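/- There are a deterministic algorithm and constants $C>0$, $k\in\mathbb{N}$ with the following property. Let $N,r,s,T,T'$ be positive integers such that $\gcd(N,s)=1$, $s\ge N^{\alpha}$ for some real $0<\alpha<\tfrac12$, and $$4^{\sqrt{(\log N)/r}}\le T\le T'\le N^{1/r}.$$ Given $N,r,s,T,T'$ (but not $\alpha$), the algorithm outputs a list of exactly those integers $p$ in the interval $[T,T']$ that satisfy both $p^r\mid N$ and $p\equiv 1\pmod s$. For every such $\alpha$, its running time is at most $$\left(1+\frac{T'-T}{T}\cdot N^{\theta(1-\theta)/r-\alpha}\right)\cdot C\,(1+\log N)^k,\qquad \theta:=\frac{r\log T}{\log N}$$ (for $N=1$, where $T=T'=1$, the value of $\theta$ does not matter). Here $\log$ is the natural logarithm, and running time is measured in bit operations: the algorithm is a fixed program for a random access machine with logarithmic cost, whose inputs are given in binary and on which every operation is charged according to the bit lengths of all the numbers and addresses involved. -/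

import Mathlib

/-! ## A random access machine with logarithmic (bit) cost

Programs are structured `while` programs over integer variables and integer arrays. Each operation
is charged according to the bit lengths of all numbers that take part in it (values as well as array
indices); multiplication and division are charged the product of the bit lengths. -/

namespace BitRAM

/-- The number of bits of the absolute value of an integer, plus one. -/
def len (z : ℤ) : ℕ := z.natAbs.size + 1

/-- A machine state: integer variables, integer arrays and the list of numbers output so far.
A program mentions only finitely many variables and arrays. -/
structure State where
  var : ℕ → ℤ
  arr : ℕ → ℤ → ℤ
  out : List ℤ

/-- Arithmetic expressions. -/
inductive Expr : Type where
  | const (z : ℤ)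
  | var (x : ℕ)
  | get (a : ℕ) (i : Expr)
  | add (e f : Expr)
  | sub (e f : Expr)
  | mul (e f : Expr)
  | div (e f : Expr)
  | mod (e f : Expr)

/-- The value of an expression. Division is Euclidean division; `x / 0 = 0` and `x % 0 = x`. -/
def Expr.eval (σ : State) : Expr → ℤ
  | .const z => z
  | .var x => σ.var x
  | .get a i => σ.arr a (i.eval σ)
  | .add e f => e.eval σ + f.eval σ
  | .sub e f => e.eval σ - f.eval σ
  | .mul e f => e.eval σ * f.eval σ
  | .div e f => e.eval σ / f.eval σ
  | .mod e f => e.eval σ % f.eval σ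

/-- The number of bit operations charged for evaluating an expression. -/
def Expr.cost (σ : State) : Expr → ℕ
  | .const z => len z
  | .var x => len (σ.var x)
  | .get a i => i.cost σ + len (i.eval σ) + len (σ.arr a (i.eval σ))
  | .add e f => e.cost σ + f.cost σ + len (e.eval σ) + len (f.eval σ)
  | .sub e f => e.cost σ + f.cost σ + len (e.eval σ) + len (f.eval σ)
  | .mul e f => e.cost σ + f.cost σ + len (e.eval σ) * len (f.eval σ)
  | .div e f => e.cost σ + f.cost σ + len (e.eval σ) * len (f.eval σ)
  | .mod e f => e.cost σ + f.cost σ + len (e.eval σ) * len (f.eval σ)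

/-- Programs. The tests of `ite` and `while` ask whether the value of the expression is positive. -/
inductive Prog : Type where
  | skip
  | assign (x : ℕ) (e : Expr)
  | store (a : ℕ) (i e : Expr)
  | write (e : Expr)
  | seq (p q : Prog)
  | ite (e : Expr) (p q : Prog)
  | while (e : Expr) (p : Prog)

/-- Effect of assigning the value `z` to the variable `x`. -/
def State.setVar (σ : State) (x : ℕ) (z : ℤ) : State :=
  { σ with var := Function.update σ.var x z }

/-- Effect of storing the value `z` in cell `i` of the array `a`. -/
def State.setArr (σ : State) (a : ℕ) (i z : ℤ) : State :=
  { σ with arr := Function.update σ.arr a (Function.update (σ.arr a) i z) }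

/-- Effect of appending the number `z` to the output. -/
def State.push (σ : State) (z : ℤ) : State :=
  { σ with out := σ.out ++ [z] }

/-- `Exec p σ τ t`: started in the state `σ`, the program `p` halts in the state `τ`, and the total
charge of the run is `t`. -/
inductive Exec : Prog → State → State → ℕ → Prop where
  | skip (σ : State) : Exec .skip σ σ 1
  | assign (σ : State) (x : ℕ) (e : Expr) :
      Exec (.assign x e) σ (σ.setVar x (e.eval σ)) (e.cost σ + len (e.eval σ))
  | store (σ : State) (a : ℕ) (i e : Expr) :
      Exec (.store a i e) σ (σ.setArr a (i.eval σ) (e.eval σ))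
        (i.cost σ + e.cost σ + len (i.eval σ) + len (e.eval σ))
  | write (σ : State) (e : Expr) :
      Exec (.write e) σ (σ.push (e.eval σ)) (e.cost σ + len (e.eval σ))
  | seq {σ τ ρ : State} {p q : Prog} {t u : ℕ} :
      Exec p σ τ t → Exec q τ ρ u → Exec (.seq p q) σ ρ (t + u)
  | ite_pos {σ τ : State} {e : Expr} {p q : Prog} {t : ℕ} :
      0 < e.eval σ → Exec p σ τ t → Exec (.ite e p q) σ τ (e.cost σ + len (e.eval σ) + t)
  | ite_neg {σ τ : State} {e : Expr} {p q : Prog} {t : ℕ} :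
      ¬ 0 < e.eval σ → Exec q σ τ t → Exec (.ite e p q) σ τ (e.cost σ + len (e.eval σ) + t)
  | while_pos {σ τ ρ : State} {e : Expr} {p : Prog} {t u : ℕ} :
      0 < e.eval σ → Exec p σ τ t → Exec (.while e p) τ ρ u →
        Exec (.while e p) σ ρ (e.cost σ + len (e.eval σ) + t + u)
  | while_neg {σ : State} {e : Expr} {p : Prog} :
      ¬ 0 < e.eval σ → Exec (.while e p) σ σ (e.cost σ + len (e.eval σ))

/-- The machine is deterministic: a program has at most one run from a given state. -/
theorem Exec.deterministic {p : Prog} {σ τ τ' : State} {t t' : ℕ}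
    (h : Exec p σ τ t) (h' : Exec p σ τ' t') : τ = τ' ∧ t = t' := by
  induction h generalizing τ' t' with
  | skip | assign | store | write => cases h'; exact ⟨rfl, rfl⟩
  | seq _ _ ih₁ ih₂ =>
    cases h' with
    | seq h₁ h₂ =>
      obtain ⟨rfl, rfl⟩ := ih₁ h₁
      obtain ⟨rfl, rfl⟩ := ih₂ h₂
      exact ⟨rfl, rfl⟩
  | ite_pos hc _ ih =>
    cases h' with
    | ite_pos _ h₁ => obtain ⟨rfl, rfl⟩ := ih h₁; exact ⟨rfl, rfl⟩
    | ite_neg hn _ => exact absurd hc hn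
  | ite_neg hc _ ih =>
    cases h' with
    | ite_pos hn _ => exact absurd hn hc
    | ite_neg _ h₁ => obtain ⟨rfl, rfl⟩ := ih h₁; exact ⟨rfl, rfl⟩
  | while_pos hc _ _ ih₁ ih₂ =>
    cases h' with
    | while_pos _ h₁ h₂ =>
      obtain ⟨rfl, rfl⟩ := ih₁ h₁
      obtain ⟨rfl, rfl⟩ := ih₂ h₂
      exact ⟨rfl, rfl⟩
    | while_neg hn => exact absurd hc hn
  | while_neg hc =>
    cases h' with
    | while_pos hn _ _ => exact absurd hn hc
    | while_neg _ => exact ⟨rfl, rfl⟩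

/-- The binary expansion of `n` as an array, least significant bit in cell `0`: a cell holds `1` for
the bit `0`, `2` for the bit `1`, and `0` (blank) outside of the expansion. -/
def binary (n : ℕ) (j : ℤ) : ℤ :=
  if 0 ≤ j ∧ j < n.size then (if n.testBit j.toNat then 2 else 1) else 0

/-- The initial state for a list of natural numbers as input: the `i`-th number is given in binary in
the array `i`; all variables and all other arrays are zero, and nothing has been output. -/
def input (l : List ℕ) : State where
  var := fun _ => 0
  arr := fun i => binary (l.getD i 0)
  out := []

end BitRAM

/-- The exponent `θ = r log T / log N`, for which `T = N ^ (θ / r)`. -/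
noncomputable def theta (N r T : ℕ) : ℝ := r * Real.log T / Real.log N

/-! Write p = 1 + s x and let u be an inverse of s modulo N. If p divides N, then p divides u + x
(`dvd_shift`). So the task is to find the small x at which a linear polynomial is divisible by p,
where p ^ r divides N: the setting of Coppersmith's lattice method.

The range of x is cut into blocks x = X + y with 0 ≤ y < H. Put a = (u + X) mod N and let m be the
bit length of N. For i < d the polynomials N ^ max(m - ⌊i / r⌋, 0) * (a + y) ^ i take values
divisible by p ^ (r m) at every wanted y (`entry_mem_lattice`). Their coefficients with respect to y
/ H form a triangular lattice basis. LLL reduction (`lllProg_spec`) finds a nonzero lattice vector w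
with |w| ^ (2 d) ≤ 2 ^ (d (d - 1) / 2) * det ^ 2. If N ^ m ≤ T ^ d and d * (2 H) ^ d ≤ T ^ (r (m -
1)), then by `det_lt` this vector is so short that its polynomial is smaller than p ^ (r m) on the
block. Being divisible by p ^ (r m), it vanishes at every wanted y (`eval_eq_zero`). If no H
satisfying the second condition is available, H is 1 and a block is a single point.

It remains to find the integer roots of one polynomial f of degree less than d. At integers, g = 1 -
f ^ 2 is positive exactly at the roots. The difference of g of order 2 d - 1 vanishes. Where a
difference of order k + 1 has constant sign, the one of order k is monotone and changes sign at most
once, so bisection produces breakpoints for all orders down to 0 (`segments_of_cell`,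
`bisectProg_spec`). A segment on which g is positive consists of roots, hence is short, and the
roots lie less than d to the right of a breakpoint (`exists_candidate`). Every candidate is tested
before it is output, so only completeness depends on the lattice argument.

For the running time, d is chosen least with N ^ m ≤ T ^ d, and H is a power of two with T ^ (r (m -
1)) < d * (4 H) ^ d. Taking logarithms gives H ≥ N ^ (θ ^ 2 / r) / (4 e ^ 3) (`log_bound`,
`exp_log_bound`). Together with T = N ^ (θ / r) and s ≥ N ^ α this bounds (T' - T) / (H s), and so
the number of blocks. The work per block is polynomial in log N, because all inner loop counts and
all bit lengths are at most `cap n`. This is tracked by `Ev`, a Hoare triple whose cost bound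
`Prog.fuel` is read off from the syntax; only the outer loop over the blocks needs its own count. -/

namespace BitRAM

/-! ### Notation for expressions and programs -/

instance : Add Expr := ⟨.add⟩
instance : Sub Expr := ⟨.sub⟩
instance : Mul Expr := ⟨.mul⟩
instance : Div Expr := ⟨.div⟩
instance : Mod Expr := ⟨.mod⟩
instance (n : ℕ) : OfNat Expr n := ⟨.const n⟩

/-- The variable `x` as an expression. -/
abbrev v (x : ℕ) : Expr := .var x

@[simp] theorem eval_add (σ : State) (e f : Expr) : (e + f).eval σ = e.eval σ + f.eval σ := rfl
@[simp] theorem eval_sub (σ : State) (e f : Expr) : (e - f).eval σ = e.eval σ - f.eval σ := rfl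
@[simp] theorem eval_mul (σ : State) (e f : Expr) : (e * f).eval σ = e.eval σ * f.eval σ := rfl
@[simp] theorem eval_div (σ : State) (e f : Expr) : (e / f).eval σ = e.eval σ / f.eval σ := rfl
@[simp] theorem eval_mod (σ : State) (e f : Expr) : (e % f).eval σ = e.eval σ % f.eval σ := rfl
@[simp] theorem eval_zero (σ : State) : (0 : Expr).eval σ = 0 := rfl
@[simp] theorem eval_one (σ : State) : (1 : Expr).eval σ = 1 := rfl
@[simp] theorem eval_ofNat (σ : State) (n : ℕ) [n.AtLeastTwo] :
    (ofNat(n) : Expr).eval σ = (ofNat(n) : ℤ) := rfl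
@[simp] theorem eval_var (σ : State) (x : ℕ) : (Expr.var x).eval σ = σ.var x := rfl
@[simp] theorem eval_get (σ : State) (a : ℕ) (e : Expr) :
    (Expr.get a e).eval σ = σ.arr a (e.eval σ) := rfl

@[simp] theorem setVar_var (σ : State) (x y : ℕ) (z : ℤ) :
    (σ.setVar x z).var y = if y = x then z else σ.var y := by
  simp [State.setVar, Function.update_apply]
@[simp] theorem setVar_arr (σ : State) (x : ℕ) (z : ℤ) : (σ.setVar x z).arr = σ.arr := rfl
@[simp] theorem setVar_out (σ : State) (x : ℕ) (z : ℤ) : (σ.setVar x z).out = σ.out := rfl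
@[simp] theorem setArr_var (σ : State) (a : ℕ) (i z : ℤ) : (σ.setArr a i z).var = σ.var := rfl
@[simp] theorem setArr_out (σ : State) (a : ℕ) (i z : ℤ) : (σ.setArr a i z).out = σ.out := rfl
@[simp] theorem setArr_arr (σ : State) (a b : ℕ) (i z : ℤ) :
    (σ.setArr a i z).arr b = if b = a then Function.update (σ.arr a) i z else σ.arr b := by
  by_cases h : b = a
  · subst h; simp [State.setArr]
  · simp [State.setArr, h]
theorem setArr_arr_self (σ : State) (a : ℕ) (i z : ℤ) :
    (σ.setArr a i z).arr a = Function.update (σ.arr a) i z := by simp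
@[simp] theorem push_var (σ : State) (z : ℤ) : (σ.push z).var = σ.var := rfl
@[simp] theorem push_arr (σ : State) (z : ℤ) : (σ.push z).arr = σ.arr := rfl
@[simp] theorem push_out (σ : State) (z : ℤ) : (σ.push z).out = σ.out ++ [z] := rfl

/-- Sequential composition of a list of programs. -/
def block : List Prog → Prog
  | [] => .skip
  | p :: l => .seq p (block l)

/-- `for x in 0, …, n - 1 do p`. -/
def forLoop (x : ℕ) (n : Expr) (p : Prog) : Prog :=
  .seq (.assign x 0) (.while (n - v x) (.seq p (.assign x (v x + 1))))

/-! ### Which variables and arrays a program may change -/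

/-- Whether a program may change the variable `y`. -/
def Prog.touchesVar (y : ℕ) : Prog → Bool
  | .skip => false
  | .assign x _ => x == y
  | .store _ _ _ => false
  | .write _ => false
  | .seq p q => p.touchesVar y || q.touchesVar y
  | .ite _ p q => p.touchesVar y || q.touchesVar y
  | .while _ p => p.touchesVar y

/-- Whether a program may change the array `b`. -/
def Prog.touchesArr (b : ℕ) : Prog → Bool
  | .skip => false
  | .assign _ _ => false
  | .store a _ _ => a == b
  | .write _ => false
  | .seq p q => p.touchesArr b || q.touchesArr b
  | .ite _ p q => p.touchesArr b || q.touchesArr b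
  | .while _ p => p.touchesArr b

/-- Whether a program may output something. -/
def Prog.writes : Prog → Bool
  | .skip => false
  | .assign _ _ => false
  | .store _ _ _ => false
  | .write _ => true
  | .seq p q => p.writes || q.writes
  | .ite _ p q => p.writes || q.writes
  | .while _ p => p.writes

/-- The two states agree on everything that the program `p` cannot change. -/
structure Same (p : Prog) (σ τ : State) : Prop where
  var : ∀ x, p.touchesVar x = false → τ.var x = σ.var x
  arr : ∀ a, p.touchesArr a = false → τ.arr a = σ.arr a
  out : p.writes = false → τ.out = σ.out

theorem Same.refl (p : Prog) (σ : State) : Same p σ σ := ⟨fun _ _ => rfl, fun _ _ => rfl, fun _ => rfl⟩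

theorem Same.trans {p : Prog} {σ τ ρ : State} (h : Same p σ τ) (h' : Same p τ ρ) : Same p σ ρ :=
  ⟨fun x hx => (h'.var x hx).trans (h.var x hx), fun x hx => (h'.arr x hx).trans (h.arr x hx),
    fun hx => (h'.out hx).trans (h.out hx)⟩

theorem Same.mono {p q : Prog} {σ τ : State} (h : Same p σ τ)
    (h₁ : ∀ x, q.touchesVar x = false → p.touchesVar x = false)
    (h₂ : ∀ x, q.touchesArr x = false → p.touchesArr x = false)
    (h₃ : q.writes = false → p.writes = false) : Same q σ τ :=
  ⟨fun x hx => h.var x (h₁ x hx), fun x hx => h.arr x (h₂ x hx), fun hx => h.out (h₃ hx)⟩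

/-- This is the frame rule. Since `touchesVar` and `touchesArr` compute on the syntax, its side
conditions for concrete programs are discharged by `rfl`. -/
theorem Exec.same {p : Prog} {σ τ : State} {t : ℕ} (h : Exec p σ τ t) : Same p σ τ := by
  induction h with
  | skip => exact Same.refl _ _
  | assign σ x e =>
    refine ⟨fun y hy => ?_, fun _ _ => rfl, fun _ => rfl⟩
    have : y ≠ x := by rintro rfl; simp [Prog.touchesVar] at hy
    simp [this]
  | store σ a i e =>
    refine ⟨fun _ _ => rfl, fun y hy => ?_, fun _ => rfl⟩
    have : y ≠ a := by rintro rfl; simp [Prog.touchesArr] at hy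
    simp [this]
  | write σ e => exact ⟨fun _ _ => rfl, fun _ _ => rfl, fun h => by simp [Prog.writes] at h⟩
  | seq _ _ h₁ h₂ =>
    refine Same.trans (h₁.mono ?_ ?_ ?_) (h₂.mono ?_ ?_ ?_) <;>
      simp +contextual [Prog.touchesVar, Prog.touchesArr, Prog.writes]
  | ite_pos _ _ h₁ =>
    refine h₁.mono ?_ ?_ ?_ <;> simp +contextual [Prog.touchesVar, Prog.touchesArr, Prog.writes]
  | ite_neg _ _ h₁ =>
    refine h₁.mono ?_ ?_ ?_ <;> simp +contextual [Prog.touchesVar, Prog.touchesArr, Prog.writes]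
  | while_pos _ _ _ h₁ h₂ =>
    exact Same.trans (h₁.mono (fun _ h => h) (fun _ h => h) (fun h => h)) h₂
  | while_neg => exact Same.refl _ _

/-! ### Cost of expressions in bounded states -/

/-- All numbers in the state are at most `2 ^ B` in absolute value. -/
def Bdd (B : ℕ) (σ : State) : Prop :=
  (∀ x, |σ.var x| ≤ 2 ^ B) ∧ ∀ a i, |σ.arr a i| ≤ 2 ^ B

theorem natAbs_le_of_abs_le {z : ℤ} {n : ℕ} (h : |z| ≤ n) : z.natAbs ≤ n := by
  rw [Int.abs_eq_natAbs] at h; exact_mod_cast h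

theorem len_le_of_abs_le {z : ℤ} {B : ℕ} (h : |z| ≤ 2 ^ B) : len z ≤ B + 2 := by
  have h' : z.natAbs ≤ 2 ^ B := natAbs_le_of_abs_le (by exact_mod_cast h)
  have : z.natAbs.size ≤ B + 1 := Nat.size_le.2 (lt_of_le_of_lt h' (Nat.pow_lt_pow_right (by norm_num) (by omega)))
  unfold len; omega

theorem len_pos (z : ℤ) : 1 ≤ len z := by unfold len; omega

theorem len_le_of_natAbs_le {a b : ℤ} (h : a.natAbs ≤ b.natAbs) : len a ≤ len b := by
  unfold len; have := Nat.size_le_size h; omega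

theorem len_add_le (a b : ℤ) : len (a + b) ≤ len a + len b := by
  have h := Int.natAbs_add_le a b
  have ha := Nat.lt_size_self a.natAbs
  have hb := Nat.lt_size_self b.natAbs
  have : (a + b).natAbs.size ≤ a.natAbs.size + b.natAbs.size + 1 := by
    apply Nat.size_le.2
    have h1 := Nat.one_le_two_pow (n := a.natAbs.size)
    have h2 := Nat.one_le_two_pow (n := b.natAbs.size)
    rw [pow_succ, pow_add]
    nlinarith
  unfold len; omega

theorem len_mul_le (a b : ℤ) : len (a * b) ≤ len a + len b := by
  have ha := Nat.lt_size_self a.natAbs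
  have hb := Nat.lt_size_self b.natAbs
  have : (a * b).natAbs.size ≤ a.natAbs.size + b.natAbs.size := by
    apply Nat.size_le.2
    rw [Int.natAbs_mul, pow_add]
    exact Nat.mul_lt_mul'' ha hb
  unfold len; omega

theorem len_neg (a : ℤ) : len (-a) = len a := by simp [len]

theorem len_sub_le (a b : ℤ) : len (a - b) ≤ len a + len b := by
  rw [sub_eq_add_neg, ← len_neg b]; exact len_add_le _ _

theorem len_div_le (a b : ℤ) : len (a / b) ≤ len a + len b :=
  (len_le_of_natAbs_le (Int.natAbs_ediv_le_natAbs a b)).trans (Nat.le_add_right _ _)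

theorem len_mod_le (a b : ℤ) : len (a % b) ≤ len a + len b := by
  rcases eq_or_ne b 0 with rfl | hb
  · simp
  · refine le_trans (len_le_of_natAbs_le ?_) (Nat.le_add_left _ _)
    have h1 := Int.emod_nonneg a hb
    have h2 := Int.emod_lt_abs a hb
    exact Int.natAbs_le_iff_mul_self_le.2 (by
      rw [← abs_mul_abs_self b]; exact mul_self_le_mul_self h1 h2.le)

/-- A weight that controls length and cost of an expression. -/
def Expr.wt : Expr → ℕ
  | .const z => len z
  | .var _ => 2
  | .get _ i => i.wt + 2
  | .add e f => e.wt + f.wt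
  | .sub e f => e.wt + f.wt
  | .mul e f => e.wt + f.wt
  | .div e f => e.wt + f.wt
  | .mod e f => e.wt + f.wt

theorem Expr.wt_pos (e : Expr) : 1 ≤ e.wt := by
  induction e <;> simp only [Expr.wt] <;> first | exact len_pos _ | omega

theorem Expr.len_eval_le {B : ℕ} {σ : State} (h : Bdd B σ) (e : Expr) :
    len (e.eval σ) ≤ e.wt * (B + 1) := by
  induction e with
  | const z => exact Nat.le_mul_of_pos_right _ (by omega)
  | var x => have := len_le_of_abs_le (h.1 x); simp only [Expr.eval, Expr.wt]; omega
  | get a i _ =>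
    have := len_le_of_abs_le (h.2 a (i.eval σ)); simp only [Expr.eval, Expr.wt]; nlinarith
  | add e f he hf => exact (len_add_le _ _).trans (by simp only [Expr.wt]; linarith)
  | sub e f he hf => exact (len_sub_le _ _).trans (by simp only [Expr.wt]; linarith)
  | mul e f he hf => exact (len_mul_le _ _).trans (by simp only [Expr.wt]; linarith)
  | div e f he hf => exact (len_div_le _ _).trans (by simp only [Expr.wt]; linarith)
  | mod e f he hf => exact (len_mod_le _ _).trans (by simp only [Expr.wt]; linarith)

/-- The charge of a binary operation is at most the sum or the product of the operand lengths, which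
the cross term of (a + b) ^ 2 absorbs. So the cost of the operands plus the charge stays below the
square of the added weights. -/
theorem Expr.cost_le {B : ℕ} {σ : State} (h : Bdd B σ) (e : Expr) :
    e.cost σ ≤ (e.wt * (B + 1)) ^ 2 := by
  have key : ∀ a b x y : ℕ, 1 ≤ a → 1 ≤ b → x ≤ a ^ 2 → y ≤ b ^ 2 →
      x + y + a + b ≤ (a + b) ^ 2 ∧ x + y + a * b ≤ (a + b) ^ 2 := by
    intro a b x y ha hb hx hy
    constructor <;> nlinarith
  have W : ∀ e : Expr, 1 ≤ e.wt * (B + 1) := fun e => Nat.mul_pos e.wt_pos (by omega)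
  induction e with
  | const z => 
    have h1 := W (.const z)
    simp only [Expr.wt, Expr.cost] at *
    nlinarith
  | var x =>
    have := len_le_of_abs_le (h.1 x); simp only [Expr.cost, Expr.wt]; nlinarith
  | get a i hi =>
    have h1 := len_le_of_abs_le (h.2 a (i.eval σ))
    have h2 := Expr.len_eval_le h i
    have h3 := W i
    simp only [Expr.cost, Expr.wt]
    rw [add_mul]
    nlinarith
  | add e f he hf =>
    have := (key _ _ _ _ (W e) (W f) he hf).1
    have h2 := Expr.len_eval_le h e
    have h3 := Expr.len_eval_le h f
    simp only [Expr.cost, Expr.wt]; rw [add_mul]; omega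
  | sub e f he hf =>
    have := (key _ _ _ _ (W e) (W f) he hf).1
    have h2 := Expr.len_eval_le h e
    have h3 := Expr.len_eval_le h f
    simp only [Expr.cost, Expr.wt]; rw [add_mul]; omega
  | mul e f he hf =>
    have := (key _ _ _ _ (W e) (W f) he hf).2
    have h2 := Nat.mul_le_mul (Expr.len_eval_le h e) (Expr.len_eval_le h f)
    simp only [Expr.cost, Expr.wt]; rw [add_mul]; omega
  | div e f he hf =>
    have := (key _ _ _ _ (W e) (W f) he hf).2
    have h2 := Nat.mul_le_mul (Expr.len_eval_le h e) (Expr.len_eval_le h f)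
    simp only [Expr.cost, Expr.wt]; rw [add_mul]; omega
  | mod e f he hf =>
    have := (key _ _ _ _ (W e) (W f) he hf).2
    have h2 := Nat.mul_le_mul (Expr.len_eval_le h e) (Expr.len_eval_le h f)
    simp only [Expr.cost, Expr.wt]; rw [add_mul]; omega

/-- A bound for the cost of an expression together with the length of its value. -/
def Expr.fuel (B : ℕ) (e : Expr) : ℕ := 2 * (e.wt * (B + 1)) ^ 2

theorem Expr.cost_add_len_le {B : ℕ} {σ : State} (h : Bdd B σ) (e : Expr) :
    e.cost σ + len (e.eval σ) ≤ e.fuel B := by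
  have h1 := Expr.cost_le h e
  have h2 := Expr.len_eval_le h e
  unfold Expr.fuel
  nlinarith

/-- A bound for the cost of a program all of whose loops run at most `R` times and which visits only
states bounded by `2 ^ B`. -/
def Prog.fuel (R B : ℕ) : Prog → ℕ
  | .skip => 1
  | .assign _ e => e.fuel B
  | .store _ i e => i.fuel B + e.fuel B
  | .write e => e.fuel B
  | .seq p q => p.fuel R B + q.fuel R B
  | .ite e p q => e.fuel B + p.fuel R B + q.fuel R B
  | .while e p => (R + 1) * (e.fuel B + p.fuel R B)

/-- The exponent depends only on the program text: every branching or loop raises it by a constant.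
This is why a fixed program with polynomially bounded R and B runs in polynomial time. -/
theorem Prog.fuel_le (p : Prog) : ∃ C k : ℕ, ∀ R B : ℕ, p.fuel R B ≤ C * ((R + 1) * (B + 1)) ^ k := by
  have he : ∀ e : Expr, ∀ R B k : ℕ, 2 ≤ k → e.fuel B ≤ 2 * e.wt ^ 2 * ((R + 1) * (B + 1)) ^ k := by
    intro e R B k hk
    unfold Expr.fuel
    calc 2 * (e.wt * (B + 1)) ^ 2 = 2 * e.wt ^ 2 * (B + 1) ^ 2 := by ring
      _ ≤ 2 * e.wt ^ 2 * ((R + 1) * (B + 1)) ^ 2 := by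
        gcongr; nlinarith
      _ ≤ _ := by gcongr; nlinarith
  have mono : ∀ {C k k' x : ℕ}, 1 ≤ x → k ≤ k' → C * x ^ k ≤ C * x ^ k' := by
    intro C k k' x hx hk; gcongr
  have pos : ∀ R B : ℕ, 1 ≤ (R + 1) * (B + 1) := fun R B => Nat.mul_pos (by omega) (by omega)
  induction p with
  | skip => exact ⟨1, 0, fun R B => by simp [Prog.fuel]⟩
  | assign x e => exact ⟨_, 2, fun R B => he e R B 2 le_rfl⟩
  | store a i e =>
    refine ⟨2 * i.wt ^ 2 + 2 * e.wt ^ 2, 2, fun R B => ?_⟩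
    rw [add_mul]; exact add_le_add (he i R B 2 le_rfl) (he e R B 2 le_rfl)
  | write e => exact ⟨_, 2, fun R B => he e R B 2 le_rfl⟩
  | seq p q hp hq =>
    obtain ⟨C, k, h⟩ := hp
    obtain ⟨C', k', h'⟩ := hq
    refine ⟨C + C', k + k', fun R B => ?_⟩
    rw [add_mul]
    exact add_le_add ((h R B).trans (mono (pos R B) (by omega)))
      ((h' R B).trans (mono (pos R B) (by omega)))
  | ite e p q hp hq =>
    obtain ⟨C, k, h⟩ := hp
    obtain ⟨C', k', h'⟩ := hq
    refine ⟨2 * e.wt ^ 2 + C + C', k + k' + 2, fun R B => ?_⟩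
    rw [add_mul, add_mul]
    exact add_le_add (add_le_add (he e R B _ (by omega)) ((h R B).trans (mono (pos R B) (by omega))))
      ((h' R B).trans (mono (pos R B) (by omega)))
  | _ e p hp =>
    obtain ⟨C, k, h⟩ := hp
    refine ⟨2 * e.wt ^ 2 + C, k + 2 + 1, fun R B => ?_⟩
    have h1 : e.fuel B + p.fuel R B ≤ (2 * e.wt ^ 2 + C) * ((R + 1) * (B + 1)) ^ (k + 2) := by
      rw [add_mul]
      exact add_le_add (he e R B _ (by omega)) ((h R B).trans (mono (pos R B) (by omega)))
    have h2 : R + 1 ≤ (R + 1) * (B + 1) := Nat.le_mul_of_pos_right _ (by omega)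
    calc (R + 1) * (e.fuel B + p.fuel R B)
        ≤ ((R + 1) * (B + 1)) * ((2 * e.wt ^ 2 + C) * ((R + 1) * (B + 1)) ^ (k + 2)) :=
          Nat.mul_le_mul h2 h1
      _ = _ := by ring

/-! ### Program logic -/

/-- From the bounded state `σ` the program `p` runs with cost at most `t` to a bounded state that
satisfies `Q`. -/
def Run (B : ℕ) (p : Prog) (σ : State) (t : ℕ) (Q : State → Prop) : Prop :=
  Bdd B σ → ∃ τ t', Exec p σ τ t' ∧ t' ≤ t ∧ Bdd B τ ∧ Q τ

/-- `Run` with the cost bound `Prog.fuel`. -/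
def Ev (R B : ℕ) (p : Prog) (σ : State) (Q : State → Prop) : Prop :=
  Run B p σ (p.fuel R B) Q

theorem Bdd.setVar {B : ℕ} {σ : State} (h : Bdd B σ) {x : ℕ} {z : ℤ} (hz : |z| ≤ 2 ^ B) :
    Bdd B (σ.setVar x z) := by
  refine ⟨fun y => ?_, h.2⟩
  rw [setVar_var]; split_ifs
  · exact hz
  · exact h.1 y

theorem Bdd.setArr {B : ℕ} {σ : State} (h : Bdd B σ) {a : ℕ} {i z : ℤ} (hz : |z| ≤ 2 ^ B) :
    Bdd B (σ.setArr a i z) := by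
  refine ⟨h.1, fun b j => ?_⟩
  rw [setArr_arr]; split_ifs
  · rw [Function.update_apply]; split_ifs
    · exact hz
    · exact h.2 a j
  · exact h.2 b j

theorem Run.seq {B : ℕ} {p q : Prog} {σ : State} {t u : ℕ} {Q : State → Prop}
    (h : Run B p σ t (fun τ => Run B q τ u Q)) : Run B (.seq p q) σ (t + u) Q := by
  intro hσ
  obtain ⟨τ, t', h1, h2, h3, h4⟩ := h hσ
  obtain ⟨ρ, u', k1, k2, k3, k4⟩ := h4 h3
  exact ⟨ρ, t' + u', .seq h1 k1, by omega, k3, k4⟩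

theorem Run.conseq {B : ℕ} {p : Prog} {σ : State} {t t' : ℕ} {P Q : State → Prop}
    (h : Run B p σ t P) (ht : t ≤ t') (hQ : ∀ τ, Same p σ τ → Bdd B τ → P τ → Q τ) :
    Run B p σ t' Q := by
  intro hσ
  obtain ⟨τ, u, h1, h2, h3, h4⟩ := h hσ
  exact ⟨τ, u, h1, h2.trans ht, h3, hQ τ h1.same h3 h4⟩

theorem Run.ite {B : ℕ} {e : Expr} {p q : Prog} {σ : State} {t : ℕ} {Q : State → Prop}
    (h1 : 0 < e.eval σ → Run B p σ t Q) (h2 : ¬ 0 < e.eval σ → Run B q σ t Q) :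
    Run B (.ite e p q) σ (e.fuel B + t) Q := by
  intro hσ
  have he := e.cost_add_len_le hσ
  by_cases hc : 0 < e.eval σ
  · obtain ⟨τ, u, k1, k2, k3, k4⟩ := h1 hc hσ
    exact ⟨τ, _, .ite_pos hc k1, by omega, k3, k4⟩
  · obtain ⟨τ, u, k1, k2, k3, k4⟩ := h2 hc hσ
    exact ⟨τ, _, .ite_neg hc k1, by omega, k3, k4⟩

/-- The invariant is indexed by the number of completed rounds. Termination comes from `hstep`,
which must show k < n whenever the guard holds. The frame condition `Same p σ τ` is carried along,
so invariants need only mention what the body changes. -/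
theorem Run.while {B n t : ℕ} {e : Expr} {p : Prog} {σ : State} {Q : State → Prop}
    {I : ℕ → State → Prop} (h0 : I 0 σ)
    (hstep : ∀ k τ, Bdd B τ → Same p σ τ → I k τ → 0 < e.eval τ → k < n ∧ Run B p τ t (I (k + 1)))
    (hend : ∀ k τ, Bdd B τ → Same p σ τ → I k τ → ¬ 0 < e.eval τ → Q τ) :
    Run B (.while e p) σ ((n + 1) * (e.fuel B + t)) Q := by
  have main : ∀ j k τ, n - k = j → Bdd B τ → Same p σ τ → I k τ →
      ∃ ρ u, Exec (.while e p) τ ρ u ∧ u ≤ j * (e.fuel B + t) + e.fuel B ∧ Bdd B ρ ∧ Q ρ := by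
    intro j
    induction j with
    | zero =>
      intro k τ hk hB hS hI
      by_cases hc : 0 < e.eval τ
      · have := (hstep k τ hB hS hI hc).1; omega
      · exact ⟨τ, _, .while_neg hc, by simpa using e.cost_add_len_le hB, hB, hend k τ hB hS hI hc⟩
    | succ j ih =>
      intro k τ hk hB hS hI
      by_cases hc : 0 < e.eval τ
      · obtain ⟨hkn, hr⟩ := hstep k τ hB hS hI hc
        obtain ⟨ρ, u, k1, k2, k3, k4⟩ := hr hB
        obtain ⟨ρ', u', m1, m2, m3, m4⟩ := ih (k + 1) ρ (by omega) k3 (hS.trans k1.same) k4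
        refine ⟨ρ', _, .while_pos hc k1 m1, ?_, m3, m4⟩
        have := e.cost_add_len_le hB
        rw [add_mul]; omega
      · refine ⟨τ, _, .while_neg hc, ?_, hB, hend k τ hB hS hI hc⟩
        have := e.cost_add_len_le hB
        exact this.trans (Nat.le_add_left _ _)
  intro hσ
  obtain ⟨τ, u, h1, h2, h3, h4⟩ := main n 0 σ (by omega) hσ (Same.refl _ _) h0
  refine ⟨τ, u, h1, ?_, h3, h4⟩
  rw [add_mul]; omega

variable {R B : ℕ} {σ : State} {Q : State → Prop}

theorem Ev.skip (h : Q σ) : Ev R B .skip σ Q :=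
  fun hσ => ⟨σ, 1, .skip σ, le_rfl, hσ, h⟩

theorem Ev.assign {x : ℕ} {e : Expr} (z : ℤ) (hz : e.eval σ = z)
    (hb : Bdd B σ → |z| ≤ 2 ^ B) (h : Q (σ.setVar x z)) : Ev R B (.assign x e) σ Q := by
  subst hz
  exact fun hσ => ⟨_, _, .assign σ x e, e.cost_add_len_le hσ, hσ.setVar (hb hσ), h⟩

theorem Ev.store {a : ℕ} {i e : Expr} (j z : ℤ) (hj : i.eval σ = j) (hz : e.eval σ = z)
    (hb : Bdd B σ → |z| ≤ 2 ^ B) (h : Q (σ.setArr a j z)) : Ev R B (.store a i e) σ Q := by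
  subst hz hj
  refine fun hσ => ⟨_, _, .store σ a i e, ?_, hσ.setArr (hb hσ), h⟩
  have h1 := e.cost_add_len_le hσ
  have h2 := i.cost_add_len_le hσ
  simp only [Prog.fuel]; omega

theorem Ev.write {e : Expr} (z : ℤ) (hz : e.eval σ = z) (h : Q (σ.push z)) :
    Ev R B (.write e) σ Q := by
  subst hz
  exact fun hσ => ⟨_, _, .write σ e, e.cost_add_len_le hσ, hσ, h⟩

theorem Ev.seq {p q : Prog} (h : Ev R B p σ (fun τ => Ev R B q τ Q)) :
    Ev R B (.seq p q) σ Q := Run.seq h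

theorem Ev.block_cons {p : Prog} {l : List Prog}
    (h : Ev R B p σ (fun τ => Ev R B (block l) τ Q)) : Ev R B (block (p :: l)) σ Q := Run.seq h

theorem Ev.block_one {p : Prog} (h : Ev R B p σ Q) : Ev R B (block [p]) σ Q :=
  Ev.block_cons (Run.conseq h le_rfl fun _ _ _ h => Ev.skip h)

theorem Ev.conseq {p : Prog} {P : State → Prop} (h : Ev R B p σ P)
    (hQ : ∀ τ, Same p σ τ → Bdd B τ → P τ → Q τ) : Ev R B p σ Q := Run.conseq h le_rfl hQ

theorem Ev.ite {e : Expr} {p q : Prog} (h1 : 0 < e.eval σ → Ev R B p σ Q)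
    (h2 : ¬ 0 < e.eval σ → Ev R B q σ Q) : Ev R B (.ite e p q) σ Q :=
  Run.conseq (t := e.fuel B + (p.fuel R B + q.fuel R B))
    (Run.ite (fun h => Run.conseq (h1 h) (by omega) fun _ _ _ h => h)
      (fun h => Run.conseq (h2 h) (by omega) fun _ _ _ h => h))
    (by simp only [Prog.fuel]; omega) fun _ _ _ h => h

theorem Ev.while {e : Expr} {p : Prog} {I : ℕ → State → Prop} (h0 : I 0 σ)
    (hstep : ∀ k τ, Bdd B τ → Same p σ τ → I k τ → 0 < e.eval τ → k < R ∧ Ev R B p τ (I (k + 1)))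
    (hend : ∀ k τ, Bdd B τ → Same p σ τ → I k τ → ¬ 0 < e.eval τ → Q τ) :
    Ev R B (.while e p) σ Q := Run.while h0 hstep hend

theorem touchesVar_forLoop {x y : ℕ} {e : Expr} {p : Prog}
    (h : (forLoop x e p).touchesVar y = false) : x ≠ y ∧ p.touchesVar y = false := by
  have h' : ¬ x = y ∧ p.touchesVar y = false ∧ ¬ x = y := by
    simpa [forLoop, Prog.touchesVar] using h
  exact ⟨h'.1, h'.2.1⟩

/-- The machine evaluates the bound `e` again before every round, so `hn` asks for its value in all
states that agree with `σ` on what the loop cannot change. In `hstep` the next invariant refers to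
the state after the counter has been increased. -/
theorem Ev.forLoop {x : ℕ} {e : Expr} {p : Prog} {I : ℕ → State → Prop} (n : ℕ) (hR : n ≤ R)
    (hB : n ≤ 2 ^ B) (hx : p.touchesVar x = false)
    (hn : ∀ τ, Same (forLoop x e p) σ τ → e.eval τ = n) (h0 : I 0 (σ.setVar x 0))
    (hstep : ∀ k < n, ∀ τ, Bdd B τ → Same (forLoop x e p) σ τ → τ.var x = k → I k τ →
      Ev R B p τ (fun ρ => I (k + 1) (ρ.setVar x (k + 1))))
    (hend : ∀ τ, Same (forLoop x e p) σ τ → τ.var x = n → I n τ → Q τ) :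
    Ev R B (forLoop x e p) σ Q := by
  have hs0 : Same (BitRAM.forLoop x e p) σ (σ.setVar x 0) := by
    refine ⟨fun y hy => ?_, fun _ _ => rfl, fun _ => rfl⟩
    simp [(touchesVar_forLoop hy).1.symm]
  have hS : ∀ {τ}, Same (p.seq (.assign x (v x + 1))) (σ.setVar x 0) τ →
      Same (BitRAM.forLoop x e p) σ τ := fun {τ} h => hs0.trans <| h.mono
    (fun y hy => by simpa [BitRAM.forLoop, Prog.touchesVar, and_comm] using hy)
    (fun y hy => by simpa [BitRAM.forLoop, Prog.touchesArr] using hy)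
    (fun hy => by simpa [BitRAM.forLoop, Prog.writes] using hy)
  refine Ev.seq (Ev.assign 0 rfl (fun _ => by simp) ?_)
  refine Ev.while (I := fun k τ => k ≤ n ∧ τ.var x = k ∧ I k τ) ⟨Nat.zero_le _, by simp, h0⟩ ?_ ?_
  · rintro k τ hτ hs ⟨hk, hxk, hI⟩ hpos
    have hlt : k < n := by
      rw [eval_sub, hn τ (hS hs)] at hpos
      simp only [eval_var, hxk] at hpos
      omega
    refine ⟨by omega, Ev.seq ((hstep k hlt τ hτ (hS hs) hxk hI).conseq ?_)⟩
    intro ρ hsρ _ hIρ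
    refine Ev.assign (k + 1) (by simp [hsρ.var x hx, hxk]) (fun _ => ?_) ⟨hlt, by simp, hIρ⟩
    have : (k : ℤ) + 1 ≤ n := by exact_mod_cast hlt
    rw [abs_of_nonneg (by omega)]
    exact this.trans (by exact_mod_cast hB)
  · rintro k τ hτ hs ⟨hk, hxk, hI⟩ hpos
    have : k = n := by
      rw [eval_sub, hn τ (hS hs)] at hpos
      simp only [eval_var, hxk] at hpos
      omega
    subst this
    exact hend τ (hS hs) hxk hI

/-- Filling the cells `0, …, n - 1` of the array `a` one after the other. -/
theorem Ev.fill {x a : ℕ} {e : Expr} {p : Prog} (P : ℕ → ℤ → Prop) (n : ℕ) (hR : n ≤ R)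
    (hB : n ≤ 2 ^ B) (hx : p.touchesVar x = false)
    (hn : ∀ τ, Same (BitRAM.forLoop x e p) σ τ → e.eval τ = n)
    (hstep : ∀ k < n, ∀ τ, Bdd B τ → Same (BitRAM.forLoop x e p) σ τ → τ.var x = k →
      (∀ m < k, P m (τ.arr a m)) → (∀ z : ℤ, z < 0 ∨ k ≤ z → τ.arr a z = σ.arr a z) →
      Ev R B p τ (fun ρ => ∃ z, ρ.arr a = Function.update (τ.arr a) k z ∧ P k z))
    (hend : ∀ τ, Same (BitRAM.forLoop x e p) σ τ → (∀ m < n, P m (τ.arr a m)) →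
      (∀ z : ℤ, z < 0 ∨ n ≤ z → τ.arr a z = σ.arr a z) → Q τ) :
    Ev R B (BitRAM.forLoop x e p) σ Q := by
  refine Ev.forLoop (I := fun k τ => (∀ m < k, P m (τ.arr a m)) ∧
    ∀ z : ℤ, z < 0 ∨ k ≤ z → τ.arr a z = σ.arr a z) n hR hB hx hn ⟨by simp, by simp⟩ ?_ ?_
  · rintro k hk τ hτ hs hxk ⟨h1, h2⟩
    refine (hstep k hk τ hτ hs hxk h1 h2).conseq ?_
    rintro ρ - - ⟨z, hz, hP⟩
    simp only [setVar_arr, hz]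
    refine ⟨fun m hm => ?_, fun y hy => ?_⟩
    · rcases Nat.lt_succ_iff_lt_or_eq.1 hm with h | rfl
      · rw [Function.update_of_ne (by omega)]; exact h1 m h
      · simpa using hP
    · rw [Function.update_of_ne (by omega)]
      exact h2 y (by omega)
  · rintro τ hs - ⟨h1, h2⟩
    exact hend τ hs h1 h2

end BitRAM

/-! ### Gram–Schmidt orthogonalization by successive projections -/

namespace LatticeReduction

variable {V : Type*} [NormedAddCommGroup V] [InnerProductSpace ℝ V]

/-- `gs b k i` is the projection of `b i` to the orthogonal complement of `b 0, …, b (k - 1)`. -/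
noncomputable def gs (b : ℕ → V) : ℕ → ℕ → V
  | 0, i => b i
  | k + 1, i => gs b k i - (inner ℝ (gs b k i) (gs b k k) / inner ℝ (gs b k k) (gs b k k)) • gs b k k

/-- Inner products of the projections. -/
noncomputable def sc (b : ℕ → V) (k i j : ℕ) : ℝ := inner ℝ (gs b k i) (gs b k j)

/-- Gram–Schmidt coefficients. -/
noncomputable def mu (b : ℕ → V) (i k : ℕ) : ℝ := sc b k i k / sc b k k k

/-- Gram determinants. -/
noncomputable def gd (b : ℕ → V) (k : ℕ) : ℝ := ∏ l ∈ Finset.range k, sc b l l l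

theorem gs_succ (b : ℕ → V) (k i : ℕ) : gs b (k + 1) i = gs b k i - mu b i k • gs b k k := rfl

theorem gd_zero (b : ℕ → V) : gd b 0 = 1 := by simp [gd]

theorem gd_succ (b : ℕ → V) (k : ℕ) : gd b (k + 1) = gd b k * sc b k k k :=
  Finset.prod_range_succ _ _

theorem sc_comm (b : ℕ → V) (k i j : ℕ) : sc b k i j = sc b k j i := real_inner_comm _ _

theorem sc_self_nonneg (b : ℕ → V) (k i : ℕ) : 0 ≤ sc b k i i := real_inner_self_nonneg

theorem mu_mul (b : ℕ → V) (i k : ℕ) : mu b i k * sc b k k k = sc b k i k := by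
  rcases eq_or_ne (sc b k k k) 0 with h | h
  · have : gs b k k = 0 := inner_self_eq_zero.1 h
    simp [sc, this]
  · exact div_mul_cancel₀ _ h

theorem sc_succ (b : ℕ → V) (k i j : ℕ) :
    sc b (k + 1) i j = sc b k i j - mu b i k * sc b k k j := by
  have h1 := mu_mul b j k
  have h2 := mu_mul b i k
  unfold sc at h1 h2 ⊢
  rw [gs_succ, gs_succ]
  simp only [inner_sub_left, inner_sub_right, real_inner_smul_left, real_inner_smul_right]
  linear_combination mu b j k * h2

theorem sc_succ_self (b : ℕ → V) (k i : ℕ) :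
    sc b (k + 1) i i = sc b k i i - mu b i k ^ 2 * sc b k k k := by
  rw [sc_succ, sc_comm b k k i, ← mu_mul]; ring

theorem sc_succ_le (b : ℕ → V) (k i : ℕ) : sc b (k + 1) i i ≤ sc b k i i := by
  rw [sc_succ_self]
  nlinarith [mul_nonneg (sq_nonneg (mu b i k)) (sc_self_nonneg b k k)]

theorem sc_le (b : ℕ → V) (k i : ℕ) : sc b k i i ≤ sc b 0 i i := by
  induction k with
  | zero => exact le_rfl
  | succ k ih => exact (sc_succ_le b k i).trans ih

theorem sc_sq_le (b : ℕ → V) (k i j : ℕ) : sc b k i j ^ 2 ≤ sc b 0 i i * sc b 0 j j := by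
  have h : sc b k i j ^ 2 ≤ sc b k i i * sc b k j j := by
    have := real_inner_mul_inner_self_le (gs b k i) (gs b k j)
    rw [sq]; exact this
  exact h.trans (mul_le_mul (sc_le b k i) (sc_le b k j) (sc_self_nonneg _ _ _) (sc_self_nonneg _ _ _))

/-- No linear independence is needed: if gs b i i is zero, division by zero gives the coefficient 0,
and the vector stays zero. -/
theorem gs_eq_zero (b : ℕ → V) {k i : ℕ} (h : i < k) : gs b k i = 0 := by
  induction k with
  | zero => omega
  | succ k ih =>
    rcases Nat.lt_succ_iff_lt_or_eq.1 h with h | rfl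
    · rw [gs_succ, ih h]; simp [mu, sc, ih h]
    · rw [gs_succ]
      rcases eq_or_ne (sc b i i i) 0 with h | h
      · have : gs b i i = 0 := inner_self_eq_zero.1 h
        simp [this]
      · simp [mu, div_self h]

theorem mu_eq_zero (b : ℕ → V) {k i : ℕ} (h : i < k) : mu b i k = 0 := by
  simp [mu, sc, gs_eq_zero b h]

theorem mu_self (b : ℕ → V) {k : ℕ} (h : sc b k k k ≠ 0) : mu b k k = 1 := div_self h

/-- Pythagoras for the successive projections. -/
theorem sc_zero_self (b : ℕ → V) (i n : ℕ) :
    sc b 0 i i = ∑ l ∈ Finset.range n, mu b i l ^ 2 * sc b l l l + sc b n i i := by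
  induction n with
  | zero => simp
  | succ n ih => rw [Finset.sum_range_succ, sc_succ_self, ih]; ring

/-- A size-reduced vector is not much longer than the Gram–Schmidt vectors. -/
theorem sc_zero_self_le {b : ℕ → V} {i : ℕ} {X : ℝ} (hX : ∀ l ≤ i, sc b l l l ≤ X)
    (hmu : ∀ l < i, |mu b i l| ≤ 1 / 2) : sc b 0 i i ≤ (i + 1) * X := by
  have hX0 : 0 ≤ X := (sc_self_nonneg b 0 0).trans (hX 0 (Nat.zero_le _))
  rw [sc_zero_self b i i, add_mul, one_mul]
  refine add_le_add ?_ (hX i le_rfl)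
  calc _ ≤ ∑ l ∈ Finset.range i, X := Finset.sum_le_sum fun l hl => ?_
    _ = _ := by simp
  have hl := Finset.mem_range.1 hl
  have h1 : mu b i l ^ 2 ≤ 1 := by
    rw [← sq_abs]; nlinarith [hmu l hl, abs_nonneg (mu b i l)]
  nlinarith [hX l hl.le, sc_self_nonneg b l l]

/-! ### Gram determinants are determinants -/

/-- Induction on n with l free. Clearing the first column by multiples of row 0 turns the entries at
level l into entries at level l + 1 by `sc_succ`, so the determinant is `sc b l l l` times the same
kind of determinant one level up. If `sc b l l l` is 0, both sides vanish. The bordered form, with a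
free last row i and column j, serves both `gd_eq_det` and the integrality of all the scaled inner
products. -/
theorem det_sc (b : ℕ → V) (n l i j : ℕ) :
    Matrix.det (Matrix.of fun s t : Fin (n + 1) =>
      sc b l (if (s : ℕ) < n then l + s else i) (if (t : ℕ) < n then l + t else j)) =
    (∏ t ∈ Finset.range n, sc b (l + t) (l + t) (l + t)) * sc b (l + n) i j := by
  induction n generalizing l with
  | zero => simp
  | succ n ih =>
    set M : Matrix (Fin (n + 2)) (Fin (n + 2)) ℝ := Matrix.of fun s t : Fin (n + 2) =>
      sc b l (if (s : ℕ) < n + 1 then l + s else i) (if (t : ℕ) < n + 1 then l + t else j) with hM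
    have hprod : (∏ t ∈ Finset.range (n + 1), sc b (l + t) (l + t) (l + t)) * sc b (l + (n + 1)) i j =
        sc b l l l * ((∏ t ∈ Finset.range n, sc b (l + 1 + t) (l + 1 + t) (l + 1 + t)) *
          sc b (l + 1 + n) i j) := by
      rw [Finset.prod_range_succ', add_zero, show l + (n + 1) = l + 1 + n by ring,
        Finset.prod_congr rfl fun t _ => by rw [show l + (t + 1) = l + 1 + t by ring]]
      ring
    rw [hprod, ← ih]
    rcases eq_or_ne (sc b l l l) 0 with h | h
    · rw [h, zero_mul]
      have h0 : gs b l l = 0 := inner_self_eq_zero.1 h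
      exact Matrix.det_eq_zero_of_row_eq_zero 0 fun t => by simp [hM, sc, h0]
    · set r : Fin (n + 2) → ℕ := fun s => if (s : ℕ) < n + 1 then l + s else i with hr
      set N : Matrix (Fin (n + 2)) (Fin (n + 2)) ℝ := Matrix.of fun s t =>
        M s t - (if s = 0 then 0 else mu b (r s) l) * M 0 t with hN
      have hdet : M.det = N.det := by
        refine Matrix.det_eq_of_forall_row_eq_smul_add_const
          (fun s => if s = 0 then 0 else mu b (r s) l) 0 (by simp) fun s t => ?_
        simp [hN]
      rw [hdet, Matrix.det_succ_column_zero, Finset.sum_eq_single 0]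
      · have e1 : N 0 0 = sc b l l l := by simp [hN, hM]
        rw [e1]
        simp only [Fin.val_zero, pow_zero, one_mul]
        congr 2
        ext s t
        simp only [hN, hM, hr, Matrix.submatrix_apply, Matrix.of_apply, Fin.zero_succAbove,
          Fin.succ_ne_zero, if_false, Fin.val_succ, Fin.val_zero, Nat.zero_lt_succ, if_true,
          add_zero, Nat.add_lt_add_iff_right]
        have hif : ∀ (s : Fin (n + 1)) (x : ℕ), (if (s : ℕ) < n then l + (s + 1) else x) =
            if (s : ℕ) < n then l + 1 + s else x := by
          intro s x; split_ifs <;> omega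
        rw [hif, hif, sc_succ]
      · intro s _ hs
        have : N s 0 = 0 := by
          simp only [hN, hM, Matrix.of_apply, hs, if_false, Fin.val_zero, Nat.zero_lt_succ, if_true,
            add_zero]
          rw [mu_mul]; simp [hr]
        rw [this]; simp
      · simp

theorem gd_eq_det (b : ℕ → V) (n : ℕ) :
    gd b n = Matrix.det (Matrix.of fun s t : Fin n => inner ℝ (b s) (b t)) := by
  cases n with
  | zero => simp [gd]
  | succ n =>
    have := det_sc b n 0 n n
    simp only [zero_add] at this
    rw [gd_succ, gd, ← this]
    congr 1
    ext s t
    have key : ∀ s : Fin (n + 1), (if (s : ℕ) < n then (s : ℕ) else n) = s := by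
      intro s; split_ifs <;> omega
    simp only [Matrix.of_apply, key]
    rfl

/-- The inner products of the projections become integral after multiplication by the Gram
determinant. -/
theorem exists_int_gd_mul_sc {b : ℕ → V} (hb : ∀ i j, ∃ z : ℤ, inner ℝ (b i) (b j) = z)
    (k i j : ℕ) : ∃ z : ℤ, gd b k * sc b k i j = z := by
  choose Z hZ using hb
  have := det_sc b k 0 i j
  simp only [zero_add] at this
  refine ⟨Matrix.det (Matrix.of fun s t : Fin (k + 1) =>
    Z (if (s : ℕ) < k then s else i) (if (t : ℕ) < k then t else j)), ?_⟩
  rw [gd, ← this]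
  refine Eq.trans ?_ (RingHom.map_det (Int.castRingHom ℝ) _).symm
  congr 1
  ext s t
  exact hZ _ _

/-! ### Elementary operations -/

section rowop

variable (b : ℕ → V) {i j : ℕ} (q : ℝ)

/-- Every initial segment of the basis that contains b i also contains b j, so its span is unchanged
and the projections at all levels are the same linear maps as before. -/
theorem gs_update (hij : j < i) (k l : ℕ) :
    gs (Function.update b i (b i - q • b j)) k l =
      if l = i then gs b k i - q • gs b k j else gs b k l := by
  induction k generalizing l with
  | zero => simp only [gs, Function.update_apply]
  | succ k ih =>
    have hkk : gs (Function.update b i (b i - q • b j)) k k = gs b k k := by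
      rw [ih]; split_ifs with h
      · subst h; rw [gs_eq_zero b hij]; simp
      · rfl
    have hmu : ∀ l, mu (Function.update b i (b i - q • b j)) l k =
        inner ℝ (gs (Function.update b i (b i - q • b j)) k l) (gs b k k) / sc b k k k := by
      intro l; simp only [mu, sc, hkk]
    rw [gs_succ, hkk, hmu, ih]
    split_ifs with h
    · rw [gs_succ, gs_succ, inner_sub_left, real_inner_smul_left, sub_div, mul_div_assoc]
      simp only [mu, sc]
      module
    · rfl

theorem gs_update_self (hij : j < i) (k : ℕ) :
    gs (Function.update b i (b i - q • b j)) k k = gs b k k := by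
  rw [gs_update b q hij]; split_ifs with h
  · subst h; rw [gs_eq_zero b hij]; simp
  · rfl

theorem sc_update_self (hij : j < i) (k : ℕ) :
    sc (Function.update b i (b i - q • b j)) k k k = sc b k k k := by
  simp only [sc, gs_update_self b q hij]

theorem gd_update (hij : j < i) (k : ℕ) :
    gd (Function.update b i (b i - q • b j)) k = gd b k := by
  simp only [gd, sc_update_self b q hij]

theorem mu_update_of_ne (hij : j < i) {l : ℕ} (hl : l ≠ i) (k : ℕ) :
    mu (Function.update b i (b i - q • b j)) l k = mu b l k := by
  simp only [mu, sc, gs_update_self b q hij, gs_update b q hij k l, if_neg hl]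

theorem mu_update (hij : j < i) (k : ℕ) :
    mu (Function.update b i (b i - q • b j)) i k = mu b i k - q * mu b j k := by
  simp only [mu, sc, gs_update_self b q hij, gs_update b q hij k i, if_true, inner_sub_left,
    real_inner_smul_left]
  ring

end rowop

section swap

variable (b : ℕ → V) (k : ℕ)

/-- At levels up to k only b 0, …, b (k - 1) are projected out, and the swap fixes these. -/
theorem gs_swap {l : ℕ} (hl : l ≤ k) (i : ℕ) :
    gs (b ∘ Equiv.swap k (k + 1)) l i = gs b l (Equiv.swap k (k + 1) i) := by
  induction l generalizing i with
  | zero => rfl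
  | succ l ih =>
    have hll : Equiv.swap k (k + 1) l = l := Equiv.swap_apply_of_ne_of_ne (by omega) (by omega)
    have := ih (by omega)
    rw [gs_succ, gs_succ]
    simp only [mu, sc, this, hll]

theorem gd_swap_of_le {l : ℕ} (hl : l ≤ k) : gd (b ∘ Equiv.swap k (k + 1)) l = gd b l := by
  unfold gd
  refine Finset.prod_congr rfl fun t ht => ?_
  have ht := Finset.mem_range.1 ht
  have htt : Equiv.swap k (k + 1) t = t := Equiv.swap_apply_of_ne_of_ne (by omega) (by omega)
  simp only [sc, gs_swap b k (show t ≤ k by omega), htt]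

theorem gd_swap_succ :
    gd (b ∘ Equiv.swap k (k + 1)) (k + 1) = gd b k * sc b k (k + 1) (k + 1) := by
  rw [gd_succ, gd_swap_of_le b k le_rfl]
  simp only [sc, gs_swap b k le_rfl, Equiv.swap_apply_left]

/-- The product form hides the symmetry. In the determinant form, permuting the vectors permutes
rows and columns simultaneously. -/
theorem gd_swap_of_lt {l : ℕ} (hl : k + 1 < l) : gd (b ∘ Equiv.swap k (k + 1)) l = gd b l := by
  rw [gd_eq_det, gd_eq_det, ← Matrix.det_submatrix_equiv_self
    (Equiv.swap (⟨k, by omega⟩ : Fin l) ⟨k + 1, hl⟩)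
    (Matrix.of fun s t : Fin l => inner ℝ (b s) (b t))]
  have key : ∀ s : Fin l, Equiv.swap k (k + 1) (s : ℕ) =
      (Equiv.swap (⟨k, by omega⟩ : Fin l) ⟨k + 1, hl⟩ s : ℕ) := by
    intro s
    simp only [Equiv.swap_apply_def, Fin.ext_iff]
    split_ifs <;> rfl
  congr 1
  ext s t
  simp [key]

end swap

/-- In a reduced basis the first vector is short. -/
theorem sc_zero_pow_le {b : ℕ → V} {d : ℕ} (h : ∀ k, k + 1 < d → sc b k k k ≤ 2 * sc b (k + 1) (k + 1) (k + 1)) :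
    sc b 0 0 0 ^ d ≤ 2 ^ (∑ l ∈ Finset.range d, l) * gd b d := by
  have h0 : ∀ l < d, sc b 0 0 0 ≤ 2 ^ l * sc b l l l := by
    intro l
    induction l with
    | zero => simp
    | succ l ih =>
      intro hl
      refine (ih (by omega)).trans ?_
      rw [pow_succ, mul_assoc]
      exact mul_le_mul_of_nonneg_left (h l hl) (by positivity)
  calc sc b 0 0 0 ^ d = ∏ l ∈ Finset.range d, sc b 0 0 0 := by simp
    _ ≤ ∏ l ∈ Finset.range d, (2 ^ l * sc b l l l) :=
        Finset.prod_le_prod (fun _ _ => sc_self_nonneg _ _ _) fun l hl => h0 l (Finset.mem_range.1 hl)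
    _ = _ := by rw [Finset.prod_mul_distrib, Finset.prod_pow_eq_pow_sum, gd]

/-- The Lovász condition gives the factor 3/4, of which the projection takes away at most mu ^ 2 ≤
1/4; the remaining 1/2 is the 2. -/
theorem le_two_mul_of_reduced {b : ℕ → V} {k : ℕ} (hmu : |mu b (k + 1) k| ≤ 1 / 2)
    (h : 3 * sc b k k k ≤ 4 * sc b k (k + 1) (k + 1)) :
    sc b k k k ≤ 2 * sc b (k + 1) (k + 1) (k + 1) := by
  rw [sc_succ_self]
  have h1 : mu b (k + 1) k ^ 2 ≤ 1 / 4 := by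
    rw [← sq_abs]; nlinarith [abs_nonneg (mu b (k + 1) k)]
  nlinarith [sc_self_nonneg b k k]

/-! ### Triangular bases -/

/-- The vectors subtracted from b i have index below i and vanish in all coordinates from i on. -/
theorem gs_apply_of_triangular {d : ℕ} {b : ℕ → EuclideanSpace ℝ (Fin d)}
    (hb : ∀ (i : ℕ) (j : Fin d), i < j → b i j = 0) {k i : ℕ} (hk : k ≤ i) {j : Fin d} (hj : i ≤ j) :
    gs b k i j = b i j := by
  induction k generalizing i with
  | zero => rfl
  | succ k ih =>
    rw [gs_succ]
    have h1 : gs b k k j = 0 := by rw [ih le_rfl (by omega)]; exact hb k j (by omega)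
    simp [ih (show k ≤ i by omega) hj, h1]

theorem sc_pos_of_triangular {d : ℕ} {b : ℕ → EuclideanSpace ℝ (Fin d)}
    (hb : ∀ (i : ℕ) (j : Fin d), i < j → b i j = 0) {k : ℕ} (hk : k < d) (hd : b k ⟨k, hk⟩ ≠ 0) :
    0 < sc b k k k := by
  refine lt_of_le_of_ne (sc_self_nonneg _ _ _) fun h => hd ?_
  have h0 : gs b k k = 0 := inner_self_eq_zero.1 h.symm
  rw [← gs_apply_of_triangular hb le_rfl (j := ⟨k, hk⟩) le_rfl, h0]
  simp

theorem gd_of_triangular {d : ℕ} {b : ℕ → EuclideanSpace ℝ (Fin d)}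
    (hb : ∀ (i : ℕ) (j : Fin d), i < j → b i j = 0) : gd b d = (∏ i : Fin d, b i i) ^ 2 := by
  rw [gd_eq_det]
  set M : Matrix (Fin d) (Fin d) ℝ := Matrix.of fun i j => b i j with hM
  have h1 : (Matrix.of fun s t : Fin d => inner ℝ (b s) (b t)) = M * M.transpose := by
    ext s t
    simp [Matrix.mul_apply, hM, PiLp.inner_apply, mul_comm]
  rw [h1, Matrix.det_mul, Matrix.det_transpose, Matrix.det_of_isLowerTriangular, sq]
  · rfl
  · intro i j hij
    exact hb i j (by simpa using hij)

end LatticeReduction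

/-! ### Bases in memory and fraction-free Gram–Schmidt elimination -/

namespace BitRAM

open LatticeReduction

theorem abs_natCast_le {n B : ℕ} (h : n ≤ 2 ^ B) : |(n : ℤ)| ≤ 2 ^ B := by
  rw [Nat.abs_cast]; exact_mod_cast h

/-- Row `i` of the `d × d` matrix stored in an array. -/
def irow (A : ℤ → ℤ) (d i : ℕ) : Fin d → ℤ := fun j => A (i * d + j)

/-- An integer vector as a vector of the Euclidean space. -/
noncomputable def toV {d : ℕ} (w : Fin d → ℤ) : EuclideanSpace ℝ (Fin d) :=
  WithLp.toLp 2 fun j => (w j : ℝ)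

theorem toV_sub_smul {d : ℕ} (w u : Fin d → ℤ) (q : ℤ) :
    toV (w - q • u) = toV w - (q : ℝ) • toV u := by
  ext j; simp [toV]

theorem inner_toV {d : ℕ} (w u : Fin d → ℤ) :
    inner ℝ (toV w) (toV u) = ((∑ j, w j * u j : ℤ) : ℝ) := by
  simp [toV, PiLp.inner_apply, mul_comm]

/-- The rows of the matrix stored in an array as vectors of the Euclidean space. -/
noncomputable def bs (A : ℤ → ℤ) (d i : ℕ) : EuclideanSpace ℝ (Fin d) := toV (irow A d i)

theorem inner_bs (A : ℤ → ℤ) (d i j : ℕ) :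
    inner ℝ (bs A d i) (bs A d j) =
      ((∑ t ∈ Finset.range d, A (i * d + t) * A (j * d + t) : ℤ) : ℝ) := by
  rw [bs, bs, inner_toV, ← Fin.sum_univ_eq_sum_range (fun t => A (i * d + t) * A (j * d + t))]
  rfl

theorem exists_int_inner_bs (A : ℤ → ℤ) (d i j : ℕ) :
    ∃ z : ℤ, inner ℝ (bs A d i) (bs A d j) = z := ⟨_, inner_bs A d i j⟩

/-- For integers |z| ≤ z ^ 2. This keeps square roots out of all the size estimates. -/
theorem abs_le_of_sq_le {z : ℤ} {Y : ℝ} (h : (z : ℝ) ^ 2 ≤ Y) : |(z : ℝ)| ≤ Y := by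
  refine le_trans ?_ h
  have : |z| ≤ z ^ 2 := by rw [Int.abs_eq_natAbs, ← Int.natAbs_sq, sq]; exact_mod_cast Nat.le_mul_self _
  exact_mod_cast this

theorem sq_le_sc (A : ℤ → ℤ) (d i : ℕ) {t : ℕ} (ht : t < d) :
    (A (i * d + t) : ℝ) ^ 2 ≤ sc (bs A d) 0 i i := by
  have h : sc (bs A d) 0 i i = _ := inner_bs A d i i
  rw [h]; push_cast
  rw [sq]
  exact Finset.single_le_sum (f := fun t : ℕ => (A (i * d + t) : ℝ) * A (i * d + t))
    (fun _ _ => mul_self_nonneg _) (Finset.mem_range.2 ht)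

theorem sum_sq_le_sc (A : ℤ → ℤ) (d i : ℕ) {l : ℕ} (hl : l ≤ d) :
    ∑ t ∈ Finset.range l, (A (i * d + t) : ℝ) ^ 2 ≤ sc (bs A d) 0 i i := by
  have h : sc (bs A d) 0 i i = _ := inner_bs A d i i
  rw [h]; push_cast
  simp only [sq]
  exact Finset.sum_le_sum_of_subset_of_nonneg (Finset.range_mono hl) fun _ _ _ => mul_self_nonneg _

/-- Partial sums occur because the machine stores each stage of an inner product. The bound is the
inequality 2|xy| ≤ x ^ 2 + y ^ 2 summed over the coordinates. -/
theorem abs_sum_mul_le {A : ℤ → ℤ} {d i j : ℕ} {Y : ℝ} (hi : sc (bs A d) 0 i i ≤ Y)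
    (hj : sc (bs A d) 0 j j ≤ Y) {l : ℕ} (hl : l ≤ d) :
    |((∑ t ∈ Finset.range l, A (i * d + t) * A (j * d + t) : ℤ) : ℝ)| ≤ Y := by
  have h1 := (sum_sq_le_sc A d i hl).trans hi
  have h2 := (sum_sq_le_sc A d j hl).trans hj
  push_cast
  refine (Finset.abs_sum_le_sum_abs _ _).trans ?_
  have : ∀ t ∈ Finset.range l, |(A (i * d + t) : ℝ) * A (j * d + t)| ≤
      (A (i * d + t) : ℝ) ^ 2 / 2 + (A (j * d + t) : ℝ) ^ 2 / 2 := by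
    intro t _
    rw [abs_mul, ← sq_abs (A (i * d + t) : ℝ), ← sq_abs (A (j * d + t) : ℝ)]
    nlinarith [sq_nonneg (|(A (i * d + t) : ℝ)| - |(A (j * d + t) : ℝ)|)]
  refine (Finset.sum_le_sum this).trans ?_
  rw [Finset.sum_add_distrib, ← Finset.sum_div, ← Finset.sum_div]
  linarith

theorem cell_div (d l i j : ℕ) (hi : i < d) (hj : j < d) :
    (l * (d * d) + i * d + j) / (d * d) = l ∧ (l * (d * d) + i * d + j) / d % d = i ∧
      (l * (d * d) + i * d + j) % d = j := by
  have hd : 0 < d := by omega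
  have h1 : (l * (d * d) + i * d + j) / d = l * d + i := by
    rw [show l * (d * d) + i * d + j = j + d * (l * d + i) by ring,
      Nat.add_mul_div_left _ _ hd, Nat.div_eq_of_lt hj, zero_add]
  refine ⟨?_, ?_, ?_⟩
  · rw [← Nat.div_div_eq_div_mul, h1, mul_comm l d, Nat.mul_add_div hd, Nat.div_eq_of_lt hi, add_zero]
  · rw [h1, mul_comm l d, Nat.mul_add_mod, Nat.mod_eq_of_lt hi]
  · rw [show l * (d * d) + i * d + j = d * (l * d + i) + j by ring, Nat.mul_add_mod,
      Nat.mod_eq_of_lt hj]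

theorem eq_cell (d n : ℕ) : n = n / (d * d) * (d * d) + n / d % d * d + n % d := by
  have h1 := Nat.div_add_mod n d
  have h2 := Nat.div_add_mod (n / d) d
  rw [Nat.div_div_eq_div_mul] at h2
  calc n = d * (n / d) + n % d := h1.symm
    _ = d * (d * (n / (d * d)) + n / d % d) + n % d := by rw [h2]
    _ = _ := by ring

/-- Lower levels come first in the order of filling, so every cell that an elimination step reads is
already final. -/
theorem cell_lt {d l l' i j i' j' : ℕ} (hi : i < d) (hj : j < d) (h : l < l') :
    l * (d * d) + i * d + j < l' * (d * d) + i' * d + j' := by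
  have h1 : (l + 1) * (d * d) ≤ l' * (d * d) := Nat.mul_le_mul_right _ h
  have h2 : (i + 1) * d ≤ d * d := Nat.mul_le_mul_right _ hi
  nlinarith

/-- Gram matrix and fraction-free elimination for the `d × d` matrix in the array 5 (`d` is
variable 5). The level `l ≤ d` of the array 6 holds the inner products of the first `l` coordinates,
the level `d + k` the integers `gd k * sc k i j`. -/
def gsProg : Prog :=
  forLoop 30 (2 * v 5 * (v 5 * v 5)) (block [
    .assign 31 (v 30 / (v 5 * v 5)), .assign 32 (v 30 / v 5 % v 5), .assign 33 (v 30 % v 5),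
    .ite (v 31)
      (.ite (v 5 + 1 - v 31)
        (.store 6 (v 30) (.get 6 (v 30 - v 5 * v 5) +
          .get 5 (v 32 * v 5 + (v 31 - 1)) * .get 5 (v 33 * v 5 + (v 31 - 1))))
        (block [
          .assign 34 (v 31 - v 5 - 1), .assign 35 1,
          .ite (v 34) (.assign 35 (.get 6 ((v 31 - 2) * (v 5 * v 5) + (v 34 - 1) * v 5 + (v 34 - 1))))
            .skip,
          .store 6 (v 30) ((.get 6 ((v 31 - 1) * (v 5 * v 5) + v 34 * v 5 + v 34) *
              .get 6 (v 30 - v 5 * v 5) -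
            .get 6 ((v 31 - 1) * (v 5 * v 5) + v 32 * v 5 + v 34) *
              .get 6 ((v 31 - 1) * (v 5 * v 5) + v 34 * v 5 + v 33)) / v 35)]))
      (.store 6 (v 30) 0)])

/-- What `gsProg` stores at level `l`, row `i`, column `j`. -/
def GsCell (A : ℤ → ℤ) (d l i j : ℕ) (z : ℤ) : Prop :=
  if l ≤ d then z = ∑ t ∈ Finset.range l, A (i * d + t) * A (j * d + t)
  else (z : ℝ) = gd (bs A d) (l - d) * sc (bs A d) (l - d) i j

theorem GsCell.cast {A : ℤ → ℤ} {d l i j k : ℕ} {z : ℤ} (h : GsCell A d l i j z) (hl : l = d + k) :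
    (z : ℝ) = gd (bs A d) k * sc (bs A d) k i j := by
  subst hl
  unfold GsCell at h
  split_ifs at h with hk
  · obtain rfl : k = 0 := by omega
    rw [gd_zero, one_mul, h]
    exact (inner_bs A d i j).symm
  · rwa [Nat.add_sub_cancel_left] at h

theorem abs_gd_mul_sc_le {A : ℤ → ℤ} {d i j k : ℕ} {X Y : ℝ}
    (hX : gd (bs A d) k ≤ X) (h0 : 0 ≤ gd (bs A d) k)
    (hi : sc (bs A d) 0 i i ≤ Y) (hj : sc (bs A d) 0 j j ≤ Y) :
    |gd (bs A d) k * sc (bs A d) k i j| ≤ X * Y := by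
  have hY : 0 ≤ Y := (sc_self_nonneg _ _ _).trans hi
  rw [abs_mul, abs_of_nonneg h0]
  refine mul_le_mul hX ?_ (abs_nonneg _) (h0.trans hX)
  refine abs_le_of_sq_le_sq ((sc_sq_le _ _ _ _).trans ?_) hY
  rw [sq]
  exact mul_le_mul hi hj (sc_self_nonneg _ _ _) hY

theorem abs_le_two_pow_of_real {z : ℤ} {B : ℕ} {x : ℝ} (h : |(z : ℝ)| ≤ x) (hx : x ≤ 2 ^ B) :
    |z| ≤ 2 ^ B := by
  have := h.trans hx
  exact_mod_cast this

/-- Conditions on the parameters under which `gsProg` works. -/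
structure GsHyp (R B : ℕ) (A : ℤ → ℤ) (d : ℕ) (X Y : ℝ) : Prop where
  d_pos : 0 < d
  one_le : 1 ≤ X
  R_le : 2 * d * (d * d) ≤ R
  B_le : 2 * d * (d * d) ≤ 2 ^ B
  XY : 3 * X * Y ≤ 2 ^ B
  gd_le : ∀ k ≤ d, gd (bs A d) k ≤ X
  one_le_gd : ∀ k ≤ d, 1 ≤ gd (bs A d) k
  sc_le : ∀ i < d, sc (bs A d) 0 i i ≤ Y

theorem gsProg_spec {R B : ℕ} {σ : State} {Q : State → Prop} {d : ℕ} {X Y : ℝ}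
    (hd : σ.var 5 = d) (H : GsHyp R B (σ.arr 5) d X Y)
    (hQ : ∀ τ, Same gsProg σ τ → (∀ k < d, ∀ i < d, ∀ j < d,
      (τ.arr 6 (((d + k) * (d * d) + i * d + j : ℕ) : ℤ) : ℝ) =
        gd (bs (σ.arr 5) d) k * sc (bs (σ.arr 5) d) k i j) → Q τ) :
    Ev R B gsProg σ Q := by
  have hd0 := H.d_pos
  have hY0 : 0 ≤ Y := (sc_self_nonneg _ _ _).trans (H.sc_le 0 hd0)
  have hXY : X * Y ≤ 2 ^ B := by nlinarith [H.XY, H.one_le]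
  have hY : Y ≤ 2 ^ B := by nlinarith [H.one_le]
  set A := σ.arr 5 with hA
  refine Ev.fill (a := 6) (fun m z => GsCell A d (m / (d * d)) (m / d % d) (m % d) z) (2 * d * (d * d))
    H.R_le H.B_le rfl (fun τ hτ => ?_) ?_ ?_
  · simp only [eval_mul, eval_var, eval_ofNat, hτ.var 5 rfl, hd]; push_cast; ring
  · intro m hm τ hτB hτ hmv hprev _
    obtain ⟨l, i, j, hi, hj, rfl⟩ : ∃ l i j, i < d ∧ j < d ∧ m = l * (d * d) + i * d + j :=
      ⟨_, _, _, Nat.mod_lt _ hd0, Nat.mod_lt _ hd0, eq_cell d m⟩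
    obtain ⟨c1, c2, c3⟩ := cell_div d l i j hi hj
    simp only [c1, c2, c3]
    have hl : l < 2 * d := by
      by_contra h
      have := Nat.mul_le_mul_right (d * d) (not_lt.1 h)
      omega
    have hdτ : τ.var 5 = d := (hτ.var 5 rfl).trans hd
    have hAτ : τ.arr 5 = A := hτ.arr 5 rfl
    have hcell : ∀ l' < l, ∀ i' < d, ∀ j' < d,
        GsCell A d l' i' j' (τ.arr 6 ((l' * (d * d) + i' * d + j' : ℕ) : ℤ)) := by
      intro l' hl' i' hi' j' hj'
      have := hprev _ (cell_lt (i' := i) (j' := j) hi' hj' hl')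
      obtain ⟨e1, e2, e3⟩ := cell_div d l' i' j' hi' hj'
      simpa only [e1, e2, e3] using this
    have hmB : l * (d * d) + i * d + j ≤ 2 ^ B := hm.le.trans H.B_le
    have bd : ∀ n ≤ l * (d * d) + i * d + j, |((n : ℕ) : ℤ)| ≤ 2 ^ B := fun n hn =>
      abs_natCast_le (hn.trans hmB)
    have hdd : 0 < d * d := Nat.mul_pos hd0 hd0
    have hlm : l ≤ l * (d * d) + i * d + j := by
      have : l ≤ l * (d * d) := Nat.le_mul_of_pos_right l hdd
      omega
    refine Ev.block_cons (Ev.assign (l : ℤ) ?_ (fun _ => bd _ hlm) ?_)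
    · rw [← c1]; simp [hmv, hdτ]
    refine Ev.block_cons (Ev.assign (i : ℤ) ?_ (fun _ => bd _ ?_) ?_)
    · conv_rhs => rw [← c2]
      simp [hmv, hdτ]
    · have : i ≤ i * d := Nat.le_mul_of_pos_right i hd0
      omega
    refine Ev.block_cons (Ev.assign (j : ℤ) ?_ (fun _ => bd _ (by omega)) ?_)
    · conv_rhs => rw [← c3]
      simp [hmv, hdτ]
    refine Ev.block_one (Ev.ite (fun hpos => ?_) fun hneg => ?_)
    · have hl0 : 0 < l := by simpa using hpos
      obtain ⟨k, rfl⟩ : ∃ k, l = k + 1 := ⟨l - 1, by omega⟩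
      have em : (((k + 1) * (d * d) + i * d + j : ℕ) : ℤ) - d * d = ((k * (d * d) + i * d + j : ℕ) : ℤ) := by
        push_cast; ring
      refine Ev.ite (fun hle => ?_) fun hgt => ?_
      · have hkd : k < d := by
          simp [hdτ] at hle; omega
        have hc := hcell k (by omega) i hi j hj
        rw [GsCell, if_pos hkd.le] at hc
        refine Ev.store (((k + 1) * (d * d) + i * d + j : ℕ) : ℤ) (∑ t ∈ Finset.range (k + 1), A (i * d + t) * A (j * d + t)) (by simp [hmv]) ?_
          (fun _ => abs_le_two_pow_of_real (abs_sum_mul_le (H.sc_le i hi) (H.sc_le j hj) hkd) hY) ?_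
        · simp only [eval_add, eval_mul, eval_get, eval_sub, eval_var, eval_one, setVar_var, hmv, hdτ,
            setVar_arr, hAτ]
          norm_num
          rw [Finset.sum_range_succ, ← hc, ← em]
          push_cast
          ring_nf
        · refine ⟨_, setArr_arr_self _ _ _ _, ?_⟩
          rw [GsCell, if_pos (show k + 1 ≤ d from hkd)]
      · have hkd : d ≤ k := by
          simp [hdτ] at hgt; omega
        obtain ⟨k', rfl⟩ : ∃ k', k = d + k' := ⟨k - d, by omega⟩
        have hk'd : k' < d := by omega
        refine Ev.block_cons (Ev.assign (k' : ℤ) (by simp [hdτ]; ring) (fun _ => bd _ (by omega)) ?_)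
        refine Ev.block_cons (Ev.assign 1 rfl (fun _ => by simpa using bd 1 (by omega)) ?_)
        set τ' := ((((τ.setVar 31 ((d + k' + 1 : ℕ) : ℤ)).setVar 32 i).setVar 33 j).setVar 34 k').setVar 35 1
          with hτ'
        -- The divisor p is 1 at the first elimination level and the previous pivot afterwards. In
        -- both cases it equals `gd k'`.
        have hfin : ∀ p : ℤ, (p : ℝ) = gd (bs A d) k' →
            Ev R B (block [Prog.store 6 (v 30) ((.get 6 ((v 31 - 1) * (v 5 * v 5) + v 34 * v 5 + v 34) *
              .get 6 (v 30 - v 5 * v 5) -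
            .get 6 ((v 31 - 1) * (v 5 * v 5) + v 32 * v 5 + v 34) *
              .get 6 ((v 31 - 1) * (v 5 * v 5) + v 34 * v 5 + v 33)) / v 35)]) (τ'.setVar 35 p)
              (fun ρ => ∃ z, ρ.arr 6 = Function.update (τ.arr 6)
                (((d + k' + 1) * (d * d) + i * d + j : ℕ) : ℤ) z ∧ GsCell A d (d + k' + 1) i j z) := by
          intro p hp
          obtain ⟨z, hz⟩ := exists_int_gd_mul_sc (exists_int_inner_bs A d) (k' + 1) i j
          have g1 := (hcell (d + k') (by omega) k' hk'd k' hk'd).cast rfl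
          have g2 := (hcell (d + k') (by omega) i hi j hj).cast rfl
          have g3 := (hcell (d + k') (by omega) i hi k' hk'd).cast rfl
          have g4 := (hcell (d + k') (by omega) k' hk'd j hj).cast rfl
          have hg0 : gd (bs A d) k' ≠ 0 := by linarith [H.one_le_gd k' (by omega)]
          have hp0 : p ≠ 0 := by rintro rfl; exact hg0 (by simpa using hp.symm)
          -- Bareiss elimination. Writing g for `gd k'`, the left side is g ^ 2 times sc k' k' k' *
          -- sc (k' + 1) i j, which is g * (gd (k' + 1) * sc (k' + 1) i j). The second factor is the
          -- integer z, so the division by g is exact.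
          have hnum : τ.arr 6 (((d + k') * (d * d) + k' * d + k' : ℕ) : ℤ) *
              τ.arr 6 (((d + k') * (d * d) + i * d + j : ℕ) : ℤ) -
              τ.arr 6 (((d + k') * (d * d) + i * d + k' : ℕ) : ℤ) *
              τ.arr 6 (((d + k') * (d * d) + k' * d + j : ℕ) : ℤ) = z * p := by
            have : ((τ.arr 6 (((d + k') * (d * d) + k' * d + k' : ℕ) : ℤ) *
              τ.arr 6 (((d + k') * (d * d) + i * d + j : ℕ) : ℤ) -
              τ.arr 6 (((d + k') * (d * d) + i * d + k' : ℕ) : ℤ) *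
              τ.arr 6 (((d + k') * (d * d) + k' * d + j : ℕ) : ℤ) : ℤ) : ℝ) = ((z * p : ℤ) : ℝ) := by
              push_cast at g1 g2 g3 g4 ⊢
              rw [g1, g2, g3, g4, hp, ← hz, gd_succ, sc_succ]
              linear_combination (gd (bs A d) k' ^ 2 * sc (bs A d) k' k' j) * mu_mul (bs A d) i k'
            exact_mod_cast this
          have hz' : GsCell A d (d + k' + 1) i j z := by
            rw [GsCell, if_neg (by omega), show d + k' + 1 - d = k' + 1 by omega]
            exact hz.symm
          refine Ev.block_one (Ev.store (((d + k' + 1) * (d * d) + i * d + j : ℕ) : ℤ) z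
            (by simp [hτ', hmv]) ?_ (fun _ => ?_) ⟨z, setArr_arr_self _ _ _ _, hz'⟩)
          · simp only [eval_add, eval_mul, eval_get, eval_sub, eval_var, eval_one, setVar_var, hmv, hdτ,
              setVar_arr, hτ', eval_div]
            norm_num
            rw [show ((d : ℤ) + k' + 1) * (d * d) + i * d + j - d * d =
              ((d + k') * (d * d) + i * d + j) by ring]
            push_cast at hnum
            rw [hnum, Int.mul_ediv_cancel _ hp0]
          · refine abs_le_two_pow_of_real ?_ hXY
            rw [← hz]
            exact abs_gd_mul_sc_le (H.gd_le _ hk'd) (by linarith [H.one_le_gd (k' + 1) hk'd])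
              (H.sc_le i hi) (H.sc_le j hj)
        refine Ev.block_cons (Ev.ite (fun hk0 => ?_) fun hk0 => ?_)
        · have hk0 : 0 < k' := by simpa [hτ'] using hk0
          obtain ⟨k'', rfl⟩ : ∃ k'', k' = k'' + 1 := ⟨k' - 1, by omega⟩
          have g1 := (hcell (d + k'') (by omega) k'' (by omega) k'' (by omega)).cast rfl
          rw [← gd_succ] at g1
          refine Ev.assign (τ.arr 6 (((d + k'') * (d * d) + k'' * d + k'' : ℕ) : ℤ)) ?_
            (fun _ => hτB.2 _ _) (hfin _ g1)
          simp only [hτ', eval_add, eval_mul, eval_get, eval_sub, eval_var, eval_one, setVar_var, hdτ,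
            setVar_arr, eval_ofNat]
          norm_num
          ring_nf
        · have hk0 : k' = 0 := by
            simp [hτ'] at hk0; omega
          have := hfin 1 (by rw [hk0, gd_zero]; simp)
          have e : τ'.setVar 35 1 = τ' := by
            simp [hτ', State.setVar]
          rw [e] at this
          exact Ev.skip this
    · have hl0 : l = 0 := by simpa using hneg
      subst hl0
      refine Ev.store ((0 * (d * d) + i * d + j : ℕ) : ℤ) 0 (by simp [hmv]) rfl (fun _ => by simp)
        ⟨0, setArr_arr_self _ _ _ _, ?_⟩
      simp [GsCell]
  · intro τ hτ hP _
    refine hQ τ hτ fun k hk i hi j hj => ?_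
    have hlt : (d + k) * (d * d) + i * d + j < 2 * d * (d * d) := by
      have := cell_lt (i' := 0) (j' := 0) hi hj (show d + k < 2 * d by omega)
      omega
    have := hP _ hlt
    obtain ⟨e1, e2, e3⟩ := cell_div d (d + k) i j hi hj
    rw [e1, e2, e3] at this
    exact this.cast rfl

end BitRAM

/-! ### Size reduction of one pair of rows -/

namespace BitRAM

open LatticeReduction

theorem bs_of_irow_update {A A' : ℤ → ℤ} {d i j : ℕ} {q : ℤ}
    (h : irow A' d = Function.update (irow A d) i (irow A d i - q • irow A d j)) :
    bs A' d = Function.update (bs A d) i (bs A d i - (q : ℝ) • bs A d j) := by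
  funext l
  rw [bs, h]
  by_cases hl : l = i
  · subst hl; rw [Function.update_self, Function.update_self, toV_sub_smul]; rfl
  · simp [hl, bs]

theorem sc_self_le_of_gd {d : ℕ} {X : ℝ} {b : ℕ → EuclideanSpace ℝ (Fin d)}
    (h1 : ∀ k ≤ d, gd b k ≤ X) (h2 : ∀ k ≤ d, 1 ≤ gd b k) {l : ℕ} (hl : l < d) :
    sc b l l l ≤ X := by
  have := h1 (l + 1) hl
  rw [gd_succ] at this
  nlinarith [h2 l hl.le, sc_self_nonneg b l l]

/-- A Gram–Schmidt norm is the quotient of consecutive Gram determinants, here at least 1 and at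
most X. The resulting lower bound 1 / X keeps the Gram–Schmidt coefficients from being large. -/
theorem one_le_mul_sc_of_gd {d : ℕ} {X : ℝ} {b : ℕ → EuclideanSpace ℝ (Fin d)}
    (h1 : ∀ k ≤ d, gd b k ≤ X) (h2 : ∀ k ≤ d, 1 ≤ gd b k) {l : ℕ} (hl : l < d) :
    1 ≤ X * sc b l l l := by
  have := h2 (l + 1) hl
  rw [gd_succ] at this
  nlinarith [h1 l hl.le, sc_self_nonneg b l l]

/-- The length of a vector after one step of size reduction. -/
theorem sc_update_le {V : Type*} [NormedAddCommGroup V] [InnerProductSpace ℝ V] {b : ℕ → V}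
    {i j : ℕ} {q X M N : ℝ} (hX : 1 ≤ X) (hM : 0 ≤ M) (hN : 1 ≤ N)
    (hc : 1 ≤ X * sc b j j j) (hj : sc b 0 j j ≤ M) (hi : sc b 0 i i ≤ N)
    (hq : |mu b i j - q| ≤ 1 / 2) :
    sc (Function.update b i (b i - q • b j)) 0 i i ≤ N * (2 + 6 * X * M) := by
  have h1 : mu b i j ^ 2 * sc b j j j ≤ N := by
    have := sc_succ_self b j i
    linarith [sc_self_nonneg b (j + 1) i, sc_le b j i]
  have h2 : mu b i j ^ 2 ≤ X * N := by
    nlinarith [sq_nonneg (mu b i j)]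
  have h3 : q ^ 2 ≤ 2 * (X * N) + 1 := by
    rw [abs_le] at hq
    -- q ^ 2 ≤ 2 mu ^ 2 + 2 (mu - q) ^ 2, and the last term is at most 1/2.
    nlinarith [sq_nonneg (mu b i j + (mu b i j - q))]
  have h4 : sc (Function.update b i (b i - q • b j)) 0 i i ≤
      2 * sc b 0 i i + 2 * (q ^ 2 * sc b 0 j j) := by
    have e : sc (Function.update b i (b i - q • b j)) 0 i i =
        inner ℝ (b i - q • b j) (b i - q • b j) := by simp [sc, gs]
    -- By the parallelogram law, the squared length of the difference is at most twice the sum of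
    -- the two squared lengths.
    have h5 : 0 ≤ inner ℝ (b i + q • b j) (b i + q • b j) := real_inner_self_nonneg
    rw [e]
    simp only [sc, gs, inner_sub_left, inner_sub_right, inner_add_left, inner_add_right,
      real_inner_smul_left, real_inner_smul_right] at h5 ⊢
    linarith
  have h6 : q ^ 2 * sc b 0 j j ≤ (2 * (X * N) + 1) * M :=
    mul_le_mul h3 hj (sc_self_nonneg _ _ _) (by positivity)
  have h7 : M ≤ X * N * M := by
    have : 1 ≤ X * N := by nlinarith
    nlinarith
  nlinarith

/-- Subtract from row `i` (variable 36) the multiple of row `j` (variable 37) that makes the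
Gram–Schmidt coefficient small. -/
def redProg : Prog := block [gsProg,
  .assign 38 ((2 * .get 6 ((v 5 + v 37) * (v 5 * v 5) + v 36 * v 5 + v 37) +
      .get 6 ((v 5 + v 37) * (v 5 * v 5) + v 37 * v 5 + v 37)) /
    (2 * .get 6 ((v 5 + v 37) * (v 5 * v 5) + v 37 * v 5 + v 37))),
  forLoop 39 (v 5) (.store 5 (v 36 * v 5 + v 39)
    (.get 5 (v 36 * v 5 + v 39) - v 38 * .get 5 (v 37 * v 5 + v 39)))]

/-- Rounding to the nearest integer in integer arithmetic: ⌊u / D + 1/2⌋ = ⌊(2 u + D) / (2 D)⌋. -/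
theorem abs_sub_round_le {u D : ℤ} (hD : 0 < D) :
    |(u : ℝ) / D - ((2 * u + D) / (2 * D) : ℤ)| ≤ 1 / 2 := by
  set q := (2 * u + D) / (2 * D) with hq
  have h1 := Int.emod_add_mul_ediv (2 * u + D) (2 * D)
  have h2 := Int.emod_nonneg (2 * u + D) (show 2 * D ≠ 0 by omega)
  have h3 := Int.emod_lt_of_pos (2 * u + D) (show 0 < 2 * D by omega)
  rw [← hq] at h1
  have hD' : (0 : ℝ) < D := by exact_mod_cast hD
  have k1 : (2 * D * q : ℝ) ≤ 2 * u + D := by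
    have : 2 * D * q ≤ 2 * u + D := by linarith
    exact_mod_cast this
  have k2 : (2 * u + D : ℝ) ≤ 2 * D * q + 2 * D := by
    have : 2 * u + D ≤ 2 * D * q + 2 * D := by linarith
    exact_mod_cast this
  rw [abs_le]
  constructor
  · rw [le_sub_iff_add_le, le_div_iff₀ hD']; nlinarith
  · rw [sub_le_iff_le_add, div_le_iff₀ hD']; nlinarith

theorem redProg_spec {R B : ℕ} {σ : State} {Q : State → Prop} {d : ℕ} {X Y W : ℝ} {i j : ℕ}
    (hd : σ.var 5 = d) (H : GsHyp R B (σ.arr 5) d X Y) (hi : σ.var 36 = i) (hj : σ.var 37 = j)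
    (hid : i < d) (hji : j < i)
    (hW : ∀ q : ℤ, |mu (bs (σ.arr 5) d) i j - q| ≤ 1 / 2 →
      sc (Function.update (bs (σ.arr 5) d) i
        (bs (σ.arr 5) d i - (q : ℝ) • bs (σ.arr 5) d j)) 0 i i ≤ W) (hWB : W ≤ 2 ^ B)
    (hQ : ∀ τ, Same redProg σ τ → (∃ q : ℤ, |mu (bs (σ.arr 5) d) i j - q| ≤ 1 / 2 ∧
      irow (τ.arr 5) d =
        Function.update (irow (σ.arr 5) d) i (irow (σ.arr 5) d i - q • irow (σ.arr 5) d j)) → Q τ) :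
    Ev R B redProg σ Q := by
  suffices h : Ev R B redProg σ (fun τ => ∃ q : ℤ, |mu (bs (σ.arr 5) d) i j - q| ≤ 1 / 2 ∧
      irow (τ.arr 5) d =
        Function.update (irow (σ.arr 5) d) i (irow (σ.arr 5) d i - q • irow (σ.arr 5) d j)) from
    h.conseq fun τ h1 _ h2 => hQ τ h1 h2
  have hd0 := H.d_pos
  set A := σ.arr 5 with hA
  refine Ev.block_cons (gsProg_spec hd H fun τ hτ hg => ?_)
  have hdτ : τ.var 5 = d := (hτ.var 5 rfl).trans hd
  have hiτ : τ.var 36 = i := (hτ.var 36 rfl).trans hi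
  have hjτ : τ.var 37 = j := (hτ.var 37 rfl).trans hj
  have hAτ : τ.arr 5 = A := hτ.arr 5 rfl
  set u := τ.arr 6 (((d + j) * (d * d) + i * d + j : ℕ) : ℤ) with hu
  set D := τ.arr 6 (((d + j) * (d * d) + j * d + j : ℕ) : ℤ) with hD
  have hjd : j < d := hji.trans hid
  have gu := hg j hjd i hid j hjd
  have gD := hg j hjd j hjd j hjd
  rw [← hu] at gu
  rw [← hD, ← gd_succ] at gD
  have gD' := gD
  rw [gd_succ] at gD'
  have hDpos : 0 < D := by
    have := H.one_le_gd (j + 1) hjd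
    rw [← gD] at this
    exact_mod_cast lt_of_lt_of_le one_pos this
  have hg0 : gd (bs A d) j ≠ 0 := by linarith [H.one_le_gd j hjd.le]
  have hround := abs_sub_round_le (u := u) hDpos
  set q := (2 * u + D) / (2 * D) with hq
  have hmu : (u : ℝ) / D = mu (bs A d) i j := by
    rw [gu, gD', mu, mul_div_mul_left _ _ hg0]
  rw [hmu] at hround
  -- The numerator 2 u + D is at most 3 X Y in absolute value, which explains the factor 3 in
  -- `GsHyp.XY`.
  have hqB : |q| ≤ 2 ^ B := by
    have h1 : |q| ≤ |2 * u + D| := by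
      have := Int.natAbs_ediv_le_natAbs (2 * u + D) (2 * D)
      rw [Int.abs_eq_natAbs, Int.abs_eq_natAbs]; exact_mod_cast this
    refine h1.trans (abs_le_two_pow_of_real ?_ H.XY)
    have h2 := abs_gd_mul_sc_le (H.gd_le j hjd.le) (by linarith [H.one_le_gd j hjd.le])
      (H.sc_le i hid) (H.sc_le j hjd)
    have h3 := abs_gd_mul_sc_le (H.gd_le j hjd.le) (by linarith [H.one_le_gd j hjd.le])
      (H.sc_le j hjd) (H.sc_le j hjd)
    rw [← gu] at h2
    rw [← gD'] at h3
    push_cast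
    refine (abs_add_le _ _).trans ?_
    rw [abs_mul]
    norm_num
    linarith
  refine Ev.block_cons (Ev.assign q ?_ (fun _ => hqB) (Ev.block_one ?_))
  · simp only [eval_add, eval_mul, eval_get, eval_var, eval_ofNat, eval_div, hdτ, hiτ, hjτ, hq, hu, hD]
    push_cast
    rfl
  have hnew := hW q hround
  have hB5 : Function.update (bs A d) i (bs A d i - (q : ℝ) • bs A d j) i = toV (irow A d i - q • irow A d j) := by
    rw [Function.update_self, toV_sub_smul]; rfl
  refine Ev.forLoop (I := fun c τ => ∀ z, τ.arr 5 z = if (i * d : ℤ) ≤ z ∧ z < i * d + c then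
      A z - q * A (z - i * d + j * d) else A z) d ?_ ?_ rfl ?_ ?_ ?_ ?_
  · have := H.R_le; nlinarith [Nat.mul_pos hd0 hd0]
  · have := H.B_le; nlinarith [Nat.mul_pos hd0 hd0]
  · intro ρ hρ
    simp [hρ.var 5 rfl, hdτ]
  · intro z
    rw [if_neg (by push_cast; omega)]
    simp [hAτ]
  · intro c hc ρ hρB hρ hcv hI
    have v5 : ρ.var 5 = d := by rw [hρ.var 5 rfl]; simp [hdτ]
    have v36 : ρ.var 36 = i := by rw [hρ.var 36 rfl]; simp [hiτ]
    have v37 : ρ.var 37 = j := by rw [hρ.var 37 rfl]; simp [hjτ]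
    have v38 : ρ.var 38 = q := by rw [hρ.var 38 rfl]; simp
    -- Row j ends before row i begins, so the entries read from row j are not affected by the writes
    -- of this loop.
    have hjid : (j * d + d : ℤ) ≤ i * d := by
      have : (j + 1) * d ≤ i * d := Nat.mul_le_mul_right _ hji
      have : ((j + 1 : ℕ) * d : ℤ) ≤ i * d := by exact_mod_cast this
      push_cast at this; linarith
    refine Ev.store (i * d + c : ℤ) (A (i * d + c) - q * A (j * d + c)) (by simp [v36, v5, hcv]) ?_ (fun _ => ?_) ?_
    · simp only [eval_sub, eval_mul, eval_get, eval_var, eval_add, v5, v36, v37, v38, hcv]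
      rw [hI, hI, if_neg (by omega), if_neg (by omega)]
    · refine abs_le_two_pow_of_real ?_ hWB
      refine (abs_le_of_sq_le ?_).trans hnew
      have e1 : sc (Function.update (bs A d) i (bs A d i - (q : ℝ) • bs A d j)) 0 i i =
          ∑ t : Fin d, (((irow A d i - q • irow A d j) t : ℤ) : ℝ) ^ 2 := by
        rw [sc, gs, hB5, inner_toV]; push_cast; simp [sq]
      rw [e1]
      have := Finset.single_le_sum (f := fun t : Fin d => (((irow A d i - q • irow A d j) t : ℤ) : ℝ) ^ 2)
        (fun _ _ => sq_nonneg _) (Finset.mem_univ ⟨c, hc⟩)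
      refine le_trans (le_of_eq ?_) this
      simp [irow]
    · intro z
      simp only [setVar_arr, setArr_arr_self, Function.update_apply]
      by_cases hz : z = i * d + c
      · subst hz
        rw [if_pos rfl, if_pos (by push_cast; omega)]
        ring_nf
      · rw [if_neg hz, hI]
        congr 1
        push_cast
        exact propext (by omega)
  · intro ρ hρ _ hI
    refine ⟨q, hround, ?_⟩
    funext l t
    have ht := t.2
    simp only [irow, Function.update_apply]
    rw [hI]
    by_cases hl : l = i
    · subst hl
      rw [if_pos (by omega), if_pos rfl]
      simp [irow]
      left; rw [add_comm]
    · rw [if_neg, if_neg hl]; · rfl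
      rintro ⟨h1, h2⟩
      rcases lt_or_gt_of_ne hl with h | h
      · have : (l + 1) * d ≤ i * d := Nat.mul_le_mul_right _ h
        have : ((l + 1 : ℕ) * d : ℤ) ≤ i * d := by exact_mod_cast this
        push_cast at this; linarith [show (t : ℤ) < d by exact_mod_cast ht]
      · have : (i + 1) * d ≤ l * d := Nat.mul_le_mul_right _ h
        have : ((i + 1 : ℕ) * d : ℤ) ≤ l * d := by exact_mod_cast this
        push_cast at this; linarith [show (0 : ℤ) ≤ t by omega]

end BitRAM

/-! ### Size reduction of a basis, the Lovász test and the swap -/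

namespace BitRAM

open LatticeReduction

/-- What is preserved while the basis gets size-reduced: `t` counts the pairs of rows treated. -/
structure SweepInv {d : ℕ} (Λ : AddSubgroup (Fin d → ℤ)) (X : ℝ) (A₀ A : ℤ → ℤ) (t : ℕ) : Prop where
  gd_eq : ∀ k, gd (bs A d) k = gd (bs A₀ d) k
  mem : ∀ i < d, irow A d i ∈ Λ
  red : ∀ i < d, ∀ j < i, i * d + (d - 1 - j) < t → |mu (bs A d) i j| ≤ 1 / 2
  nrm : ∀ i < d, sc (bs A d) 0 i i ≤ d * X * (2 + 6 * X * (d * X)) ^ t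

/-- Size reduction of the whole basis. -/
def sweepProg : Prog := forLoop 40 (v 5 * v 5) (block [
  .assign 36 (v 40 / v 5), .assign 37 (v 5 - 1 - v 40 % v 5), .ite (v 36 - v 37) redProg .skip])

/-- For a reduced row the bound does not depend on how long the row was before. This lets the norms
return to d X after each sweep, however they grew in between. -/
theorem sc_le_of_red {d : ℕ} {b : ℕ → EuclideanSpace ℝ (Fin d)} {X : ℝ} (hX : 1 ≤ X)
    (h1 : ∀ k ≤ d, gd b k ≤ X) (h2 : ∀ k ≤ d, 1 ≤ gd b k) {j : ℕ} (hj : j < d)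
    (hred : ∀ l < j, |mu b j l| ≤ 1 / 2) : sc b 0 j j ≤ d * X := by
  refine (sc_zero_self_le (fun l hl => sc_self_le_of_gd h1 h2 (by omega)) hred).trans ?_
  have : ((j : ℝ) + 1) ≤ d := by exact_mod_cast hj
  nlinarith

/-- Rows are treated upwards and, within a row, columns downwards. The row j < i that gets
subtracted is then already reduced, so its squared norm is at most d X and each step multiplies the
norm bound by at most Z. After d * d steps the bit length is still polynomial. -/
theorem sweepProg_spec {R B : ℕ} {σ : State} {Q : State → Prop} {d : ℕ} {X : ℝ}
    {Λ : AddSubgroup (Fin d → ℤ)} (hd : σ.var 5 = d)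
    (H : GsHyp R B (σ.arr 5) d X (d * X * (2 + 6 * X * (d * X)) ^ (d * d)))
    (h0 : SweepInv Λ X (σ.arr 5) (σ.arr 5) 0)
    (hQ : ∀ τ, Same sweepProg σ τ →
      GsHyp R B (τ.arr 5) d X (d * X * (2 + 6 * X * (d * X)) ^ (d * d)) →
      SweepInv Λ X (σ.arr 5) (τ.arr 5) (d * d) → Q τ) :
    Ev R B sweepProg σ Q := by
  have hd0 := H.d_pos
  set A := σ.arr 5 with hA
  set Z : ℝ := 2 + 6 * X * (d * X) with hZ
  have hX := H.one_le
  have hd1 : (1 : ℝ) ≤ d := by exact_mod_cast hd0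
  have hdX : 1 ≤ (d : ℝ) * X := by nlinarith
  have hZ1 : 1 ≤ Z := by rw [hZ]; nlinarith
  have hNmono : ∀ {t t' : ℕ}, t ≤ t' → d * X * Z ^ t ≤ d * X * Z ^ t' := fun h =>
    mul_le_mul_of_nonneg_left (pow_le_pow_right₀ hZ1 h) (by linarith)
  have hGs : ∀ {A' : ℤ → ℤ} {t : ℕ}, t ≤ d * d → SweepInv Λ X A A' t →
      GsHyp R B A' d X (d * X * Z ^ (d * d)) := fun ht hI =>
    ⟨hd0, hX, H.R_le, H.B_le, H.XY, fun k hk => by rw [hI.gd_eq]; exact H.gd_le k hk,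
      fun k hk => by rw [hI.gd_eq]; exact H.one_le_gd k hk,
      fun i hi => (hI.nrm i hi).trans (hNmono ht)⟩
  have hRdd : d * d ≤ 2 * d * (d * d) := by nlinarith [Nat.mul_pos hd0 hd0]
  refine Ev.forLoop (I := fun t τ => SweepInv Λ X A (τ.arr 5) t) (d * d) (hRdd.trans H.R_le)
    (hRdd.trans H.B_le) rfl (fun τ hτ => ?_) h0 ?_ fun τ hτ _ hI => hQ τ hτ (hGs le_rfl hI) hI
  · simp [hτ.var 5 rfl, hd]
  intro t ht τ hτB hτ htv hI
  have hdτ : τ.var 5 = d := (hτ.var 5 rfl).trans hd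
  have htB : d * d ≤ 2 ^ B := hRdd.trans H.B_le
  obtain ⟨i, c, hi, hc, rfl⟩ : ∃ i c, i < d ∧ c < d ∧ t = i * d + c :=
    ⟨t / d, t % d, Nat.div_lt_of_lt_mul ht, Nat.mod_lt _ hd0, (Nat.div_add_mod' t d).symm⟩
  have e1 : (i * d + c) / d = i := by
    rw [mul_comm, Nat.mul_add_div hd0, Nat.div_eq_of_lt hc, add_zero]
  have e2 : (i * d + c) % d = c := by
    rw [mul_comm, Nat.mul_add_mod, Nat.mod_eq_of_lt hc]
  have hdle : d ≤ d * d := Nat.le_mul_of_pos_left d hd0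
  refine Ev.block_cons (Ev.assign (i : ℤ) ?_ (fun _ => abs_natCast_le (by omega)) ?_)
  · conv_rhs => rw [← e1]
    simp [htv, hdτ]
  refine Ev.block_cons (Ev.assign ((d - 1 - c : ℕ) : ℤ) ?_ (fun _ => abs_natCast_le (by omega)) ?_)
  · have : ((d - 1 - c : ℕ) : ℤ) = d - 1 - ((i * d + c) % d : ℕ) := by rw [e2]; omega
    rw [this]
    simp [htv, hdτ]
  set j := d - 1 - c with hj
  have hjc : d - 1 - j = c := by omega
  have hmono : ∀ {A'}, (∀ k, gd (bs A' d) k = gd (bs A d) k) → (∀ i < d, irow A' d i ∈ Λ) →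
      (∀ i' < d, ∀ j' < i', i' * d + (d - 1 - j') < i * d + c + 1 → |mu (bs A' d) i' j'| ≤ 1 / 2) →
      (∀ i' < d, sc (bs A' d) 0 i' i' ≤ d * X * Z ^ (i * d + c + 1)) →
      SweepInv Λ X A A' (i * d + c + 1) := fun a b c d => ⟨a, b, c, d⟩
  have huniq : ∀ i' j', j' < i' → i' < d → i' * d + (d - 1 - j') = i * d + c → i' = i ∧ j' = j := by
    intro i' j' h1 h2 h
    have k1 : (i' * d + (d - 1 - j')) / d = i' := by
      rw [mul_comm, Nat.mul_add_div hd0, Nat.div_eq_of_lt (by omega), add_zero]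
    rw [h, e1] at k1
    subst k1
    exact ⟨rfl, by omega⟩
  refine Ev.block_one (Ev.ite (fun hpos => ?_) fun hneg => ?_)
  · have hji : j < i := by
      simp at hpos; omega
    have hIG := hGs ht.le hI
    have hjid : j * d + d ≤ i * d := by
      have := Nat.mul_le_mul_right d (show j + 1 ≤ i from hji); rwa [Nat.succ_mul] at this
    have hMj : sc (bs (τ.arr 5) d) 0 j j ≤ d * X :=
      sc_le_of_red hX hIG.gd_le hIG.one_le_gd (by omega) fun l hl =>
        hI.red j (by omega) l hl (by omega)
    have hcj := one_le_mul_sc_of_gd hIG.gd_le hIG.one_le_gd (show j < d by omega)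
    have hstep : ∀ q : ℤ, |mu (bs (τ.arr 5) d) i j - q| ≤ 1 / 2 →
      sc (Function.update (bs (τ.arr 5) d) i
        (bs (τ.arr 5) d i - (q : ℝ) • bs (τ.arr 5) d j)) 0 i i ≤ d * X * Z ^ (i * d + c + 1) := by
      intro q hq
      have := sc_update_le hX (by linarith) (one_le_mul_of_one_le_of_one_le hdX (one_le_pow₀ hZ1))
        hcj hMj (hI.nrm i hi) hq
      rw [pow_succ]; linarith
    refine redProg_spec (d := d) (X := X) (i := i) (j := j) (by simp [hdτ]) hIG (by simp) (by simp) hi hji hstep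
      (W := d * X * Z ^ (i * d + c + 1)) ?_ ?_
    · have h1 := hNmono (show i * d + c + 1 ≤ d * d from ht)
      have h2 := H.XY
      have : 0 ≤ d * X * Z ^ (d * d) := by positivity
      nlinarith
    · rintro ρ - ⟨q, hq, hrow⟩
      simp only [setVar_arr] at hq hrow ⊢
      have hbs := bs_of_irow_update hrow
      refine hmono ?_ ?_ ?_ ?_
      · intro k; rw [hbs, gd_update _ _ hji, hI.gd_eq]
      · intro l hl
        rw [hrow, Function.update_apply]; split_ifs
        · exact Λ.sub_mem (hI.mem i hi) (Λ.zsmul_mem (hI.mem j (by omega)) q)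
        · exact hI.mem l hl
      · intro i' hi' j' hj' hlt
        rw [hbs]
        by_cases hii : i' = i
        · subst hii
          rw [mu_update _ _ hji]
          rcases Nat.lt_succ_iff_lt_or_eq.1 hlt with h | h
          -- A column j' > j was treated earlier. It is not disturbed, since b j has coefficient
          -- zero there.
          · rw [mu_eq_zero _ (show j < j' by omega), mul_zero, sub_zero]
            exact hI.red i' hi' j' hj' h
          · obtain ⟨-, rfl⟩ := huniq i' j' hj' hi' h
            rw [mu_self, mul_one]
            · exact hq
            · intro h0; rw [h0] at hcj; linarith
        · rw [mu_update_of_ne _ _ hji hii]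
          refine hI.red i' hi' j' hj' (lt_of_le_of_ne (Nat.lt_succ_iff.1 hlt) fun h => ?_)
          exact hii (huniq i' j' hj' hi' h).1
      · intro i' hi'
        rw [hbs]
        by_cases hii : i' = i
        · subst hii; exact hstep q hq
        · refine le_trans (le_of_eq ?_) ((hI.nrm i' hi').trans (hNmono (Nat.le_succ _)))
          simp [sc, gs, hii]
  · have hji : i ≤ j := by
      simp at hneg; omega
    refine Ev.skip (hmono hI.gd_eq hI.mem ?_ fun i' hi' => (hI.nrm i' hi').trans (hNmono (Nat.le_succ _)))
    intro i' hi' j' hj' hlt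
    refine hI.red i' hi' j' hj' (lt_of_le_of_ne (Nat.lt_succ_iff.1 hlt) fun h => ?_)
    obtain ⟨rfl, rfl⟩ := huniq i' j' hj' hi' h
    -- A pair with j ≥ i imposes no condition, so skipping it loses nothing.
    omega

/-- Sets variable 42 to `k + 1` for some `k` for which the rows `k` and `k + 1` should be swapped
(to `0` if there is none). -/
def detectProg : Prog := block [.assign 42 0,
  forLoop 43 (v 5 - 1) (.ite
    (3 * .get 6 ((v 5 + v 43) * (v 5 * v 5) + v 43 * v 5 + v 43) -
      4 * .get 6 ((v 5 + v 43) * (v 5 * v 5) + (v 43 + 1) * v 5 + (v 43 + 1)))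
    (.assign 42 (v 43 + 1)) .skip)]

/-- Both stored integers carry the same factor `gd b k` ≥ 1, so comparing them decides the Lovász
condition exactly. -/
theorem detectProg_spec {R B : ℕ} {σ : State} {Q : State → Prop} {d : ℕ} {b : ℕ → EuclideanSpace ℝ (Fin d)}
    (hd : σ.var 5 = d) (hd0 : 0 < d) (hR : d ≤ R) (hB : d ≤ 2 ^ B)
    (hU : ∀ k < d, ∀ i < d, ∀ j < d,
      (σ.arr 6 (((d + k) * (d * d) + i * d + j : ℕ) : ℤ) : ℝ) = gd b k * sc b k i j)
    (hpos : ∀ k ≤ d, 1 ≤ gd b k)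
    (hQ : ∀ τ, Same detectProg σ τ →
      ((τ.var 42 = 0 ∧ ∀ k, k + 1 < d → 3 * sc b k k k ≤ 4 * sc b k (k + 1) (k + 1)) ∨
        ∃ k : ℕ, k + 1 < d ∧ τ.var 42 = k + 1 ∧ 4 * sc b k (k + 1) (k + 1) < 3 * sc b k k k) → Q τ) :
    Ev R B detectProg σ Q := by
  suffices h : Ev R B detectProg σ (fun τ =>
      ((τ.var 42 = 0 ∧ ∀ k, k + 1 < d → 3 * sc b k k k ≤ 4 * sc b k (k + 1) (k + 1)) ∨
        ∃ k : ℕ, k + 1 < d ∧ τ.var 42 = k + 1 ∧ 4 * sc b k (k + 1) (k + 1) < 3 * sc b k k k)) from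
    h.conseq fun τ h1 _ h2 => hQ τ h1 h2
  refine Ev.block_cons (Ev.assign 0 rfl (fun _ => by simp) (Ev.block_one ?_))
  refine Ev.forLoop (I := fun n τ =>
      ((τ.var 42 = 0 ∧ ∀ k < n, 3 * sc b k k k ≤ 4 * sc b k (k + 1) (k + 1)) ∨
        ∃ k : ℕ, k + 1 < d ∧ τ.var 42 = k + 1 ∧ 4 * sc b k (k + 1) (k + 1) < 3 * sc b k k k))
    (d - 1) (by omega) (by omega) rfl ?_ ?_ ?_ ?_
  · intro τ hτ
    simp [hτ.var 5 rfl, hd]; omega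
  · left; simp
  · intro k hk τ hτB hτ hkv hI
    have hdτ : τ.var 5 = d := by rw [hτ.var 5 rfl]; simp [hd]
    have hU' : τ.arr 6 = σ.arr 6 := by rw [hτ.arr 6 rfl]; simp
    have g1 := hU k (by omega) k (by omega) k (by omega)
    have g2 := hU k (by omega) (k + 1) (by omega) (k + 1) (by omega)
    have hg := hpos k (by omega)
    set x := σ.arr 6 (((d + k) * (d * d) + k * d + k : ℕ) : ℤ) with hx
    set y := σ.arr 6 (((d + k) * (d * d) + (k + 1) * d + (k + 1) : ℕ) : ℤ) with hy
    have he : (3 * Expr.get 6 ((v 5 + v 43) * (v 5 * v 5) + v 43 * v 5 + v 43) -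
      4 * Expr.get 6 ((v 5 + v 43) * (v 5 * v 5) + (v 43 + 1) * v 5 + (v 43 + 1))).eval τ = 3 * x - 4 * y := by
      simp only [eval_sub, eval_mul, eval_add, eval_get, eval_ofNat, eval_var, eval_one, hdτ, hkv, hU',
        hx, hy]
      push_cast
      rfl
    refine Ev.ite (fun hc => ?_) fun hc => ?_
    · rw [he] at hc
      refine Ev.assign (k + 1) (by simp [hkv]) (fun _ => ?_) (Or.inr ⟨k, by omega, by simp, ?_⟩)
      · exact_mod_cast abs_natCast_le (n := k + 1) (by omega)
      · have : (4 * y : ℝ) < 3 * x := by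
          have : 4 * y < 3 * x := by linarith
          exact_mod_cast this
        rw [g1, g2] at this
        nlinarith
    · rw [he] at hc
      refine Ev.skip ?_
      rcases hI with ⟨h1, h2⟩ | h
      · left
        refine ⟨by simpa using h1, fun k' hk' => ?_⟩
        rcases Nat.lt_succ_iff_lt_or_eq.1 hk' with h | rfl
        · exact h2 k' h
        · have : (3 * x : ℝ) ≤ 4 * y := by
            have : 3 * x ≤ 4 * y := by linarith
            exact_mod_cast this
          rw [g1, g2] at this
          nlinarith
      · right; simpa using h
  · rintro τ hτ - (⟨h1, h2⟩ | h)
    · exact Or.inl ⟨h1, fun k hk => h2 k (by omega)⟩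
    · exact Or.inr h

/-- Swaps the rows `k - 1` and `k`, where `k` is variable 42. -/
def swapProg : Prog := forLoop 44 (v 5) (block [
  .assign 45 (.get 5 ((v 42 - 1) * v 5 + v 44)),
  .store 5 ((v 42 - 1) * v 5 + v 44) (.get 5 (v 42 * v 5 + v 44)),
  .store 5 (v 42 * v 5 + v 44) (v 45)])

theorem swapProg_spec {R B : ℕ} {σ : State} {Q : State → Prop} {d k : ℕ}
    (hd : σ.var 5 = d) (hR : d ≤ R) (hB : d ≤ 2 ^ B) (hk : σ.var 42 = k + 1)
    (hQ : ∀ τ, Same swapProg σ τ →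
      irow (τ.arr 5) d = irow (σ.arr 5) d ∘ Equiv.swap k (k + 1) → Q τ) :
    Ev R B swapProg σ Q := by
  set A := σ.arr 5 with hA
  refine Ev.forLoop (I := fun c τ => ∀ z, τ.arr 5 z =
    if (k * d : ℤ) ≤ z ∧ z < k * d + c then A (z + d) else
    if ((k * d : ℤ) + d) ≤ z ∧ z < k * d + d + c then A (z - d) else A z) d hR hB rfl ?_ ?_ ?_ ?_
  · intro τ hτ
    simp [hτ.var 5 rfl, hd]
  · intro z
    rw [if_neg (by push_cast; omega), if_neg (by push_cast; omega)]
    simp [hA]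
  · intro c hc τ hτB hτ hcv hI
    have v5 : τ.var 5 = d := by rw [hτ.var 5 rfl, hd]
    have v42 : τ.var 42 = k + 1 := by rw [hτ.var 42 rfl, hk]
    have r1 : τ.arr 5 (k * d + c) = A (k * d + c) := by
      rw [hI, if_neg (by omega), if_neg (by omega)]
    have r2 : τ.arr 5 (k * d + d + c) = A (k * d + d + c) := by
      rw [hI, if_neg (by omega), if_neg (by omega)]
    refine Ev.block_cons (Ev.assign (A (k * d + c)) ?_ (fun _ => by rw [← r1]; exact hτB.2 _ _) ?_)
    · simp only [eval_get, eval_add, eval_mul, eval_sub, eval_var, eval_one, v5, v42, hcv]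
      rw [← r1]; ring_nf
    refine Ev.block_cons (Ev.store (k * d + c : ℤ) (A (k * d + d + c)) ?_ ?_
      (fun _ => by rw [← r2]; exact hτB.2 _ _) ?_)
    · simp [v5, v42, hcv]
    · simp [v5, v42, hcv]
      rw [← r2]; ring_nf
    refine Ev.block_one (Ev.store (k * d + d + c : ℤ) (A (k * d + c)) ?_ ?_
      (fun _ => by rw [← r1]; exact hτB.2 _ _) ?_)
    · simp [v5, v42, hcv]; ring
    · simp
    intro z
    simp only [setVar_arr, setArr_arr_self, Function.update_apply]
    by_cases hz : z = k * d + d + c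
    · subst hz
      rw [if_pos rfl, if_neg (by push_cast; omega), if_pos (by push_cast; omega)]
      ring_nf
    · rw [if_neg hz]
      by_cases hz' : z = k * d + c
      · subst hz'
        rw [if_pos rfl, if_pos (by push_cast; omega)]
        ring_nf
      · rw [if_neg hz', hI]
        congr 1
        · push_cast; exact propext (by omega)
        · congr 1
          push_cast; exact propext (by omega)
  · intro τ hτ _ hI
    refine hQ τ hτ ?_
    funext l t
    have ht := t.2
    simp only [irow, Function.comp_apply]
    rw [hI]
    rcases eq_or_ne l k with rfl | hl
    · rw [if_pos (by omega), Equiv.swap_apply_left]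
      push_cast; ring_nf
    rcases eq_or_ne l (k + 1) with rfl | hl'
    · rw [if_neg (by push_cast; rw [add_mul]; omega), if_pos (by push_cast; rw [add_mul]; omega), Equiv.swap_apply_right]
      push_cast; ring_nf
    · rw [Equiv.swap_apply_of_ne_of_ne hl hl', if_neg, if_neg]
      all_goals
        rintro ⟨h1, h2⟩
        rcases lt_or_gt_of_ne hl with h | h
        · have : (l + 1) * d ≤ k * d := Nat.mul_le_mul_right _ h
          have : ((l + 1 : ℕ) * d : ℤ) ≤ k * d := by exact_mod_cast this
          push_cast at this; rw [add_mul] at this; omega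
        · have : (k + 1 + 1) * d ≤ l * d := Nat.mul_le_mul_right _ (by omega)
          have : ((k + 1 + 1 : ℕ) * d : ℤ) ≤ l * d := by exact_mod_cast this
          push_cast at this; rw [add_mul, add_mul] at this; omega

end BitRAM

/-! ### The reduction loop and its termination -/

namespace BitRAM

open LatticeReduction

/-- The result of lattice reduction: a short nonzero vector. -/
def lllProg : Prog := block [.assign 41 1, .while (v 41) (block [
  .assign 41 0, sweepProg, gsProg, detectProg, .ite (v 42) (block [swapProg, .assign 41 1]) .skip])]

/-- The properties of a basis that every round of the reduction preserves. -/
structure LatInv {d : ℕ} (Λ : AddSubgroup (Fin d → ℤ)) (X Δ : ℝ) (A : ℤ → ℤ) : Prop where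
  gd_le : ∀ k ≤ d, gd (bs A d) k ≤ X
  one_le_gd : ∀ k ≤ d, 1 ≤ gd (bs A d) k
  gd_eq : gd (bs A d) d = Δ
  mem : ∀ i < d, irow A d i ∈ Λ
  nrm : ∀ i < d, sc (bs A d) 0 i i ≤ d * X

/-- A swap changes only the Gram determinant of order k + 1, and the failing Lovász condition says
that this one shrinks by the factor 3/4. The product of the Gram determinants is the potential that
bounds the number of rounds. -/
theorem LatInv.swap {d : ℕ} {Λ : AddSubgroup (Fin d → ℤ)} {X Δ : ℝ} {A A' : ℤ → ℤ}
    (h : LatInv Λ X Δ A) {k : ℕ} (hk : k + 1 < d)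
    (hsc : 4 * sc (bs A d) k (k + 1) (k + 1) < 3 * sc (bs A d) k k k)
    (hA : irow A' d = irow A d ∘ Equiv.swap k (k + 1)) :
    LatInv Λ X Δ A' ∧ ∏ l ∈ Finset.range d, gd (bs A' d) (l + 1) ≤
      3 / 4 * ∏ l ∈ Finset.range d, gd (bs A d) (l + 1) := by
  have hb : bs A' d = bs A d ∘ Equiv.swap k (k + 1) := by
    funext i; rw [bs, hA]; rfl
  have hσ : ∀ i < d, Equiv.swap k (k + 1) i < d := by
    intro i hi; rw [Equiv.swap_apply_def]; split_ifs <;> omega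
  have hgk := h.one_le_gd k (by omega)
  have hk1 : gd (bs A' d) (k + 1) = gd (bs A d) k * sc (bs A d) k (k + 1) (k + 1) := by
    rw [hb, gd_swap_succ]
  have hother : ∀ l, l ≠ k + 1 → gd (bs A' d) l = gd (bs A d) l := by
    intro l hl
    rcases lt_or_gt_of_ne hl with h | h
    · rw [hb, gd_swap_of_le _ _ (by omega)]
    · rw [hb, gd_swap_of_lt _ _ h]
  have hlt : gd (bs A' d) (k + 1) ≤ 3 / 4 * gd (bs A d) (k + 1) := by
    rw [hk1, gd_succ]; nlinarith
  -- The new Gram determinant is an integer and positive, hence at least 1.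
  have hone : 1 ≤ gd (bs A' d) (k + 1) := by
    obtain ⟨z, hz⟩ := exists_int_gd_mul_sc (exists_int_inner_bs A d) k (k + 1) (k + 1)
    rw [hk1, hz]
    have h1 := one_le_mul_sc_of_gd h.gd_le h.one_le_gd hk
    have h2 := sc_succ_le (bs A d) k (k + 1)
    have hX : 0 < X := by linarith [h.gd_le 0 (Nat.zero_le _), h.one_le_gd 0 (Nat.zero_le _)]
    have h3 : 0 < sc (bs A d) (k + 1) (k + 1) (k + 1) := by
      by_contra hn; nlinarith
    have : (0 : ℝ) < z := by rw [← hz]; exact mul_pos (by linarith) (by linarith)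
    have : 0 < z := by exact_mod_cast this
    exact_mod_cast this
  refine ⟨⟨fun l hl => ?_, fun l hl => ?_, ?_, fun i hi => ?_, fun i hi => ?_⟩, ?_⟩
  · by_cases hlk : l = k + 1
    · rw [hlk]; linarith [h.gd_le (k + 1) hk.le, h.one_le_gd (k + 1) hk.le]
    · rw [hother l hlk]; exact h.gd_le l hl
  · by_cases hlk : l = k + 1
    · rw [hlk]; exact hone
    · rw [hother l hlk]; exact h.one_le_gd l hl
  · rw [hother d (by omega)]; exact h.gd_eq
  · rw [hA]; exact h.mem _ (hσ i hi)
  · have : sc (bs A' d) 0 i i = sc (bs A d) 0 (Equiv.swap k (k + 1) i) (Equiv.swap k (k + 1) i) := by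
      rw [hb]; rfl
    rw [this]; exact h.nrm _ (hσ i hi)
  · calc ∏ l ∈ Finset.range d, gd (bs A' d) (l + 1)
        ≤ ∏ l ∈ Finset.range d, ((if l = k then 3 / 4 else 1) * gd (bs A d) (l + 1)) := by
          refine Finset.prod_le_prod (fun l hl => ?_) fun l hl => ?_
          · have hl := Finset.mem_range.1 hl
            by_cases hlk : l = k
            · rw [hlk]; linarith
            · rw [hother _ (by omega)]; linarith [h.one_le_gd (l + 1) hl]
          · split_ifs with hlk
            · rw [hlk]; exact hlt
            · rw [hother _ (by omega), one_mul]
      _ = _ := by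
          rw [Finset.prod_mul_distrib, Finset.prod_ite_eq', if_pos (Finset.mem_range.2 (by omega))]

/-- The potential is at most X ^ d initially, at least 1 throughout, and loses a factor 3/4 with
every swap. Hence `hXR` leaves room for fewer than R swaps; a round without a swap ends the loop
with a reduced basis, whose first vector is short by `sc_zero_pow_le`. -/
theorem lllProg_spec {R B : ℕ} {σ : State} {Q : State → Prop} {d : ℕ} {X Δ : ℝ}
    {Λ : AddSubgroup (Fin d → ℤ)} (hd : σ.var 5 = d) (hd0 : 0 < d) (h : LatInv Λ X Δ (σ.arr 5))
    (hR : 2 * d * (d * d) ≤ R) (hB : 2 * d * (d * d) ≤ 2 ^ B)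
    (hXB : 3 * X * (d * X * (2 + 6 * X * (d * X)) ^ (d * d)) ≤ 2 ^ B)
    (hXR : X ^ d * (3 / 4) ^ R < 1)
    (hQ : ∀ τ, Same lllProg σ τ → irow (τ.arr 5) d 0 ∈ Λ → irow (τ.arr 5) d 0 ≠ 0 →
      (∀ i < d, sc (bs (τ.arr 5) d) 0 i i ≤ d * X) →
      ((∑ j, irow (τ.arr 5) d 0 j * irow (τ.arr 5) d 0 j : ℤ) : ℝ) ^ d ≤
        2 ^ (∑ l ∈ Finset.range d, l) * Δ → Q τ) :
    Ev R B lllProg σ Q := by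
  have hX : 1 ≤ X := (h.one_le_gd 0 (Nat.zero_le _)).trans (h.gd_le 0 (Nat.zero_le _))
  have hd1 : (1 : ℝ) ≤ d := by exact_mod_cast hd0
  have hdX : 1 ≤ (d : ℝ) * X := by nlinarith
  set Z : ℝ := 2 + 6 * X * (d * X) with hZ
  have hZ1 : 1 ≤ Z := by rw [hZ]; nlinarith
  have hGs : ∀ {A}, LatInv Λ X Δ A → GsHyp R B A d X (d * X * Z ^ (d * d)) := fun {A} hA =>
    ⟨hd0, hX, hR, hB, hXB, hA.gd_le, hA.one_le_gd, fun i hi => (hA.nrm i hi).trans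
      (le_mul_of_one_le_right (by linarith) (one_le_pow₀ hZ1))⟩
  have hSw : ∀ {A}, LatInv Λ X Δ A → SweepInv Λ X A A 0 := fun {A} hA =>
    ⟨fun _ => rfl, hA.mem, fun _ _ _ _ h => absurd h (Nat.not_lt_zero _),
      fun i hi => by simpa using hA.nrm i hi⟩
  have hdR : d ≤ 2 * d * (d * d) := by nlinarith [Nat.mul_pos hd0 hd0]
  suffices hmain : Ev R B lllProg σ (fun τ => LatInv Λ X Δ (τ.arr 5) ∧ ∀ k, k + 1 < d →
      sc (bs (τ.arr 5) d) k k k ≤ 2 * sc (bs (τ.arr 5) d) (k + 1) (k + 1) (k + 1)) by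
    refine hmain.conseq fun τ hτ _ hτ' => ?_
    obtain ⟨hL, hred⟩ := hτ'
    have e : sc (bs (τ.arr 5) d) 0 0 0 =
        ((∑ j, irow (τ.arr 5) d 0 j * irow (τ.arr 5) d 0 j : ℤ) : ℝ) := by
      rw [← inner_toV]; rfl
    refine hQ τ hτ (hL.mem 0 hd0) (fun h0 => ?_) hL.nrm ?_
    · have := one_le_mul_sc_of_gd hL.gd_le hL.one_le_gd hd0
      rw [e, h0] at this
      norm_num at this
    · rw [← e, ← hL.gd_eq]
      exact sc_zero_pow_le hred
  refine Ev.block_cons (Ev.assign 1 rfl (fun _ => by exact_mod_cast Nat.one_le_two_pow) (Ev.block_one ?_))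
  refine Ev.while (I := fun n τ => LatInv Λ X Δ (τ.arr 5) ∧
    ((τ.var 41 = 1 ∧ ∏ l ∈ Finset.range d, gd (bs (τ.arr 5) d) (l + 1) ≤ (3 / 4) ^ n * X ^ d) ∨
      (τ.var 41 = 0 ∧ ∀ k, k + 1 < d → sc (bs (τ.arr 5) d) k k k ≤
        2 * sc (bs (τ.arr 5) d) (k + 1) (k + 1) (k + 1)))) ⟨h, Or.inl ⟨by simp, ?_⟩⟩ ?_ ?_
  · rw [pow_zero, one_mul]
    refine (Finset.prod_le_prod (fun l hl => ?_) fun l hl => h.gd_le (l + 1) (Finset.mem_range.1 hl)).trans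
      (by simp)
    linarith [h.one_le_gd (l + 1) (Finset.mem_range.1 hl)]
  · rintro n τ hτB hτ ⟨hL, hcase⟩ hguard
    obtain ⟨h41, hpot⟩ : τ.var 41 = 1 ∧
        ∏ l ∈ Finset.range d, gd (bs (τ.arr 5) d) (l + 1) ≤ (3 / 4) ^ n * X ^ d := by
      rcases hcase with h | ⟨h, -⟩
      · exact h
      · rw [eval_var, h] at hguard; exact absurd hguard (lt_irrefl _)
    have hdτ : τ.var 5 = d := by rw [hτ.var 5 rfl]; simp [hd]
    refine ⟨?_, ?_⟩
    · by_contra hn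
      have h1 : (1 : ℝ) ≤ ∏ l ∈ Finset.range d, gd (bs (τ.arr 5) d) (l + 1) := by
        calc (1 : ℝ) = ∏ l ∈ Finset.range d, 1 := by simp
          _ ≤ _ := Finset.prod_le_prod (fun _ _ => zero_le_one) fun l hl =>
            hL.one_le_gd (l + 1) (Finset.mem_range.1 hl)
      have h2 : (3 / 4 : ℝ) ^ n ≤ (3 / 4) ^ R :=
        pow_le_pow_of_le_one (by norm_num) (by norm_num) (not_lt.1 hn)
      have h3 : (0 : ℝ) < X ^ d := by positivity
      nlinarith
    refine Ev.block_cons (Ev.assign 0 rfl (fun _ => by simp) (Ev.block_cons ?_))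
    refine sweepProg_spec (d := d) (Λ := Λ) (X := X) (by simp [hdτ]) (hGs hL) (hSw hL) ?_
    intro ρ hρ hρG hρS
    simp only [setVar_arr] at hρS
    have hdρ : ρ.var 5 = d := by rw [hρ.var 5 rfl]; simp [hdτ]
    have h41ρ : ρ.var 41 = 0 := by rw [hρ.var 41 rfl]; simp
    have hred : ∀ i < d, ∀ j < i, |mu (bs (ρ.arr 5) d) i j| ≤ 1 / 2 := by
      intro i hi j hj
      refine hρS.red i hi j hj ?_
      have : (i + 1) * d ≤ d * d := Nat.mul_le_mul_right _ hi
      rw [add_mul] at this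
      omega
    have hLρ : LatInv Λ X Δ (ρ.arr 5) :=
      ⟨hρG.gd_le, hρG.one_le_gd, by rw [hρS.gd_eq, hL.gd_eq], hρS.mem, fun i hi =>
        sc_le_of_red hX hρG.gd_le hρG.one_le_gd hi (hred i hi)⟩
    have hpotρ : ∏ l ∈ Finset.range d, gd (bs (ρ.arr 5) d) (l + 1) ≤ (3 / 4) ^ n * X ^ d := by
      simp only [hρS.gd_eq]; exact hpot
    refine Ev.block_cons (gsProg_spec hdρ hρG fun ρ' hρ' hU => ?_)
    have hA' : ρ'.arr 5 = ρ.arr 5 := hρ'.arr 5 rfl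
    have hdρ' : ρ'.var 5 = d := (hρ'.var 5 rfl).trans hdρ
    refine Ev.block_cons (detectProg_spec hdρ' hd0 (hdR.trans hR) (hdR.trans hB) hU hρG.one_le_gd
      fun υ hυ hdet => ?_)
    have hAυ : υ.arr 5 = ρ.arr 5 := (hυ.arr 5 rfl).trans hA'
    have hdυ : υ.var 5 = d := (hυ.var 5 rfl).trans hdρ'
    have h41υ : υ.var 41 = 0 := (hυ.var 41 rfl).trans ((hρ'.var 41 rfl).trans h41ρ)
    refine Ev.block_one (Ev.ite (fun hc => ?_) fun hc => ?_)
    · obtain ⟨k, hk, h42, hsc⟩ := hdet.resolve_left fun h0 => by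
        rw [eval_var, h0.1] at hc; exact lt_irrefl _ hc
      refine Ev.block_cons (swapProg_spec hdυ (hdR.trans hR) (hdR.trans hB) h42 fun ω hω hrow => ?_)
      rw [hAυ] at hrow
      obtain ⟨hL', hp'⟩ := hLρ.swap hk hsc hrow
      refine Ev.block_one (Ev.assign 1 rfl (fun _ => by exact_mod_cast Nat.one_le_two_pow)
        ⟨hL', Or.inl ⟨by simp, ?_⟩⟩)
      simp only [setVar_arr]
      rw [pow_succ]
      nlinarith
    · have h0 : υ.var 42 = 0 ∧ _ := hdet.resolve_right fun ⟨k, hk, h42, _⟩ => by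
        rw [eval_var, h42] at hc; exact hc (by positivity)
      refine Ev.skip ?_
      rw [hAυ]
      exact ⟨hLρ, Or.inr ⟨h41υ, fun k hk => le_two_mul_of_reduced (hred (k + 1) hk k (by omega))
        (h0.2 k hk)⟩⟩
  · rintro n τ - hτ ⟨hL, hcase⟩ hguard
    rcases hcase with ⟨h1, -⟩ | ⟨-, h2⟩
    · rw [eval_var, h1] at hguard; exact absurd one_pos hguard
    · exact ⟨hL, h2⟩

end BitRAM

/-! ### Integer roots of polynomials by finite differences and bisection -/

namespace RootFinding

open Polynomial

/-- `P` takes at most one switch on `[u, w]`. -/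
def OneSwitch (P : ℤ → Prop) (u w : ℤ) : Prop :=
  (∀ x y, u ≤ x → x ≤ y → y ≤ w → P x → P y) ∨ (∀ x y, u ≤ x → x ≤ y → y ≤ w → P y → P x)

theorem monotone_of_step {g : ℤ → ℤ} {u w : ℤ} (h : ∀ x, u ≤ x → x < w → g x ≤ g (x + 1))
    {x y : ℤ} (hx : u ≤ x) (hxy : x ≤ y) (hy : y ≤ w) : g x ≤ g y := by
  obtain ⟨n, rfl⟩ := Int.le.dest hxy
  induction n with
  | zero => simp
  | succ n ih =>
    have h1 := ih (by omega) (by push_cast at hy; omega)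
    have h2 := h (x + n) (by omega) (by push_cast at hy; omega)
    push_cast
    rw [← add_assoc]
    exact h1.trans h2

/-- A difference that is positive throughout makes g nondecreasing; one that is nowhere positive
makes it nonincreasing. Either way the positivity of g switches at most once. -/
theorem oneSwitch_of_fwdDiff {g : ℤ → ℤ} {u w : ℤ}
    (h : ∀ x y, u ≤ x → x < w → u ≤ y → y < w → (0 < fwdDiff 1 g x ↔ 0 < fwdDiff 1 g y)) :
    OneSwitch (fun x => 0 < g x) u w := by
  by_cases hc : 0 < fwdDiff 1 g u
  · left
    intro x y hx hxy hy h0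
    refine lt_of_lt_of_le h0 (monotone_of_step (fun z hz hzw => ?_) hx hxy hy)
    have := (h u z le_rfl (by omega) hz hzw).1 hc
    rw [fwdDiff] at this; omega
  · right
    intro x y hx hxy hy h0
    have := monotone_of_step (g := fun z => - g z) (u := u) (w := w) (fun z hz hzw => by
      have := mt (h u z le_rfl (by omega) hz hzw).2 hc
      rw [fwdDiff] at this; omega) hx hxy hy
    omega

/-- `P` is constant on each of the intervals `[c i, c (i + 1))`. -/
def Segments (P : ℤ → Prop) (c : ℕ → ℤ) (n : ℕ) : Prop :=
  ∀ i < n, c i ≤ c (i + 1) ∧ ∀ x y, c i ≤ x → x < c (i + 1) → c i ≤ y → y < c (i + 1) → (P x ↔ P y)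

/-- `w` is a point between `u` and `u'` where `P` switches if it does. -/
structure IsSwitch (P : ℤ → Prop) (u u' w : ℤ) : Prop where
  left_le : u ≤ w
  le_right : w ≤ u'
  left : ∀ x, u ≤ x → x < w → (P x ↔ P u)
  right : ∀ x, w ≤ x → x ≤ u' → (P x ↔ P u')

/-- The old breakpoint c (i + 1) lies between two consecutive new ones. On both sides of it, up to
these new breakpoints, P' has the same truth value as at c (i + 1) itself. -/
theorem segments_of_isSwitch {P' : ℤ → Prop} {c c' : ℕ → ℤ} {n : ℕ} (h0 : c' 0 = c 0) (hs : ∀ i < n, IsSwitch P' (c i) (c (i + 1)) (c' (i + 1))) :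
    Segments P' c' n := by
  intro i hi
  have hsi := hs i hi
  cases i with
  | zero =>
    rw [h0]
    exact ⟨hsi.left_le, fun x y hx hx' hy hy' => (hsi.left x hx hx').trans (hsi.left y hy hy').symm⟩
  | succ i =>
    have hsi' := hs i (by omega)
    refine ⟨hsi'.le_right.trans hsi.left_le, fun x y hx hx' hy hy' => ?_⟩
    have key : ∀ x, c' (i + 1) ≤ x → x < c' (i + 2) → (P' x ↔ P' (c (i + 1))) := by
      intro x hx hx'
      rcases le_or_gt x (c (i + 1)) with hle | hlt
      · exact hsi'.right x hx hle
      · exact hsi.left x hlt.le hx'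
    exact (key x hx hx').trans (key y hy hy').symm

/-- The polynomial `∑ w j * X ^ j * H ^ (d - 1 - j)`. -/
noncomputable def hpoly (w : ℕ → ℤ) (H : ℤ) (d : ℕ) : ℤ[X] :=
  ∑ j ∈ Finset.range d, C (w j * H ^ (d - 1 - j)) * X ^ j

theorem eval_hpoly (w : ℕ → ℤ) (H : ℤ) (d : ℕ) (y : ℤ) :
    (hpoly w H d).eval y = ∑ j ∈ Finset.range d, w j * H ^ (d - 1 - j) * y ^ j := by
  simp [hpoly, eval_finsetSum]

theorem natDegree_hpoly (w : ℕ → ℤ) (H : ℤ) (d : ℕ) : (hpoly w H d).natDegree ≤ d - 1 := by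
  refine natDegree_sum_le_of_forall_le _ _ fun j hj => ?_
  exact (natDegree_C_mul_X_pow_le _ _).trans (by have := Finset.mem_range.1 hj; omega)

theorem coeff_hpoly (w : ℕ → ℤ) (H : ℤ) (d : ℕ) {j : ℕ} (hj : j < d) :
    (hpoly w H d).coeff j = w j * H ^ (d - 1 - j) := by
  simp only [hpoly, finsetSum_coeff, coeff_C_mul_X_pow]
  rw [Finset.sum_eq_single j]
  · simp
  · intro i _ hij; rw [if_neg (Ne.symm hij)]
  · intro h; exact absurd (Finset.mem_range.2 hj) h

/-- The function that is positive exactly at the roots. -/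
noncomputable def rootInd (w : ℕ → ℤ) (H : ℤ) (d : ℕ) (y : ℤ) : ℤ := 1 - ((hpoly w H d).eval y) ^ 2

theorem rootInd_pos_iff {w : ℕ → ℤ} {H : ℤ} {d : ℕ} {y : ℤ} :
    0 < rootInd w H d y ↔ (hpoly w H d).eval y = 0 := by
  unfold rootInd
  constructor
  · intro h
    by_contra h0
    have : 0 < ((hpoly w H d).eval y) ^ 2 := by positivity
    omega
  · intro h; rw [h]; norm_num

/-- The degree of 1 - f ^ 2 is at most 2 (d - 1). -/
theorem fwdDiff_rootInd (w : ℕ → ℤ) (H : ℤ) {d : ℕ} (hd : 0 < d) :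
    (fwdDiff 1)^[2 * d - 1] (rootInd w H d) = 0 := by
  have h1 : rootInd w H d = (1 - hpoly w H d ^ 2).eval := by
    funext y; simp [rootInd]
  rw [h1]
  apply Polynomial.fwdDiff_iter_eq_zero_of_degree_lt
  have h2 : (hpoly w H d ^ 2).natDegree ≤ 2 * (d - 1) :=
    natDegree_pow_le_of_le 2 (natDegree_hpoly w H d)
  have h3 : (1 - hpoly w H d ^ 2).natDegree ≤ max 0 (2 * (d - 1)) :=
    natDegree_sub_le_of_le (by simp) h2
  omega

/-- Breakpoint tables: row `l` has breakpoints for the sign of the difference of order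
`2 * d - 1 - l`. -/
def Cell (g : ℤ → ℤ) (H : ℤ) (d : ℕ) (c : ℕ → ℕ → ℤ) (l i : ℕ) : Prop :=
  (i = 0 → c l i = 0) ∧ (0 < i → l = 0 → c l i = H) ∧
    (0 < i → 0 < l → IsSwitch (fun x => 0 < (fwdDiff 1)^[2 * d - 1 - l] g x)
      (c (l - 1) (i - 1)) (c (l - 1) i) (c l i))

/-- Induction over the rows. In row 0 the difference is identically zero. Row l has at most l + 1
genuine segments and all later breakpoints equal H, so 2 d columns suffice up to the last row 2 d -
1. -/
theorem segments_of_cell {g : ℤ → ℤ} {H : ℤ} {d : ℕ} {c : ℕ → ℕ → ℤ} (hH : 0 ≤ H)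
    (hg : (fwdDiff 1)^[2 * d - 1] g = 0) {l : ℕ}
    (hc : ∀ l' ≤ l, ∀ i ≤ 2 * d, Cell g H d c l' i) :
    Segments (fun x => 0 < (fwdDiff 1)^[2 * d - 1 - l] g x) (c l) (2 * d) ∧
      ∀ i ≤ 2 * d, l < i → c l i = H := by
  induction l with
  | zero =>
    constructor
    · intro i hi
      constructor
      · rw [(hc 0 le_rfl (i + 1) hi).2.1 (by omega) rfl]
        rcases Nat.eq_zero_or_pos i with rfl | h0
        · rw [(hc 0 le_rfl 0 (by omega)).1 rfl]; exact hH
        · rw [(hc 0 le_rfl i hi.le).2.1 h0 rfl]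
      · intro x y _ _ _ _
        simp [hg]
    · intro i hi h0
      exact (hc 0 le_rfl i hi).2.1 h0 rfl
  | succ l ih =>
    obtain ⟨-, h2⟩ := ih fun l' hl' => hc l' (by omega)
    refine ⟨segments_of_isSwitch (c := c l) ?_ fun i hi => ?_, fun i hi hli => ?_⟩
    · rw [(hc (l + 1) le_rfl 0 (by omega)).1 rfl, (hc l (by omega) 0 (by omega)).1 rfl]
    · simpa using (hc (l + 1) le_rfl (i + 1) hi).2.2 (by omega) (by omega)
    · have := (hc (l + 1) le_rfl i hi).2.2 (by omega) (by omega)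
      have e1 := h2 (i - 1) (by omega) (by omega)
      have e2 := h2 i hi (by omega)
      simp only [Nat.add_sub_cancel, e1, e2] at this
      exact le_antisymm this.le_right this.left_le

/-- Each interval of the previous row contains at most one switch. -/
theorem oneSwitch_of_segments {g : ℤ → ℤ} {d l : ℕ} {c : ℕ → ℤ} (hl : l + 1 ≤ 2 * d - 1)
    (h : Segments (fun x => 0 < (fwdDiff 1)^[2 * d - 1 - l] g x) c (2 * d)) {i : ℕ} (hi : i < 2 * d) :
    OneSwitch (fun x => 0 < (fwdDiff 1)^[2 * d - 1 - (l + 1)] g x) (c i) (c (i + 1)) := by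
  refine oneSwitch_of_fwdDiff fun x y hx hx' hy hy' => ?_
  have := (h i hi).2 x y hx hx' hy hy'
  rw [show 2 * d - 1 - l = (2 * d - 1 - (l + 1)) + 1 by omega] at this
  simpa only [Function.iterate_succ_apply'] using this

theorem exists_segment {c : ℕ → ℤ} {n : ℕ} {y : ℤ} (h0 : c 0 ≤ y) (hn : y < c n) :
    ∃ i < n, c i ≤ y ∧ y < c (i + 1) := by
  induction n with
  | zero => omega
  | succ n ih =>
    by_cases h : y < c n
    · obtain ⟨i, hi, h1⟩ := ih h; exact ⟨i, by omega, h1⟩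
    · exact ⟨n, by omega, not_lt.1 h, hn⟩

/-- All roots in `[0, H)` lie within distance `d` to the right of a breakpoint of the last row. -/
theorem exists_candidate {w : ℕ → ℤ} {H : ℤ} {d : ℕ} {c : ℕ → ℕ → ℤ} (hH : 0 < H) (hd : 0 < d)
    (hw : ∃ j < d, w j ≠ 0)
    (hc : ∀ l ≤ 2 * d - 1, ∀ i ≤ 2 * d, Cell (rootInd w H d) H d c l i) {y : ℤ} (hy0 : 0 ≤ y)
    (hy : y < H) (hroot : (hpoly w H d).eval y = 0) :
    ∃ i < 2 * d, ∃ t < d, y = c (2 * d - 1) i + t := by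
  obtain ⟨hseg, hlast⟩ := segments_of_cell hH.le (fwdDiff_rootInd w H hd) hc
  rw [Nat.sub_self, Function.iterate_zero, id] at hseg
  have c0 : c (2 * d - 1) 0 = 0 := (hc _ le_rfl 0 (by omega)).1 rfl
  obtain ⟨i, hi, h1, h2⟩ := exists_segment (c := c (2 * d - 1)) (n := 2 * d) (y := y) (by omega)
    (by rw [hlast _ le_rfl (by omega)]; exact hy)
  refine ⟨i, hi, (y - c (2 * d - 1) i).toNat, ?_, by omega⟩
  -- Otherwise all integers from the breakpoint to y would be roots: at least d + 1 of them, against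
  -- degree at most d - 1.
  by_contra hlt
  have hp0 : hpoly w H d ≠ 0 := by
    obtain ⟨j, hj, hwj⟩ := hw
    intro h0
    have := coeff_hpoly w H d hj
    rw [h0, coeff_zero] at this
    exact mul_ne_zero hwj (pow_ne_zero _ hH.ne') this.symm
  refine hp0 (eq_zero_of_natDegree_lt_card_of_eval_eq_zero' _
    (Finset.Icc (c (2 * d - 1) i) y) (fun x hx => ?_) ?_)
  · obtain ⟨hx1, hx2⟩ := Finset.mem_Icc.1 hx
    rw [← rootInd_pos_iff]
    exact ((hseg i hi).2 x y hx1 (by omega) h1 h2).2 (rootInd_pos_iff.2 hroot)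
  · rw [Int.card_Icc]
    have := natDegree_hpoly w H d
    omega

end RootFinding

/-! ### Evaluating a polynomial and its differences -/

namespace BitRAM

open RootFinding

/-- Homogeneous Horner scheme. -/
def horner (w : ℕ → ℤ) (H : ℤ) (d : ℕ) (y : ℤ) : ℕ → ℤ
  | 0 => 0
  | t + 1 => horner w H d y t * y + w (d - (t + 1)) * H ^ t

theorem horner_eq (w : ℕ → ℤ) (H : ℤ) (d : ℕ) (y : ℤ) (t : ℕ) :
    horner w H d y t = ∑ s ∈ Finset.range t, w (d - (s + 1)) * H ^ s * y ^ (t - 1 - s) := by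
  induction t with
  | zero => rfl
  | succ t ih =>
    rw [horner, ih, Finset.sum_range_succ, Finset.sum_mul]
    congr 1
    · refine Finset.sum_congr rfl fun s hs => ?_
      have := Finset.mem_range.1 hs
      rw [show t + 1 - 1 - s = (t - 1 - s) + 1 by omega, pow_succ]; ring
    · simp

theorem horner_self (w : ℕ → ℤ) (H : ℤ) (d : ℕ) (y : ℤ) :
    horner w H d y d = (hpoly w H d).eval y := by
  rw [horner_eq, eval_hpoly, ← Finset.sum_range_reflect]
  refine Finset.sum_congr rfl fun j hj => ?_
  have := Finset.mem_range.1 hj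
  rw [show d - (d - 1 - j + 1) = j by omega, show d - 1 - (d - 1 - j) = j by omega]

theorem abs_horner_le {w : ℕ → ℤ} {H y W Y : ℤ} {d : ℕ} (hw : ∀ j < d, |w j| ≤ W) (hH : |H| ≤ Y)
    (hy : |y| ≤ Y) (hY : 1 ≤ Y) {t : ℕ} (ht : t ≤ d) : |horner w H d y t| ≤ t * W * Y ^ t := by
  induction t with
  | zero => simp [horner]
  | succ t ih =>
    have h1 := ih (by omega)
    have hW : 0 ≤ W := (abs_nonneg _).trans (hw 0 (by omega))
    have h2 : |w (d - (t + 1)) * H ^ t| ≤ W * Y ^ (t + 1) := by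
      rw [abs_mul, abs_pow]
      refine mul_le_mul (hw _ (by omega)) ?_ (by positivity) hW
      exact (pow_le_pow_left₀ (abs_nonneg _) hH t).trans (pow_le_pow_right₀ hY (Nat.le_succ t))
    have h3 : |horner w H d y t * y| ≤ t * W * Y ^ t * Y := by
      rw [abs_mul]
      exact mul_le_mul h1 hy (abs_nonneg _) (by positivity)
    rw [horner]
    refine (abs_add_le _ _).trans ((add_le_add h3 h2).trans (le_of_eq ?_))
    push_cast; ring

/-- Evaluates at the point in variable 50 the difference whose order is in variable 51 of the
function `rootInd` for the polynomial with coefficients in row 0 of the array 5 and the powers of `H`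
in the array 8. The result is in variable 52. -/
def evalProg : Prog := block [
  forLoop 53 (2 * v 5 * (v 5 + 1)) (block [
    .assign 54 (v 53 / (v 5 + 1)), .assign 55 (v 53 % (v 5 + 1)),
    .ite (v 55) (.store 9 (v 53) (.get 9 (v 53 - 1) * (v 50 + v 54) +
        .get 5 (v 5 - v 55) * .get 8 (v 55 - 1)))
      (.store 9 (v 53) 0)]),
  .assign 56 (2 * v 5),
  forLoop 53 (v 56 * v 56) (.ite (v 53 + 1 - v 56)
    (.store 10 (v 53) (.get 10 (v 53 - v 56 + 1) - .get 10 (v 53 - v 56)))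
    (.store 10 (v 53) (1 - .get 9 (v 53 * (v 5 + 1) + v 5) * .get 9 (v 53 * (v 5 + 1) + v 5)))),
  .assign 52 (.get 10 (v 51 * v 56))]

/-- The situation in which roots are searched. -/
structure RootHyp (R B : ℕ) (σ : State) (w : ℕ → ℤ) (H : ℕ) (d : ℕ) (W : ℕ) : Prop where
  var5 : σ.var 5 = d
  d_pos : 0 < d
  row : ∀ j < d, σ.arr 5 j = w j
  pow : ∀ t < d, σ.arr 8 t = (H : ℤ) ^ t
  w_le : ∀ j < d, |w j| ≤ W
  R_le : 4 * d * (d + 1) ≤ R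
  B_le : 4 * d * (d + 1) ≤ 2 ^ B
  H_le : H ≤ 2 ^ B
  W_le : 2 ^ (2 * d * (2 * d)) * (1 + (d * W * (H + 2 * d) ^ d) ^ 2) ≤ 2 ^ B

theorem evalProg_spec {R B : ℕ} {σ : State} {Q : State → Prop} {w : ℕ → ℤ} {H d W : ℕ}
    (h : RootHyp R B σ w H d W) {x : ℤ} {k : ℕ} (hx : σ.var 50 = x) (hx0 : 0 ≤ x) (hxH : x ≤ H)
    (hk : σ.var 51 = k) (hkd : k < 2 * d)
    (hQ : ∀ τ, Same evalProg σ τ → τ.var 52 = (fwdDiff 1)^[k] (rootInd w H d) x → Q τ) :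
    Ev R B evalProg σ Q := by
  suffices hmain : Ev R B evalProg σ (fun τ => τ.var 52 = (fwdDiff 1)^[k] (rootInd w H d) x) from
    hmain.conseq fun τ h1 _ h2 => hQ τ h1 h2
  have hd0 := h.d_pos
  set M : ℕ := d * W * (H + 2 * d) ^ d with hM
  have hMB : M ≤ 2 ^ B := by
    have h1 := Nat.one_le_two_pow (n := 2 * d * (2 * d))
    have := h.W_le
    rw [← hM] at this
    have h2 : M ≤ M ^ 2 := Nat.le_self_pow two_ne_zero M
    nlinarith
  have hhor : ∀ i < 2 * d, ∀ t ≤ d, |horner w H d (x + i) t| ≤ M := by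
    intro i hi t ht
    have hY : (1 : ℤ) ≤ ((H + 2 * d : ℕ) : ℤ) := by omega
    refine (abs_horner_le (W := (W : ℤ)) (Y := ((H + 2 * d : ℕ) : ℤ)) h.w_le
      (by rw [abs_of_nonneg] <;> omega) (by rw [abs_of_nonneg] <;> omega) hY ht).trans ?_
    rw [hM]; push_cast
    have hWnn : (0 : ℤ) ≤ W := by omega
    have ht' : (t : ℤ) ≤ d := by exact_mod_cast ht
    have hp : ((H : ℤ) + 2 * d) ^ t ≤ (H + 2 * d) ^ d := pow_le_pow_right₀ (by omega) ht
    exact mul_le_mul (mul_le_mul_of_nonneg_right ht' hWnn) hp (by positivity) (by positivity)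
  have h2d : 2 * d * (d + 1) ≤ 4 * d * (d + 1) := by nlinarith
  refine Ev.block_cons (Ev.fill (a := 9) (fun m z => z = horner w H d (x + (m / (d + 1) : ℕ)) (m % (d + 1)))
    (2 * d * (d + 1)) (h2d.trans h.R_le) (h2d.trans h.B_le) rfl ?_ ?_ ?_)
  · intro τ hτ
    simp [hτ.var 5 rfl, h.var5]
  · intro m hm τ hτB hτ hmv hprev _
    obtain ⟨i, t, hi, ht, rfl⟩ : ∃ i t, i < 2 * d ∧ t < d + 1 ∧ m = i * (d + 1) + t :=
      ⟨m / (d + 1), m % (d + 1), Nat.div_lt_of_lt_mul (by linarith), Nat.mod_lt _ (by omega),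
        (Nat.div_add_mod' m (d + 1)).symm⟩
    have hdm : ∀ i t, t < d + 1 → (i * (d + 1) + t) / (d + 1) = i ∧ (i * (d + 1) + t) % (d + 1) = t := by
      intro i t ht
      constructor
      · rw [mul_comm, Nat.mul_add_div (by omega), Nat.div_eq_of_lt ht, add_zero]
      · rw [mul_comm, Nat.mul_add_mod, Nat.mod_eq_of_lt ht]
    obtain ⟨e1, e2⟩ := hdm i t ht
    have v5 : τ.var 5 = d := by rw [hτ.var 5 rfl, h.var5]
    have v50 : τ.var 50 = x := by rw [hτ.var 50 rfl, hx]
    have a5 : τ.arr 5 = σ.arr 5 := hτ.arr 5 rfl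
    have a8 : τ.arr 8 = σ.arr 8 := hτ.arr 8 rfl
    refine Ev.block_cons (Ev.assign (i : ℤ) ?_ (fun _ => abs_natCast_le ?_) ?_)
    · conv_rhs => rw [← e1]
      simp [hmv, v5]
    · have := h.B_le; nlinarith
    refine Ev.block_cons (Ev.assign (t : ℤ) ?_ (fun _ => abs_natCast_le ?_) ?_)
    · conv_rhs => rw [← e2]
      simp [hmv, v5]
    · have := h.B_le; nlinarith
    simp only [e1, e2]
    have hbd : |horner w H d (x + i) t| ≤ 2 ^ B :=
      (hhor i hi t (by omega)).trans (by exact_mod_cast hMB)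
    refine Ev.block_one (Ev.ite (fun hpos => ?_) fun hneg => ?_)
    · have ht0 : 0 < t := by simpa using hpos
      obtain ⟨t, rfl⟩ : ∃ t', t = t' + 1 := ⟨t - 1, by omega⟩
      have hp := hprev (i * (d + 1) + t) (by omega)
      obtain ⟨f1, f2⟩ := hdm i t (by omega)
      rw [f1, f2] at hp
      refine Ev.store ((i * (d + 1) + (t + 1) : ℕ) : ℤ) (horner w H d (x + i) (t + 1)) (by simp [hmv]) ?_
        (fun _ => hbd) ⟨_, setArr_arr_self _ _ _ _, rfl⟩
      have hrow := h.row (d - (t + 1)) (by omega)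
      have hpow := h.pow t (by omega)
      rw [Nat.cast_sub (by omega)] at hrow
      push_cast at hrow hp
      simp [hmv, v5, v50, a5, a8, horner]
      rw [hrow, hpow, show (i * (d + 1) + (t + 1) - 1 : ℤ) = i * (d + 1) + t by ring, hp]
    · have ht0 : t = 0 := by simpa using hneg
      subst ht0
      exact Ev.store ((i * (d + 1) + 0 : ℕ) : ℤ) 0 (by simp [hmv]) rfl (fun _ => by simp)
        ⟨0, setArr_arr_self _ _ _ _, rfl⟩
  intro τ hτ hA _
  have v5 : τ.var 5 = d := by rw [hτ.var 5 rfl, h.var5]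
  have v51 : τ.var 51 = k := by rw [hτ.var 51 rfl, hk]
  have h9 : ∀ i < 2 * d, τ.arr 9 ((i * (d + 1) + d : ℕ) : ℤ) = (hpoly w H d).eval (x + i) := by
    intro i hi
    have hlt : i * (d + 1) + d < 2 * d * (d + 1) := by
      have : (i + 1) * (d + 1) ≤ 2 * d * (d + 1) := Nat.mul_le_mul_right _ hi
      rw [add_mul] at this; omega
    rw [hA _ hlt, mul_comm, Nat.mul_add_div (by omega), Nat.div_eq_of_lt (Nat.lt_succ_self d), add_zero,
      Nat.mul_add_mod, Nat.mod_eq_of_lt (Nat.lt_succ_self d), horner_self]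
  have hB4 : 2 * d * (2 * d) ≤ 4 * d * (d + 1) := by nlinarith
  refine Ev.block_cons (Ev.assign ((2 * d : ℕ) : ℤ) (by simp [v5]) (fun _ => abs_natCast_le ?_) ?_)
  · have := h.B_le; nlinarith
  -- The difference table is a square stored row by row. At the right edge the rule for a cell wraps
  -- around to the next row and yields meaningless numbers. The value is therefore claimed only
  -- where row plus column is below 2 d, while the size bound, which at least doubles from the cells
  -- read to the cell written, holds everywhere.
  refine Ev.block_cons (Ev.fill (a := 10) (fun m z => |z| ≤ 2 ^ m * (1 + (M : ℤ) ^ 2) ∧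
      (m / (2 * d) + m % (2 * d) < 2 * d → z = (fwdDiff 1)^[m / (2 * d)] (rootInd w H d) (x + (m % (2 * d) : ℕ))))
    (2 * d * (2 * d)) (hB4.trans h.R_le) (hB4.trans h.B_le) rfl ?_ ?_ ?_)
  · intro ρ hρ
    simp [hρ.var 56 rfl]
  · intro m hm ρ hρB hρ hmv hprev _
    have u5 : ρ.var 5 = d := by rw [hρ.var 5 rfl]; simp [v5]
    have u56 : ρ.var 56 = 2 * d := by rw [hρ.var 56 rfl]; simp
    have a9 : ρ.arr 9 = τ.arr 9 := by rw [hρ.arr 9 rfl]; simp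
    have hbd : ∀ z : ℤ, |z| ≤ 2 ^ m * (1 + (M : ℤ) ^ 2) → |z| ≤ 2 ^ B := by
      intro z hz
      refine hz.trans ?_
      have h1 : (2 : ℤ) ^ m ≤ 2 ^ (2 * d * (2 * d)) := pow_le_pow_right₀ (by norm_num) hm.le
      have h2 : ((2 ^ (2 * d * (2 * d)) * (1 + M ^ 2) : ℕ) : ℤ) ≤ ((2 ^ B : ℕ) : ℤ) := by
        exact_mod_cast h.W_le
      push_cast at h2
      exact (mul_le_mul_of_nonneg_right h1 (by positivity)).trans h2
    refine Ev.ite (fun hpos => ?_) fun hneg => ?_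
    · have hm' : 2 * d ≤ m := by
        simp [hmv, u56] at hpos; omega
      obtain ⟨n, rfl⟩ : ∃ n, m = 2 * d + n := ⟨m - 2 * d, by omega⟩
      obtain ⟨p1, p2⟩ := hprev (n + 1) (by omega)
      obtain ⟨q1, q2⟩ := hprev n (by omega)
      have hz : |ρ.arr 10 ((n + 1 : ℕ) : ℤ) - ρ.arr 10 (n : ℤ)| ≤ 2 ^ (2 * d + n) * (1 + (M : ℤ) ^ 2) := by
        refine (abs_sub _ _).trans ?_
        have h1 : (2 : ℤ) ^ (n + 1) ≤ 2 ^ (2 * d + n - 1) := pow_le_pow_right₀ (by norm_num) (by omega)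
        have h2 : (2 : ℤ) ^ n ≤ 2 ^ (2 * d + n - 1) := pow_le_pow_right₀ (by norm_num) (by omega)
        have h3 : (2 : ℤ) ^ (2 * d + n) = 2 * 2 ^ (2 * d + n - 1) := by
          rw [← pow_succ']; congr 1; omega
        have h4 : (0 : ℤ) < 1 + (M : ℤ) ^ 2 := by positivity
        nlinarith
      refine Ev.store ((2 * d + n : ℕ) : ℤ) (ρ.arr 10 ((n + 1 : ℕ) : ℤ) - ρ.arr 10 (n : ℤ)) (by simp [hmv]) ?_
        (fun _ => hbd _ hz) ⟨_, setArr_arr_self _ _ _ _, hz, ?_⟩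
      · simp [hmv, u56]
      · have hd2 : (2 * d + n) / (2 * d) = n / (2 * d) + 1 := by
          rw [Nat.add_div_left _ (by omega)]
        have hm2 : (2 * d + n) % (2 * d) = n % (2 * d) := by simp
        rw [hd2, hm2]
        intro hlt
        have hr : n % (2 * d) + 1 < 2 * d := by linarith [Nat.zero_le (n / (2 * d))]
        have hsplit := Nat.div_add_mod n (2 * d)
        have hd3 : (n + 1) / (2 * d) = n / (2 * d) ∧ (n + 1) % (2 * d) = n % (2 * d) + 1 := by
          have : n + 1 = 2 * d * (n / (2 * d)) + (n % (2 * d) + 1) := by omega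
          constructor
          · rw [this, Nat.mul_add_div (by omega), Nat.div_eq_of_lt hr, add_zero]
          · conv_lhs => rw [this]
            rw [Nat.mul_add_mod, Nat.mod_eq_of_lt hr]
        rw [p2 (by rw [hd3.1, hd3.2]; omega), q2 (by omega), hd3.1, hd3.2, Function.iterate_succ_apply',
          fwdDiff]
        push_cast
        rw [add_assoc]
    · have hm' : m < 2 * d := by
        simp [hmv, u56] at hneg; omega
      have hv : rootInd w H d (x + m) =
          1 - ρ.arr 9 (m * (d + 1) + d) * ρ.arr 9 (m * (d + 1) + d) := by
        have := h9 m hm'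
        push_cast at this
        rw [a9, this, rootInd, sq]
      have hz : |rootInd w H d (x + m)| ≤ 2 ^ m * (1 + (M : ℤ) ^ 2) := by
        have h1 := hhor m hm' d le_rfl
        rw [horner_self] at h1
        have h2 : ((hpoly w H d).eval (x + m)) ^ 2 ≤ (M : ℤ) ^ 2 := by
          rw [← sq_abs]; exact pow_le_pow_left₀ (abs_nonneg _) h1 2
        have h3 : |rootInd w H d (x + m)| ≤ 1 + (M : ℤ) ^ 2 := by
          rw [rootInd, abs_le]
          constructor <;> nlinarith [sq_nonneg ((hpoly w H d).eval (x + m)), sq_nonneg (M : ℤ)]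
        refine h3.trans (le_mul_of_one_le_left (by positivity) (one_le_pow₀ (by norm_num)))
      refine Ev.store (m : ℤ) (rootInd w H d (x + m)) (by simp [hmv]) ?_ (fun _ => hbd _ hz)
        ⟨_, setArr_arr_self _ _ _ _, hz, fun _ => ?_⟩
      · simp [hmv, u5, hv]
      · rw [Nat.div_eq_of_lt hm', Nat.mod_eq_of_lt hm']; rfl
  intro ρ hρ hA10 _
  have u51 : ρ.var 51 = k := by rw [hρ.var 51 rfl]; simp [v51]
  have u56 : ρ.var 56 = 2 * d := by rw [hρ.var 56 rfl]; simp
  refine Ev.block_one (Ev.assign ((fwdDiff 1)^[k] (rootInd w H d) x) ?_ (fun hB => ?_) (by simp))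
  · have hlt : k * (2 * d) < 2 * d * (2 * d) := Nat.mul_lt_mul_of_pos_right hkd (by omega)
    have := (hA10 _ hlt).2
    rw [Nat.mul_div_cancel _ (by omega), Nat.mul_mod_left] at this
    have := this (by omega)
    simp only [Nat.cast_zero, add_zero] at this
    rw [← this]
    simp [u51, u56]
  · have hlt : k * (2 * d) < 2 * d * (2 * d) := Nat.mul_lt_mul_of_pos_right hkd (by omega)
    have := (hA10 _ hlt).2
    rw [Nat.mul_div_cancel _ (by omega), Nat.mul_mod_left] at this
    have := this (by omega)
    simp only [Nat.cast_zero, add_zero] at this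
    rw [← this]
    exact hB.2 _ _

end BitRAM

/-! ### Bisection and the table of breakpoints -/

namespace BitRAM

open RootFinding

theorem RootHyp.congr {R B : ℕ} {σ τ : State} {w : ℕ → ℤ} {H d W : ℕ} (h : RootHyp R B σ w H d W)
    (h5 : τ.var 5 = σ.var 5) (ha : τ.arr 5 = σ.arr 5) (hb : τ.arr 8 = σ.arr 8) :
    RootHyp R B τ w H d W :=
  ⟨h5.trans h.var5, h.d_pos, fun j hj => by rw [ha]; exact h.row j hj,
    fun j hj => by rw [hb]; exact h.pow j hj, h.w_le, h.R_le, h.B_le, h.H_le, h.W_le⟩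

/-- Bisection between the points in the variables 57 and 58 for the difference whose order is in
variable 51. The result is in variable 58. -/
def bisectProg : Prog := block [
  .assign 50 (v 57), evalProg, .ite (v 52) (.assign 59 1) (.assign 59 0),
  .while (v 58 - v 57 - 1) (block [
    .assign 50 ((v 57 + v 58) / 2), evalProg, .ite (v 52) (.assign 60 1) (.assign 60 0),
    .ite (1 - (v 59 - v 60) * (v 59 - v 60)) (.assign 57 (v 50)) (.assign 58 (v 50))])]

theorem bisectProg_spec {R B : ℕ} {σ : State} {Q : State → Prop} {w : ℕ → ℤ} {H d W : ℕ}
    (h : RootHyp R B σ w H d W) {a b : ℤ} {k : ℕ} (ha : σ.var 57 = a) (hb : σ.var 58 = b)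
    (ha0 : 0 ≤ a) (hab : a ≤ b) (hbH : b ≤ H) (hHR : H < 2 ^ R)
    (hk : σ.var 51 = k) (hkd : k < 2 * d)
    (hs : OneSwitch (fun x => 0 < (fwdDiff 1)^[k] (rootInd w H d) x) a b)
    (hQ : ∀ τ, Same bisectProg σ τ →
      IsSwitch (fun x => 0 < (fwdDiff 1)^[k] (rootInd w H d) x) a b (τ.var 58) → Q τ) :
    Ev R B bisectProg σ Q := by
  set P : ℤ → Prop := fun x => 0 < (fwdDiff 1)^[k] (rootInd w H d) x with hP
  suffices hmain : Ev R B bisectProg σ (fun τ => IsSwitch P a b (τ.var 58)) from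
    hmain.conseq fun τ h1 _ h2 => hQ τ h1 h2
  have hHB : (H : ℤ) ≤ 2 ^ B := by exact_mod_cast h.H_le
  have h1B : |(1 : ℤ)| ≤ 2 ^ B := by exact_mod_cast Nat.one_le_two_pow
  have hxB : ∀ x : ℤ, 0 ≤ x → x ≤ H → |x| ≤ 2 ^ B := fun x h0 h1 => by
    rw [abs_of_nonneg h0]; exact h1.trans hHB
  refine Ev.block_cons (Ev.assign a (by simp [ha]) (fun _ => hxB a ha0 (hab.trans hbH)) (Ev.block_cons ?_))
  refine evalProg_spec (h.congr (by simp) rfl rfl) (x := a) (k := k) (by simp) ha0 (hab.trans hbH) (by simp [hk]) hkd ?_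
  intro τ hτ h52
  have key : ∃ f : ℤ, (f = 1 ∧ P a ∨ f = 0 ∧ ¬ P a) := by
    by_cases hp : P a
    · exact ⟨1, Or.inl ⟨rfl, hp⟩⟩
    · exact ⟨0, Or.inr ⟨rfl, hp⟩⟩
  suffices hw : ∀ ρ, Same bisectProg σ ρ → (ρ.var 59 = 1 ∧ P a ∨ ρ.var 59 = 0 ∧ ¬ P a) →
      ρ.var 57 = a → ρ.var 58 = b → ρ.var 51 = k →
      Ev R B (block [.while (v 58 - v 57 - 1) (block [
    .assign 50 ((v 57 + v 58) / 2), evalProg, .ite (v 52) (.assign 60 1) (.assign 60 0),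
    .ite (1 - (v 59 - v 60) * (v 59 - v 60)) (.assign 57 (v 50)) (.assign 58 (v 50))])]) ρ
        (fun τ => IsSwitch P a b (τ.var 58)) by
    have hS : ∀ z, Same bisectProg σ (τ.setVar 59 z) := by
      intro z
      refine ⟨fun x hx => ?_, fun x hx => ?_, fun hx => ?_⟩
      · have h1 : evalProg.touchesVar x = false := by
          by_contra h; simp [bisectProg, block, Prog.touchesVar, h] at hx
        have h2 : x ≠ 50 ∧ x ≠ 59 := by
          constructor <;> (rintro rfl; revert hx; decide)
        rw [setVar_var, if_neg h2.2, hτ.var x h1]; simp [h2.1]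
      · have h1 : evalProg.touchesArr x = false := by
          by_contra h; simp [bisectProg, block, Prog.touchesArr, h] at hx
        exact hτ.arr x h1
      · exact hτ.out rfl
    have t57 : τ.var 57 = a := by rw [hτ.var 57 rfl]; simp [ha]
    have t58 : τ.var 58 = b := by rw [hτ.var 58 rfl]; simp [hb]
    have t51 : τ.var 51 = k := by rw [hτ.var 51 rfl]; simp [hk]
    refine Ev.block_cons (Ev.ite (fun hc => ?_) fun hc => ?_)
    · rw [eval_var, h52] at hc
      exact Ev.assign 1 rfl (fun _ => h1B) (hw _ (hS 1) (Or.inl ⟨by simp, hc⟩) (by simp [t57])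
        (by simp [t58]) (by simp [t51]))
    · rw [eval_var, h52] at hc
      exact Ev.assign 0 rfl (fun _ => by simp) (hw _ (hS 0) (Or.inr ⟨by simp, hc⟩) (by simp [t57])
        (by simp [t58]) (by simp [t51]))
  intro ρ hSρ hflag h57 h58 h51
  have hρh : RootHyp R B ρ w H d W := h.congr (hSρ.var 5 rfl) (hSρ.arr 5 rfl) (hSρ.arr 8 rfl)
  -- The quantity that halves exactly is hi - lo - 1: both halves of an interval of length l have
  -- length at most (l + 1) / 2. The loop stops at hi - lo ≤ 1, when hi is the switch.
  refine Ev.block_one (Ev.while (I := fun n τ => ∃ lo hi : ℤ, τ.var 57 = lo ∧ τ.var 58 = hi ∧ a ≤ lo ∧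
    lo ≤ hi ∧ hi ≤ b ∧ (∀ x, a ≤ x → x ≤ lo → (P x ↔ P a)) ∧ (∀ x, hi ≤ x → x ≤ b → (P x ↔ P b)) ∧
    (hi - lo - 1) * 2 ^ n ≤ H)
    ⟨a, b, h57, h58, le_rfl, hab, le_rfl, fun x h1 h2 => by rw [le_antisymm h2 h1],
      fun x h1 h2 => by rw [le_antisymm h2 h1], by rw [pow_zero, mul_one]; omega⟩ ?_ ?_)
  · rintro n τ hτB hτ ⟨lo, hi, t57, t58, hal, hlh, hhb, hl, hh, hlen⟩ hguard
    simp only [eval_sub, eval_var, eval_one, t57, t58] at hguard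
    have h2n : (0 : ℤ) < 2 ^ n := by positivity
    constructor
    · by_contra hn
      have h1 : (2 : ℤ) ^ R ≤ 2 ^ n := pow_le_pow_right₀ (by norm_num) (not_lt.1 hn)
      have h2 : (H : ℤ) < 2 ^ R := by exact_mod_cast hHR
      nlinarith
    have t51 : τ.var 51 = k := (hτ.var 51 rfl).trans h51
    have t59 : τ.var 59 = ρ.var 59 := hτ.var 59 rfl
    set mid := (lo + hi) / 2 with hmid
    have m1 : lo < mid := by omega
    have m2 : mid < hi := by omega
    refine Ev.block_cons (Ev.assign mid (by simp [t57, t58, hmid])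
      (fun _ => hxB _ (by omega) (by omega)) (Ev.block_cons ?_))
    refine evalProg_spec (hρh.congr ?_ ?_ ?_) (x := mid) (k := k) (by simp) (by omega) (by omega)
      (by simp [t51]) hkd ?_
    · simp [hτ.var 5 rfl]
    · simp [hτ.arr 5 rfl]
    · simp [hτ.arr 8 rfl]
    intro υ hυ h52
    have u57 : υ.var 57 = lo := by rw [hυ.var 57 rfl]; simp [t57]
    have u58 : υ.var 58 = hi := by rw [hυ.var 58 rfl]; simp [t58]
    have u59 : υ.var 59 = ρ.var 59 := by rw [hυ.var 59 rfl]; simp [t59]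
    have u50 : υ.var 50 = mid := by rw [hυ.var 50 rfl]; simp
    have hlast : ∀ υ' : State, υ'.var 57 = lo → υ'.var 58 = hi → υ'.var 59 = ρ.var 59 → υ'.var 50 = mid →
        (υ'.var 60 = 1 ∧ P mid ∨ υ'.var 60 = 0 ∧ ¬ P mid) →
        Ev R B (block [.ite (1 - (v 59 - v 60) * (v 59 - v 60)) (.assign 57 (v 50)) (.assign 58 (v 50))])
          υ' (fun τ => ∃ lo hi : ℤ, τ.var 57 = lo ∧ τ.var 58 = hi ∧ a ≤ lo ∧
    lo ≤ hi ∧ hi ≤ b ∧ (∀ x, a ≤ x → x ≤ lo → (P x ↔ P a)) ∧ (∀ x, hi ≤ x → x ≤ b → (P x ↔ P b)) ∧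
    (hi - lo - 1) * 2 ^ (n + 1) ≤ H) := by
      intro υ' w57 w58 w59 w50 w60
      have hhalf : ∀ δ : ℤ, 2 * δ ≤ hi - lo - 1 → δ * 2 ^ (n + 1) ≤ H := by
        intro δ hδ
        rw [pow_succ]; nlinarith
      refine Ev.block_one (Ev.ite (fun hc => ?_) fun hc => ?_)
      -- The flags are 0 or 1, so 1 minus the square of their difference is positive exactly when
      -- they agree.
      · have hiff : P mid ↔ P a := by
          simp only [eval_sub, eval_mul, eval_var, eval_one, w59] at hc
          rcases hflag with ⟨f1, f2⟩ | ⟨f1, f2⟩ <;> rcases w60 with ⟨g1, g2⟩ | ⟨g1, g2⟩ <;>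
            simp [f1, g1] at hc <;> tauto
        refine Ev.assign mid (by simp [w50]) (fun _ => hxB _ (by omega) (by omega))
          ⟨mid, hi, by simp, by simp [w58], by omega, by omega, hhb, fun x hx hx' => ?_, hh,
            hhalf _ (by omega)⟩
        rcases hs with hm | hm
        · constructor
          · intro hx0; exact hiff.1 (hm x mid hx hx' (by omega) hx0)
          · intro hp; exact hm a x le_rfl hx (by omega) hp
        · constructor
          · intro hx0; exact hm a x le_rfl hx (by omega) hx0
          · intro hp; exact hm x mid hx hx' (by omega) (hiff.2 hp)
      · have hiff : ¬ (P mid ↔ P a) := by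
          simp only [eval_sub, eval_mul, eval_var, eval_one, w59] at hc
          rcases hflag with ⟨f1, f2⟩ | ⟨f1, f2⟩ <;> rcases w60 with ⟨g1, g2⟩ | ⟨g1, g2⟩ <;>
            simp [f1, g1] at hc <;> tauto
        refine Ev.assign mid (by simp [w50]) (fun _ => hxB _ (by omega) (by omega))
          ⟨lo, mid, by simp [w57], by simp, hal, by omega, by omega, hl, fun x hx hx' => ?_,
            hhalf _ (by omega)⟩
        rcases hs with hm | hm
        · have ha' : ¬ P a := fun hp => hiff ⟨fun _ => hp, fun _ => hm a mid le_rfl (by omega) (by omega) hp⟩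
          have hmid' : P mid := by by_contra hp; exact hiff ⟨fun h => absurd h hp, fun h => absurd h ha'⟩
          exact ⟨fun _ => hm mid b (by omega) (by omega) le_rfl hmid', fun _ => hm mid x (by omega) hx hx' hmid'⟩
        · have hmid' : ¬ P mid := fun hp => hiff ⟨fun _ => hm a mid le_rfl (by omega) (by omega) hp, fun _ => hp⟩
          exact ⟨fun hp => absurd (hm mid x (by omega) hx hx' hp) hmid',
            fun hp => absurd (hm mid b (by omega) (by omega) le_rfl hp) hmid'⟩
    refine Ev.block_cons (Ev.ite (fun hc => ?_) fun hc => ?_)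
    · rw [eval_var, h52] at hc
      exact Ev.assign 1 rfl (fun _ => h1B) (hlast _ (by simp [u57]) (by simp [u58]) (by simp [u59])
        (by simp [u50]) (Or.inl ⟨by simp, hc⟩))
    · rw [eval_var, h52] at hc
      exact Ev.assign 0 rfl (fun _ => by simp) (hlast _ (by simp [u57]) (by simp [u58]) (by simp [u59])
        (by simp [u50]) (Or.inr ⟨by simp, hc⟩))
  · rintro n τ - hτ ⟨lo, hi, t57, t58, hal, hlh, hhb, hl, hh, -⟩ hguard
    simp only [eval_sub, eval_var, eval_one, t57, t58] at hguard
    rw [t58]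
    exact ⟨by omega, hhb, fun x hx hx' => hl x hx (by omega), hh⟩

/-- Computes the table of breakpoints in the array 11 (`H` is variable 6). -/
def segsProg : Prog := forLoop 61 (2 * v 5 * (2 * v 5 + 1)) (block [
  .assign 62 (v 61 / (2 * v 5 + 1)), .assign 63 (v 61 % (2 * v 5 + 1)),
  .ite (v 63)
    (.ite (v 62)
      (block [.assign 57 (.get 11 (v 61 - (2 * v 5 + 1) - 1)), .assign 58 (.get 11 (v 61 - (2 * v 5 + 1))),
        .assign 51 (2 * v 5 - 1 - v 62), bisectProg, .store 11 (v 61) (v 58)])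
      (.store 11 (v 61) (v 6)))
    (.store 11 (v 61) 0)])

/-- The table of breakpoints in an array. -/
def segTable (A : ℤ → ℤ) (d l i : ℕ) : ℤ := A ((l * (2 * d + 1) + i : ℕ) : ℤ)

/-- Each row increases weakly from 0 to H. So bisection evaluates only at points of [0, H], where
the size bounds hold. -/
theorem mem_Icc_of_cell {w : ℕ → ℤ} {H : ℤ} {d l : ℕ} {c : ℕ → ℕ → ℤ} (hH : 0 ≤ H) (hd : 0 < d)
    (hl : l ≤ 2 * d - 1)
    (hc : ∀ l' ≤ l, ∀ i ≤ 2 * d, Cell (rootInd w H d) H d c l' i) (j : ℕ) (hj : j ≤ 2 * d) :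
    0 ≤ c l j ∧ c l j ≤ H := by
  obtain ⟨hseg, hlast⟩ := segments_of_cell hH (fwdDiff_rootInd w H hd) hc
  have hc0 : c l 0 = 0 := (hc l le_rfl 0 (by omega)).1 rfl
  have hcl : c l (2 * d) = H := hlast _ le_rfl (by omega)
  have hmono : ∀ n j, j + n ≤ 2 * d → c l j ≤ c l (j + n) := by
    intro n
    induction n with
    | zero => intro j _; exact le_rfl
    | succ n ih => intro j hj; exact (ih j (by omega)).trans (hseg (j + n) (by omega)).1
  have h1 := hmono j 0 (by omega)
  have h2 := hmono (2 * d - j) j (by omega)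
  rw [zero_add, hc0] at h1
  rw [show j + (2 * d - j) = 2 * d by omega, hcl] at h2
  exact ⟨h1, h2⟩

theorem segsProg_spec {R B : ℕ} {σ : State} {Q : State → Prop} {w : ℕ → ℤ} {H d W : ℕ}
    (h : RootHyp R B σ w H d W) (h6 : σ.var 6 = H) (hHR : H < 2 ^ R)
    (hQ : ∀ τ, Same segsProg σ τ →
      (∀ l ≤ 2 * d - 1, ∀ i ≤ 2 * d, Cell (rootInd w H d) H d (segTable (τ.arr 11) d) l i) → Q τ) :
    Ev R B segsProg σ Q := by
  have hd0 := h.d_pos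
  have hn : 2 * d * (2 * d + 1) ≤ 4 * d * (d + 1) := by nlinarith
  have hHB : (H : ℤ) ≤ 2 ^ B := by exact_mod_cast h.H_le
  have hbound : ∀ m < 2 * d * (2 * d + 1), m ≤ 2 ^ B := fun m hm => hm.le.trans (hn.trans h.B_le)
  have hdm : ∀ l i, i ≤ 2 * d → (l * (2 * d + 1) + i) / (2 * d + 1) = l ∧ (l * (2 * d + 1) + i) % (2 * d + 1) = i := by
    intro l i hi
    constructor
    · rw [mul_comm, Nat.mul_add_div (by omega), Nat.div_eq_of_lt (by omega), add_zero]
    · rw [mul_comm, Nat.mul_add_mod, Nat.mod_eq_of_lt (by omega)]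
  have hcong : ∀ {c c' : ℕ → ℕ → ℤ} {l i}, c' l i = c l i →
      (0 < i → 0 < l → c' (l - 1) (i - 1) = c (l - 1) (i - 1) ∧ c' (l - 1) i = c (l - 1) i) →
      Cell (rootInd w H d) H d c l i → Cell (rootInd w H d) H d c' l i := by
    intro c c' l i h1 h2 h3
    refine ⟨fun h => by rw [h1]; exact h3.1 h, fun h h' => by rw [h1]; exact h3.2.1 h h', fun h h' => ?_⟩
    rw [h1, (h2 h h').1, (h2 h h').2]; exact h3.2.2 h h'
  have hrow : ∀ l l' i i', i ≤ 2 * d → l < l' → l * (2 * d + 1) + i < l' * (2 * d + 1) + i' := by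
    intro l l' i i' hi hl
    have : (l + 1) * (2 * d + 1) ≤ l' * (2 * d + 1) := Nat.mul_le_mul_right _ hl
    rw [add_mul] at this; omega
  refine Ev.forLoop (I := fun n τ => ∀ l i, i ≤ 2 * d → l * (2 * d + 1) + i < n →
    Cell (rootInd w H d) H d (segTable (τ.arr 11) d) l i) (2 * d * (2 * d + 1)) (hn.trans h.R_le)
    (hn.trans h.B_le) rfl ?_ (fun l i _ h => absurd h (Nat.not_lt_zero _)) ?_ ?_
  · intro τ hτ
    simp [hτ.var 5 rfl, h.var5]
  · intro m hm τ hτB hτ hmv hI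
    obtain ⟨l, i, hl, hi, rfl⟩ : ∃ l i, l < 2 * d ∧ i ≤ 2 * d ∧ m = l * (2 * d + 1) + i :=
      ⟨m / (2 * d + 1), m % (2 * d + 1), Nat.div_lt_of_lt_mul (by linarith),
        Nat.lt_succ_iff.1 (Nat.mod_lt _ (by omega)), (Nat.div_add_mod' m (2 * d + 1)).symm⟩
    obtain ⟨e1, e2⟩ := hdm l i hi
    have v5 : τ.var 5 = d := by rw [hτ.var 5 rfl, h.var5]
    have v6 : τ.var 6 = H := by rw [hτ.var 6 rfl, h6]
    have hτh : RootHyp R B τ w H d W := h.congr (hτ.var 5 rfl) (hτ.arr 5 rfl) (hτ.arr 8 rfl)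
    -- All branches end by writing one cell. Earlier cells, and the cells their conditions refer to,
    -- keep their values.
    have hstore : ∀ A : ℤ → ℤ, ∀ z, (∀ z : ℤ, z ≠ ((l * (2 * d + 1) + i : ℕ) : ℤ) → A z = τ.arr 11 z) →
        A ((l * (2 * d + 1) + i : ℕ) : ℤ) = z →
        ((i = 0 → z = 0) ∧ (0 < i → l = 0 → z = H) ∧
          (0 < i → 0 < l → IsSwitch (fun x => 0 < (fwdDiff 1)^[2 * d - 1 - l] (rootInd w H d) x)
            (segTable (τ.arr 11) d (l - 1) (i - 1)) (segTable (τ.arr 11) d (l - 1) i) z)) →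
        ∀ l' i', i' ≤ 2 * d → l' * (2 * d + 1) + i' < l * (2 * d + 1) + i + 1 →
          Cell (rootInd w H d) H d (segTable A d) l' i' := by
      intro A z hA hAz hz l' i' hi' hlt
      have hprev : ∀ l'' i'', i'' ≤ 2 * d → l'' * (2 * d + 1) + i'' < l * (2 * d + 1) + i →
          segTable A d l'' i'' = segTable (τ.arr 11) d l'' i'' := by
        intro l'' i'' _ h
        exact hA _ (by exact_mod_cast h.ne)
      rcases Nat.lt_succ_iff_lt_or_eq.1 hlt with hlt | heq
      · refine hcong (hprev l' i' hi' hlt) (fun h1 h2 => ?_) (hI l' i' hi' hlt)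
        have := hrow (l' - 1) l' i' i' hi' (by omega)
        exact ⟨hprev _ _ (by omega) (by omega), hprev _ _ hi' (by omega)⟩
      · have el : l' = l := by rw [← (hdm l' i' hi').1, heq, e1]
        have ei : i' = i := by rw [← (hdm l' i' hi').2, heq, e2]
        subst el ei
        have : segTable A d l' i' = z := hAz
        refine ⟨fun h => by rw [this]; exact hz.1 h, fun h h' => by rw [this]; exact hz.2.1 h h',
          fun h h' => ?_⟩
        have := hrow (l' - 1) l' i' i' hi' (by omega)
        rw [hprev _ _ (by omega) (by omega), hprev _ _ hi' (by omega)]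
        rw [show segTable A d l' i' = z from hAz]
        exact hz.2.2 h h'
    refine Ev.block_cons (Ev.assign (l : ℤ) ?_ (fun _ => abs_natCast_le ?_) ?_)
    · conv_rhs => rw [← e1]
      simp [hmv, v5]
    · have := hbound _ hm; nlinarith
    refine Ev.block_cons (Ev.assign (i : ℤ) ?_ (fun _ => abs_natCast_le ?_) ?_)
    · conv_rhs => rw [← e2]
      simp [hmv, v5]
    · have := hbound _ hm; nlinarith
    refine Ev.block_one (Ev.ite (fun hpos => ?_) fun hneg => ?_)
    · have hi0 : 0 < i := by simpa using hpos
      refine Ev.ite (fun hpos => ?_) fun hneg => ?_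
      · have hl0 : 0 < l := by simpa using hpos
        obtain ⟨l, rfl⟩ : ∃ l', l = l' + 1 := ⟨l - 1, by omega⟩
        obtain ⟨i, rfl⟩ : ∃ i', i = i' + 1 := ⟨i - 1, by omega⟩
        have hlt := hrow l (l + 1) (2 * d) (i + 1) le_rfl (by omega)
        obtain ⟨hseg, -⟩ := segments_of_cell (H := (H : ℤ)) (by omega) (fwdDiff_rootInd w H hd0)
          (c := segTable (τ.arr 11) d) (l := l) fun l' hl' i' hi' => hI l' i' hi' (by
            have : l' * (2 * d + 1) ≤ l * (2 * d + 1) := Nat.mul_le_mul_right _ hl'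
            omega)
        have hOne := oneSwitch_of_segments (l := l) (by omega) hseg (i := i) (by omega)
        have hrange := mem_Icc_of_cell (H := (H : ℤ)) (by omega) hd0
          (c := segTable (τ.arr 11) d) (l := l) (by omega) fun l' hl' i' hi' => hI l' i' hi' (by
            have : l' * (2 * d + 1) ≤ l * (2 * d + 1) := Nat.mul_le_mul_right _ hl'
            omega)
        have r1 := hrange i (by omega)
        have r2 := hrange (i + 1) (by omega)
        have hidx1 : (((l + 1) * (2 * d + 1) + (i + 1) : ℕ) : ℤ) - (2 * d + 1) - 1 = ((l * (2 * d + 1) + i : ℕ) : ℤ) := by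
          push_cast; ring
        have hidx2 : (((l + 1) * (2 * d + 1) + (i + 1) : ℕ) : ℤ) - (2 * d + 1) = ((l * (2 * d + 1) + (i + 1) : ℕ) : ℤ) := by
          push_cast; ring
        refine Ev.block_cons (Ev.assign (segTable (τ.arr 11) d l i) ?_
          (fun _ => by rw [abs_of_nonneg r1.1]; exact r1.2.trans hHB) ?_)
        · simp only [eval_get, eval_sub, eval_add, eval_mul, eval_var, eval_one, eval_ofNat, setVar_var,
            setVar_arr, hmv, v5]
          norm_num
          push_cast at hidx1
          rw [hidx1]; simp [segTable]
        refine Ev.block_cons (Ev.assign (segTable (τ.arr 11) d l (i + 1)) ?_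
          (fun _ => by rw [abs_of_nonneg r2.1]; exact r2.2.trans hHB) ?_)
        · simp only [eval_get, eval_sub, eval_add, eval_mul, eval_var, eval_one, eval_ofNat, setVar_var,
            setVar_arr, hmv, v5]
          norm_num
          push_cast at hidx2
          rw [hidx2]; simp [segTable]
        refine Ev.block_cons (Ev.assign ((2 * d - 1 - (l + 1) : ℕ) : ℤ) ?_ (fun _ => abs_natCast_le ?_) ?_)
        · simp [v5]; omega
        · have h1 : 2 * d ≤ 4 * d * (d + 1) := by nlinarith
          have := h.B_le; omega
        refine Ev.block_cons (bisectProg_spec (hτh.congr (by simp) rfl rfl)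
          (a := segTable (τ.arr 11) d l i) (b := segTable (τ.arr 11) d l (i + 1)) (k := 2 * d - 1 - (l + 1))
          (by simp) (by simp) r1.1 (hseg i (by omega)).1 r2.2 hHR (by simp) (by omega) hOne ?_)
        intro ρ hρ hsw
        have a11 : ρ.arr 11 = τ.arr 11 := by rw [hρ.arr 11 rfl]; simp
        have u61 : ρ.var 61 = (((l + 1) * (2 * d + 1) + (i + 1) : ℕ) : ℤ) := by
          rw [hρ.var 61 rfl]; simp [hmv]
        refine Ev.block_one (Ev.store (((l + 1) * (2 * d + 1) + (i + 1) : ℕ) : ℤ) (ρ.var 58)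
          (by simp [u61]) rfl (fun hB => hB.1 58) ?_)
        refine hstore _ (ρ.var 58) (fun z hz => ?_) ?_ ⟨by simp, by simp, fun _ _ => by simpa using hsw⟩
        · rw [setVar_arr, setArr_arr_self, Function.update_of_ne hz, a11]
        · rw [setVar_arr, setArr_arr_self, Function.update_self]
      · have hl0 : l = 0 := by simpa using hneg
        refine Ev.store ((l * (2 * d + 1) + i : ℕ) : ℤ) H (by simp [hmv]) (by simp [v6])
          (fun _ => abs_natCast_le h.H_le) ?_
        refine hstore _ H (fun z hz => ?_) ?_ ⟨fun h => by omega, fun _ _ => rfl, fun _ h => by omega⟩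
        · rw [setVar_arr, setArr_arr_self, Function.update_of_ne hz]; rfl
        · rw [setVar_arr, setArr_arr_self, Function.update_self]
    · have hi0 : i = 0 := by simpa using hneg
      refine Ev.store ((l * (2 * d + 1) + i : ℕ) : ℤ) 0 (by simp [hmv]) rfl (fun _ => by simp) ?_
      refine hstore _ 0 (fun z hz => ?_) ?_ ⟨fun _ => rfl, fun h => by omega, fun h => by omega⟩
      · rw [setVar_arr, setArr_arr_self, Function.update_of_ne hz]; rfl
      · rw [setVar_arr, setArr_arr_self, Function.update_self]
  · intro τ hτ _ hI
    refine hQ τ hτ fun l hl i hi => hI l i hi ?_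
    have := hrow l (2 * d) i 0 hi (by omega)
    omega

end BitRAM

/-! ### The lattice of polynomials with a common root modulo powers of divisors -/

namespace Coppersmith

open LatticeReduction

/-- The coefficients of `N ^ (m - i / r) * (a + H * z) ^ i`. -/
def entry (N r m H : ℕ) (a : ℤ) (i j : ℕ) : ℤ :=
  N ^ (m - i / r) * (i.choose j * a ^ (i - j) * H ^ j)

/-- The vectors of coefficients of polynomials in `y / H` that are divisible by `p ^ (r * m)` whenever
`p ^ r ∣ N` and `p ∣ a + y`. -/
def lattice (N r m d H : ℕ) (a : ℤ) : AddSubgroup (Fin d → ℤ) where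
  carrier := {w | ∀ p y : ℤ, p ^ r ∣ N → p ∣ a + y →
    p ^ (r * m) * H ^ (d - 1) ∣ ∑ j, w j * ((H : ℤ) ^ (d - 1 - j) * y ^ (j : ℕ))}
  zero_mem' := fun p y _ _ => by simp
  add_mem' := fun {w u} hw hu p y h h' => by
    simp only [Pi.add_apply, add_mul, Finset.sum_add_distrib]
    exact dvd_add (hw p y h h') (hu p y h h')
  neg_mem' := fun {w} hw p y h h' => by
    simp only [Pi.neg_apply, neg_mul, Finset.sum_neg_distrib]
    exact (hw p y h h').neg_right

theorem sum_entry (N r m H : ℕ) (a y : ℤ) {d i : ℕ} (hi : i < d) :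
    ∑ j : Fin d, entry N r m H a i j * ((H : ℤ) ^ (d - 1 - j) * y ^ (j : ℕ)) =
      N ^ (m - i / r) * (a + y) ^ i * H ^ (d - 1) := by
  rw [Fin.sum_univ_eq_sum_range (fun j => entry N r m H a i j * ((H : ℤ) ^ (d - 1 - j) * y ^ j)),
    add_comm a y, add_pow, Finset.mul_sum, Finset.sum_mul]
  symm
  refine Finset.sum_subset_zero_on_sdiff (Finset.range_mono hi) (fun j hj => ?_) fun j hj => ?_
  · simp only [Finset.mem_sdiff, Finset.mem_range, not_lt] at hj
    rw [entry, Nat.choose_eq_zero_of_lt (by omega)]; simp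
  · have hj := Finset.mem_range.1 hj
    rw [entry, show (H : ℤ) ^ (d - 1) = H ^ j * H ^ (d - 1 - j) by rw [← pow_add]; congr 1; omega]
    ring

/-- The power of N supplies r (m - ⌊i / r⌋) factors p and the power of a + y supplies i more. Since
r ⌊i / r⌋ ≤ i, these are at least r m in total, also when the truncated difference is 0. -/
theorem entry_mem_lattice {N r m d H : ℕ} {a : ℤ} {i : ℕ} (hi : i < d) :
    (fun j : Fin d => entry N r m H a i j) ∈ lattice N r m d H a := by
  intro p y hp hy
  rw [sum_entry N r m H a y hi]
  refine mul_dvd_mul ?_ dvd_rfl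
  have h1 : p ^ (r * (m - i / r)) * p ^ i ∣ N ^ (m - i / r) * (a + y) ^ i := by
    rw [pow_mul]; exact mul_dvd_mul (pow_dvd_pow_of_dvd hp _) (pow_dvd_pow_of_dvd hy _)
  refine dvd_trans ?_ h1
  rw [← pow_add]
  refine pow_dvd_pow _ ?_
  have h2 : r * (i / r) ≤ i := Nat.mul_div_le i r
  have h3 : m ≤ (m - i / r) + i / r := by omega
  calc r * m ≤ r * ((m - i / r) + i / r) := Nat.mul_le_mul_left _ h3
    _ ≤ _ := by rw [mul_add]; omega

/-- The second summand is twice the missing tail of the triangular sum; with truncated subtraction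
the identity holds for d > m too. -/
theorem two_mul_sum_sub (m d : ℕ) :
    2 * ∑ q ∈ Finset.range d, (m - q) + (m - d) * (m - d + 1) = m * (m + 1) := by
  induction d with
  | zero => simp
  | succ d ih =>
    rw [Finset.sum_range_succ, ← ih]
    rcases Nat.lt_or_ge d m with h | h
    · obtain ⟨k, rfl⟩ : ∃ k, m = d + 1 + k := ⟨m - (d + 1), by omega⟩
      rw [show d + 1 + k - d = k + 1 by omega, show d + 1 + k - (d + 1) = k by omega]
      ring
    · rw [show m - d = 0 by omega, show m - (d + 1) = 0 by omega]; ring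

theorem sum_sub_div (m : ℕ) {r : ℕ} (hr : 0 < r) (k : ℕ) :
    ∑ i ∈ Finset.range (r * k), (m - i / r) = r * ∑ q ∈ Finset.range k, (m - q) := by
  induction k with
  | zero => simp
  | succ k ih =>
    rw [mul_add, mul_one, Finset.sum_range_add, ih, Finset.sum_range_succ, mul_add]
    congr 1
    rw [Finset.sum_congr rfl (g := fun _ => m - k)]
    · simp
    · intro i hi
      rw [Nat.mul_add_div hr, Nat.div_eq_of_lt (Finset.mem_range.1 hi), add_zero]

/-- Each exponent m - q occurs at most r times, so the bound does not depend on d: rows beyond r m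
cost no further powers of N. -/
theorem two_mul_sum_sub_div_le (m d : ℕ) {r : ℕ} (hr : 0 < r) :
    2 * ∑ i ∈ Finset.range d, (m - i / r) ≤ r * (m * (m + 1)) := by
  have h1 : ∑ i ∈ Finset.range d, (m - i / r) ≤ ∑ i ∈ Finset.range (r * d), (m - i / r) :=
    Finset.sum_le_sum_of_subset (Finset.range_mono (Nat.le_mul_of_pos_left d hr))
  rw [sum_sub_div m hr] at h1
  have := two_mul_sum_sub m d
  have h2 : 2 * ∑ q ∈ Finset.range d, (m - q) ≤ m * (m + 1) := by omega
  nlinarith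

/-- The powers of N contribute at most N ^ (r m (m + 1)) ≤ T ^ (d r (m + 1)) to the squared
determinant. The powers of H, together with d ^ d and the LLL constant, stay below (d * (2 H) ^ d) ^
d ≤ T ^ (d r (m - 1)). The two exponents add up to 2 d r m. Strictness comes from d (d - 1) < d ^ 2.
-/
theorem det_lt {N r T m d H : ℕ} (hN : 0 < N) (hr : 0 < r) (hd : 0 < d) (hm : 0 < m) (hH : 0 < H)
    (hNT : N ^ m ≤ T ^ d) (hc : d * (2 * H) ^ d ≤ T ^ (r * (m - 1))) :
    d ^ d * (2 ^ (∑ l ∈ Finset.range d, l) *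
      (∏ i ∈ Finset.range d, N ^ (m - i / r) * H ^ i) ^ 2) < ((T ^ (r * m)) ^ 2) ^ d := by
  obtain ⟨m, rfl⟩ : ∃ k, m = k + 1 := ⟨m - 1, by omega⟩
  rw [Nat.add_sub_cancel] at hc
  set s := ∑ l ∈ Finset.range d, l with hs
  have h2s : 2 * s < d * d := by
    have := Finset.sum_range_id_mul_two d
    have h3 : d * (d - 1) < d * d := Nat.mul_lt_mul_of_pos_left (by omega) hd
    omega
  have hT : 0 < T := by
    rcases Nat.eq_zero_or_pos T with rfl | h
    · rw [zero_pow hd.ne'] at hNT; have := Nat.pow_pos (n := m + 1) hN; omega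
    · exact h
  rw [Finset.prod_mul_distrib, Finset.prod_pow_eq_pow_sum, Finset.prod_pow_eq_pow_sum, ← hs, mul_pow,
    ← pow_mul, ← pow_mul, mul_comm _ 2, mul_comm _ 2]
  have h1 : N ^ (2 * ∑ i ∈ Finset.range d, (m + 1 - i / r)) ≤ T ^ (d * (r * (m + 2))) := by
    calc _ ≤ N ^ (r * ((m + 1) * (m + 1 + 1))) :=
          Nat.pow_le_pow_right hN (two_mul_sum_sub_div_le _ _ hr)
      _ = (N ^ (m + 1)) ^ (r * (m + 2)) := by rw [← pow_mul]; congr 1; ring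
      _ ≤ (T ^ d) ^ (r * (m + 2)) := Nat.pow_le_pow_left hNT _
      _ = _ := by rw [← pow_mul]
  have h2 : d ^ d * (2 ^ s * H ^ (2 * s)) < T ^ (d * (r * m)) := by
    calc d ^ d * (2 ^ s * H ^ (2 * s)) ≤ d ^ d * (2 ^ (2 * s) * H ^ (2 * s)) := by
          gcongr; norm_num; omega
      _ = d ^ d * (2 * H) ^ (2 * s) := by rw [mul_pow]
      _ < d ^ d * (2 * H) ^ (d * d) := by
          gcongr; omega
      _ = (d * (2 * H) ^ d) ^ d := by rw [mul_pow d, ← pow_mul]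
      _ ≤ (T ^ (r * m)) ^ d := Nat.pow_le_pow_left hc _
      _ = _ := by rw [← pow_mul]; congr 1; ring
  calc _ = N ^ (2 * ∑ i ∈ Finset.range d, (m + 1 - i / r)) * (d ^ d * (2 ^ s * H ^ (2 * s))) := by ring
    _ < T ^ (d * (r * (m + 2))) * T ^ (d * (r * m)) :=
        Nat.mul_lt_mul_of_le_of_lt h1 h2 (by positivity)
    _ = _ := by rw [← pow_add, ← pow_mul, ← pow_mul]; congr 1; ring

/-- A short vector of the lattice gives a polynomial that vanishes at the points wanted. -/
theorem eval_eq_zero {N r T m d H : ℕ} {a p y : ℤ} (hN : 0 < N) (hr : 0 < r) (hd : 0 < d) (hm : 0 < m)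
    (hH : 0 < H) (hNT : N ^ m ≤ T ^ d) (hc : d * (2 * H) ^ d ≤ T ^ (r * (m - 1)))
    {w : Fin d → ℤ} (hw : w ∈ lattice N r m d H a)
    (hs : (∑ j, w j * w j) ^ d ≤ 2 ^ (∑ l ∈ Finset.range d, l) *
      (∏ i ∈ Finset.range d, (N : ℤ) ^ (m - i / r) * H ^ i) ^ 2)
    (hp : p ^ r ∣ N) (hTp : T ≤ p) (hy : p ∣ a + y) (hy0 : 0 ≤ y) (hyH : y ≤ H) :
    ∑ j, w j * ((H : ℤ) ^ (d - 1 - j) * y ^ (j : ℕ)) = 0 := by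
  have hH' : (0 : ℤ) < H := by exact_mod_cast hH
  have h1 : |∑ j, w j * ((H : ℤ) ^ (d - 1 - j) * y ^ (j : ℕ))| ≤ (∑ j, |w j|) * H ^ (d - 1) := by
    rw [Finset.sum_mul]
    refine (Finset.abs_sum_le_sum_abs _ _).trans (Finset.sum_le_sum fun j _ => ?_)
    rw [abs_mul, abs_of_nonneg (show 0 ≤ (H : ℤ) ^ (d - 1 - j) * y ^ (j : ℕ) by positivity)]
    refine mul_le_mul_of_nonneg_left ?_ (abs_nonneg _)
    calc (H : ℤ) ^ (d - 1 - j) * y ^ (j : ℕ) ≤ H ^ (d - 1 - j) * H ^ (j : ℕ) := by gcongr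
      _ = _ := by rw [← pow_add]; congr 1; omega
  -- Cauchy–Schwarz passes from the Euclidean norm to the sum of absolute values. Everything is
  -- raised to the power 2 d, so that no roots occur.
  have h2 : (∑ j, |w j|) < (T : ℤ) ^ (r * m) := by
    have h3 : ((∑ j, |w j|) ^ 2) ^ d < (((T : ℤ) ^ (r * m)) ^ 2) ^ d := by
      have h4 : (∑ j, |w j|) ^ 2 ≤ d * ∑ j, w j * w j := by
        have := sq_sum_le_card_mul_sum_sq (s := Finset.univ) (f := fun j => |w j|)
        simpa [sq_abs, sq] using this
      calc ((∑ j, |w j|) ^ 2) ^ d ≤ (d * ∑ j, w j * w j) ^ d := pow_le_pow_left₀ (by positivity) h4 d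
        _ ≤ d ^ d * (2 ^ (∑ l ∈ Finset.range d, l) *
            (∏ i ∈ Finset.range d, (N : ℤ) ^ (m - i / r) * H ^ i) ^ 2) := by
          rw [mul_pow]; gcongr
        _ < _ := by exact_mod_cast det_lt hN hr hd hm hH hNT hc
    exact lt_of_pow_lt_pow_left₀ 2 (by positivity) (lt_of_pow_lt_pow_left₀ d (by positivity) h3)
  -- The value is a multiple of p ^ (r m) * H ^ (d - 1) and smaller than that in absolute value.
  refine Int.eq_zero_of_abs_lt_dvd (hw p y hp hy) (h1.trans_lt ?_)
  have hT0 : (0 : ℤ) ≤ T := by positivity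
  have h5 : (T : ℤ) ^ (r * m) ≤ p ^ (r * m) := pow_le_pow_left₀ hT0 hTp _
  exact mul_lt_mul_of_pos_right (h2.trans_le h5) (by positivity)

end Coppersmith

/-! ### The Coppersmith basis as input of the reduction -/

namespace BitRAM

open LatticeReduction Coppersmith

theorem abs_entry_le {N r m H : ℕ} {a : ℤ} (hN : 0 < N) (ha0 : 0 ≤ a) (ha : a < N) (hHN : H ≤ N)
    {d i j : ℕ} (hi : i < d) : |entry N r m H a i j| ≤ (N : ℤ) ^ m * (2 * N) ^ d := by
  have hN' : (1 : ℤ) ≤ N := by exact_mod_cast hN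
  have hH' : (H : ℤ) ≤ N := by exact_mod_cast hHN
  rw [entry, abs_of_nonneg (by positivity)]
  have h1 : (i.choose j : ℤ) * a ^ (i - j) * H ^ j ≤ (H + a) ^ i := by
    rcases Nat.lt_or_ge i j with h | h
    · rw [Nat.choose_eq_zero_of_lt h]; simp; positivity
    · rw [add_pow]
      refine le_trans (le_of_eq ?_) (Finset.single_le_sum
        (f := fun j => (H : ℤ) ^ j * a ^ (i - j) * (i.choose j : ℤ)) (fun _ _ => by positivity)
        (Finset.mem_range.2 (Nat.lt_succ_of_le h)))
      ring
  have h2 : ((H : ℤ) + a) ^ i ≤ (2 * N) ^ d :=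
    (pow_le_pow_left₀ (by positivity) (by omega) i).trans (pow_le_pow_right₀ (by omega) hi.le)
  exact mul_le_mul (pow_le_pow_right₀ hN' (Nat.sub_le _ _)) (h1.trans h2) (by positivity) (by positivity)

theorem irow_eq_entry {N r m d H : ℕ} {a : ℤ} {A : ℤ → ℤ}
    (hA : ∀ n < d * d, A n = entry N r m H a (n / d) (n % d)) {i : ℕ} (hi : i < d) :
    irow A d i = fun j : Fin d => entry N r m H a i j := by
  funext j
  have hj := j.2
  have h1 : i * d + j < d * d := by
    have : (i + 1) * d ≤ d * d := Nat.mul_le_mul_right _ hi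
    rw [add_mul] at this; omega
  have := hA _ h1
  rw [mul_comm i d, Nat.mul_add_div (by omega), Nat.div_eq_of_lt hj, add_zero, Nat.mul_add_mod,
    Nat.mod_eq_of_lt hj, mul_comm d i] at this
  rw [irow, ← this]; push_cast; rfl

/-- The basis of the lattice satisfies the requirements of the reduction algorithm. -/
theorem latInv_of_entry {N r m d H : ℕ} {a : ℤ} {A : ℤ → ℤ} {E : ℝ} (hN : 0 < N) (hH : 0 < H)
    (hd : 0 < d) (hA : ∀ n < d * d, A n = entry N r m H a (n / d) (n % d)) (hE1 : 1 ≤ E)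
    (hE : ∀ i < d, ∀ j < d, |(entry N r m H a i j : ℝ)| ≤ E) :
    LatInv (lattice N r m d H a) ((d * E ^ 2) ^ d)
      ((∏ i ∈ Finset.range d, (N : ℝ) ^ (m - i / r) * H ^ i) ^ 2) A := by
  have hd1 : (1 : ℝ) ≤ d := by exact_mod_cast hd
  have hY : 1 ≤ d * E ^ 2 := by nlinarith [one_le_pow₀ hE1 (n := 2)]
  have happ : ∀ {i : ℕ}, i < d → ∀ j : Fin d, bs A d i j = entry N r m H a i j := by
    intro i hi j
    rw [bs, irow_eq_entry hA hi]; rfl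
  have htri : ∀ (i : ℕ) (j : Fin d), i < j → bs A d i j = 0 := by
    intro i j hij
    rw [happ (hij.trans j.2), entry, Nat.choose_eq_zero_of_lt hij]; simp
  have hdiag : ∀ i : Fin d, bs A d i i = (N : ℝ) ^ (m - i / r) * H ^ (i : ℕ) := by
    intro i
    rw [happ i.2, entry]; simp
  have hsc : ∀ i < d, sc (bs A d) 0 i i ≤ d * E ^ 2 := by
    intro i hi
    have h : sc (bs A d) 0 i i = _ := inner_toV (irow A d i) (irow A d i)
    rw [h, irow_eq_entry hA hi]
    push_cast
    refine (Finset.sum_le_card_nsmul _ _ (E ^ 2) fun j _ => ?_).trans (by simp)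
    rw [← sq, ← sq_abs]
    exact pow_le_pow_left₀ (abs_nonneg _) (hE i hi j j.2) 2
  have hpos : ∀ k < d, 0 < sc (bs A d) k k k := fun k hk =>
    sc_pos_of_triangular htri hk (by rw [hdiag ⟨k, hk⟩]; positivity)
  have hgpos : ∀ k ≤ d, 0 < gd (bs A d) k := fun k hk =>
    Finset.prod_pos fun l hl => hpos l ((Finset.mem_range.1 hl).trans_le hk)
  refine ⟨fun k hk => ?_, fun k hk => ?_, ?_, fun i hi => ?_, fun i hi => ?_⟩
  -- Hadamard's inequality: projections do not lengthen the rows.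
  · calc gd (bs A d) k ≤ ∏ l ∈ Finset.range k, (d * E ^ 2) :=
          Finset.prod_le_prod (fun _ _ => sc_self_nonneg _ _ _) fun l hl =>
            (sc_le _ _ _).trans (hsc l ((Finset.mem_range.1 hl).trans_le hk))
      _ = (d * E ^ 2) ^ k := by simp
      _ ≤ _ := pow_le_pow_right₀ hY hk
  -- For k > 0 the Gram determinant is a positive integer.
  · obtain rfl | ⟨k, rfl⟩ : k = 0 ∨ ∃ l, k = l + 1 := by
      cases k; exacts [Or.inl rfl, Or.inr ⟨_, rfl⟩]
    · rw [gd_zero]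
    · obtain ⟨z, hz⟩ := exists_int_gd_mul_sc (exists_int_inner_bs A d) k k k
      have := hgpos _ hk
      rw [gd_succ, hz] at this ⊢
      exact_mod_cast this
  · rw [gd_of_triangular htri, Finset.prod_congr rfl fun i _ => hdiag i,
      Fin.prod_univ_eq_prod_range (fun i => (N : ℝ) ^ (m - i / r) * H ^ i)]
  · rw [irow_eq_entry hA hi]; exact entry_mem_lattice hi
  · refine (hsc i hi).trans ?_
    calc (d : ℝ) * E ^ 2 ≤ (d * E ^ 2) ^ d := le_self_pow₀ hY hd.ne'
      _ ≤ d * (d * E ^ 2) ^ d := le_mul_of_one_le_left (by positivity) hd1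

end BitRAM

namespace BitRAM

/-! ### Sizes of the numbers -/

/-- The parameters of the algorithm: `n` is the length of `N`, the lattice has dimension `d`, and
blocks of length `H` are searched. -/
structure Ctx (n N r s T T' d H : ℕ) : Prop where
  n_pos : 0 < n
  N_lt : N < 2 ^ n
  r_pos : 0 < r
  two_le_T : 2 ≤ T
  T_le : T ≤ T'
  pow_le : T' ^ r ≤ N
  s_pos : 0 < s
  s_lt : s < 2 ^ n
  d_pos : 0 < d
  d_le : d ≤ n ^ 2
  H_pos : 0 < H
  H_le : H ≤ N
  le_pow : N ^ n ≤ T ^ d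
  cond : H = 1 ∨ d * (2 * H) ^ d ≤ T ^ (r * (n - 1))

/-- A bound for the number of iterations of loops and for the length of numbers. -/
def cap (n : ℕ) : ℕ := 40 * n ^ 9

/-- A bound for the entries of the basis. -/
def entryBound (n N d : ℕ) : ℕ := N ^ n * (2 * N) ^ d

/-- A bound for the Gram determinants of the basis. -/
def gramBound (n N d : ℕ) : ℕ := (d * entryBound n N d ^ 2) ^ d

theorem pow_le_two_pow {a k j e x : ℕ} (h : a ≤ 2 ^ k) (hj : j ≤ e) (hx : k * e ≤ x) : a ^ j ≤ 2 ^ x :=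
  calc a ^ j ≤ (2 ^ k) ^ j := Nat.pow_le_pow_left h j
    _ ≤ (2 ^ k) ^ e := Nat.pow_le_pow_right (by positivity) hj
    _ = 2 ^ (k * e) := by rw [pow_mul]
    _ ≤ _ := Nat.pow_le_pow_right two_pos hx

theorem mul_le_two_pow {a b k j x : ℕ} (ha : a ≤ 2 ^ k) (hb : b ≤ 2 ^ j) (hx : k + j ≤ x) :
    a * b ≤ 2 ^ x :=
  (Nat.mul_le_mul ha hb).trans (by rw [← pow_add]; exact Nat.pow_le_pow_right two_pos hx)

theorem add_le_two_pow {a b k j x : ℕ} (ha : a ≤ 2 ^ k) (hb : b ≤ 2 ^ j) (hx : k + j + 1 ≤ x) :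
    a + b ≤ 2 ^ x := by
  have h1 : 2 ^ k ≤ 2 ^ (k + j) := Nat.pow_le_pow_right two_pos (by omega)
  have h2 : 2 ^ j ≤ 2 ^ (k + j) := Nat.pow_le_pow_right two_pos (by omega)
  calc a + b ≤ 2 ^ (k + j + 1) := by rw [pow_succ]; omega
    _ ≤ _ := Nat.pow_le_pow_right two_pos hx

theorem le_two_pow_of_le {a k x : ℕ} (ha : a ≤ 2 ^ k) (hx : k ≤ x) : a ≤ 2 ^ x :=
  ha.trans (Nat.pow_le_pow_right two_pos hx)

theorem le_two_pow_of_le_self {a k : ℕ} (h : a ≤ k) : a ≤ 2 ^ k := h.trans Nat.lt_two_pow_self.le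

variable {n N r s T T' d H : ℕ}

theorem pow_le_pow_nine (hn : 0 < n) {k : ℕ} (hk : k ≤ 9) : n ^ k ≤ n ^ 9 := Nat.pow_le_pow_right hn hk

theorem entryBound_le (hn : 0 < n) (hN : N < 2 ^ n) (hd : d ≤ n ^ 2) :
    entryBound n N d ≤ 2 ^ (3 * n ^ 3) := by
  have h1 : n ^ 2 ≤ n ^ 3 := Nat.pow_le_pow_right hn (by omega)
  have h2 : 2 * N ≤ 2 ^ (n + 1) := by rw [pow_succ]; omega
  refine mul_le_two_pow (pow_le_two_pow hN.le le_rfl le_rfl) (pow_le_two_pow h2 hd le_rfl) ?_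
  nlinarith

theorem gramBound_le (hn : 0 < n) (hN : N < 2 ^ n) (hd : d ≤ n ^ 2) :
    gramBound n N d ≤ 2 ^ (7 * n ^ 5) := by
  refine pow_le_two_pow (mul_le_two_pow (le_two_pow_of_le_self hd)
    (pow_le_two_pow (entryBound_le hn hN hd) le_rfl le_rfl) le_rfl) hd ?_
  have h1 : n ^ 4 ≤ n ^ 5 := Nat.pow_le_pow_right hn (by omega)
  nlinarith

namespace Ctx

theorem N_pos (h : Ctx n N r s T T' d H) : 0 < N := by
  have := Nat.pow_pos (n := r) (show 0 < T' by have := h.two_le_T; have := h.T_le; omega)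
  have := h.pow_le; omega

theorem le_N (h : Ctx n N r s T T' d H) : T' ≤ N := (Nat.le_self_pow h.r_pos.ne' T').trans h.pow_le

theorem r_le (h : Ctx n N r s T T' d H) : r ≤ n := by
  have h1 : 2 ^ r < 2 ^ n :=
    ((Nat.pow_le_pow_left (h.two_le_T.trans h.T_le) r).trans h.pow_le).trans_lt h.N_lt
  exact ((Nat.pow_lt_pow_iff_right (by norm_num)).1 h1).le

theorem one_le_entryBound (h : Ctx n N r s T T' d H) : 1 ≤ entryBound n N d := by
  have := h.N_pos
  unfold entryBound; exact Nat.succ_le_of_lt (by positivity)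

/-- A polynomial in `n` that is at most `cap n`. -/
theorem poly_le_cap (hn : 0 < n) (c₀ c₁ c₂ c₃ c₄ c₅ c₆ c₇ c₉ : ℕ)
    (hc : c₀ + c₁ + c₂ + c₃ + c₄ + c₅ + c₆ + c₇ + c₉ ≤ 40) :
    c₀ + c₁ * n + c₂ * n ^ 2 + c₃ * n ^ 3 + c₄ * n ^ 4 + c₅ * n ^ 5 + c₆ * n ^ 6 + c₇ * n ^ 7 +
      c₉ * n ^ 9 ≤ cap n := by
  have e0 : 1 ≤ n ^ 9 := Nat.pow_pos hn
  have e1 : n ≤ n ^ 9 := Nat.le_self_pow (by norm_num) n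
  have e2 := pow_le_pow_nine hn (k := 2) (by norm_num)
  have e3 := pow_le_pow_nine hn (k := 3) (by norm_num)
  have e4 := pow_le_pow_nine hn (k := 4) (by norm_num)
  have e5 := pow_le_pow_nine hn (k := 5) (by norm_num)
  have e6 := pow_le_pow_nine hn (k := 6) (by norm_num)
  have e7 := pow_le_pow_nine hn (k := 7) (by norm_num)
  calc _ ≤ c₀ * n ^ 9 + c₁ * n ^ 9 + c₂ * n ^ 9 + c₃ * n ^ 9 + c₄ * n ^ 9 + c₅ * n ^ 9 + c₆ * n ^ 9 +
        c₇ * n ^ 9 + c₉ * n ^ 9 := by gcongr; exact Nat.le_mul_of_pos_right _ e0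
    _ = (c₀ + c₁ + c₂ + c₃ + c₄ + c₅ + c₆ + c₇ + c₉) * n ^ 9 := by ring
    _ ≤ _ := Nat.mul_le_mul_right _ hc

theorem n_le (h : Ctx n N r s T T' d H) : n ≤ cap n := by
  have := poly_le_cap h.n_pos 0 1 0 0 0 0 0 0 0 (by norm_num); omega

theorem d_mul_d_le (h : Ctx n N r s T T' d H) : d * d ≤ n ^ 4 := by
  calc d * d ≤ n ^ 2 * n ^ 2 := Nat.mul_le_mul h.d_le h.d_le
    _ = _ := by ring

theorem loop_le (h : Ctx n N r s T T' d H) :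
    2 * d * (d * d) ≤ cap n ∧ 4 * d * (d + 1) ≤ cap n ∧ 2 * d * d ≤ cap n ∧ d * d ≤ cap n ∧
      d ≤ cap n := by
  have h1 := poly_le_cap h.n_pos 0 0 4 0 4 0 2 0 0 (by norm_num)
  have h2 := h.d_mul_d_le
  have h3 := h.d_le
  have h4 : d * (d * d) ≤ n ^ 2 * n ^ 4 := Nat.mul_le_mul h3 h2
  have h5 : n ^ 2 * n ^ 4 = n ^ 6 := by ring
  refine ⟨?_, ?_, ?_, ?_, ?_⟩ <;> nlinarith

/-- This estimate forces the exponent 9 in `cap`: a number of about 14 n ^ 5 bits is raised to the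
power d * d ≤ n ^ 4. -/
theorem gram_nat_le (h : Ctx n N r s T T' d H) :
    3 * gramBound n N d * (d * gramBound n N d *
      (2 + 6 * gramBound n N d * (d * gramBound n N d)) ^ (d * d)) ≤ 2 ^ cap n := by
  have hX := gramBound_le h.n_pos h.N_lt h.d_le
  have hd : d ≤ 2 ^ (n ^ 2) := le_two_pow_of_le_self h.d_le
  have hdX := mul_le_two_pow hd hX le_rfl
  have h1 : 2 + 6 * gramBound n N d * (d * gramBound n N d) ≤
      2 ^ (1 + (3 + 7 * n ^ 5 + (n ^ 2 + 7 * n ^ 5)) + 1) :=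
    add_le_two_pow (by norm_num) (mul_le_two_pow (mul_le_two_pow (by norm_num) hX le_rfl) hdX le_rfl) le_rfl
  refine mul_le_two_pow (mul_le_two_pow (show 3 ≤ 2 ^ 2 by norm_num) hX le_rfl)
    (mul_le_two_pow hdX (pow_le_two_pow h1 h.d_mul_d_le le_rfl) le_rfl) ?_
  refine le_trans (le_of_eq ?_) (poly_le_cap h.n_pos 2 0 1 0 5 14 1 0 14 (by norm_num))
  ring

theorem gram_pow_lt (h : Ctx n N r s T T' d H) :
    (gramBound n N d : ℝ) ^ d * (3 / 4) ^ cap n < 1 := by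
  have h1 : gramBound n N d ^ d ≤ 2 ^ (7 * n ^ 7) :=
    pow_le_two_pow (gramBound_le h.n_pos h.N_lt h.d_le) h.d_le (by ring_nf; rfl)
  -- Three factors 3/4 together are less than 1/2, so 3 * (7 n ^ 7 + 1) rounds outweigh the 7 n ^ 7
  -- bits of the initial potential.
  have h2 : 3 * (7 * n ^ 7 + 1) ≤ cap n := by
    refine le_trans (le_of_eq ?_) (poly_le_cap h.n_pos 3 0 0 0 0 0 0 21 0 (by norm_num)); ring
  have h3 : ((3 : ℝ) / 4) ^ cap n ≤ (1 / 2) ^ (7 * n ^ 7 + 1) := by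
    calc ((3 : ℝ) / 4) ^ cap n ≤ (3 / 4) ^ (3 * (7 * n ^ 7 + 1)) :=
          pow_le_pow_of_le_one (by norm_num) (by norm_num) h2
      _ = ((3 / 4) ^ 3) ^ (7 * n ^ 7 + 1) := by rw [pow_mul]
      _ ≤ _ := pow_le_pow_left₀ (by norm_num) (by norm_num) _
  have h1' : (gramBound n N d : ℝ) ^ d ≤ 2 ^ (7 * n ^ 7) := by exact_mod_cast h1
  calc (gramBound n N d : ℝ) ^ d * (3 / 4) ^ cap n ≤ 2 ^ (7 * n ^ 7) * (1 / 2) ^ (7 * n ^ 7 + 1) :=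
        mul_le_mul h1' h3 (by positivity) (by positivity)
    _ = 1 / 2 := by rw [pow_succ (1 / 2 : ℝ), ← mul_assoc, ← mul_pow]; norm_num
    _ < 1 := by norm_num

theorem root_nat_le (h : Ctx n N r s T T' d H) :
    2 ^ (2 * d * (2 * d)) * (1 + (d * (d * gramBound n N d) * (H + 2 * d) ^ d) ^ 2) ≤ 2 ^ cap n := by
  have hX := gramBound_le h.n_pos h.N_lt h.d_le
  have hd : d ≤ 2 ^ (n ^ 2) := le_two_pow_of_le_self h.d_le
  have hH : H + 2 * d ≤ 2 ^ (n + (1 + n ^ 2) + 1) :=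
    add_le_two_pow (h.H_le.trans h.N_lt.le) (mul_le_two_pow (by norm_num) hd le_rfl) le_rfl
  have h0 : 2 ^ (2 * d * (2 * d)) ≤ 2 ^ (4 * n ^ 4) :=
    Nat.pow_le_pow_right two_pos (by have := h.d_mul_d_le; nlinarith)
  refine mul_le_two_pow h0 (add_le_two_pow (show 1 ≤ 2 ^ 0 by norm_num)
    (pow_le_two_pow (mul_le_two_pow (mul_le_two_pow hd (mul_le_two_pow hd hX le_rfl) le_rfl)
      (pow_le_two_pow hH h.d_le le_rfl) le_rfl) le_rfl le_rfl) le_rfl) ?_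
  refine le_trans (le_of_eq ?_) (poly_le_cap h.n_pos 1 0 8 2 6 14 0 0 0 (by norm_num))
  ring

theorem entryBound_le_cap (h : Ctx n N r s T T' d H) : entryBound n N d ≤ 2 ^ cap n :=
  le_two_pow_of_le (entryBound_le h.n_pos h.N_lt h.d_le) (by
    have := poly_le_cap h.n_pos 0 0 0 3 0 0 0 0 0 (by norm_num); omega)

theorem N_le_cap (h : Ctx n N r s T T' d H) : N ≤ 2 ^ cap n :=
  le_two_pow_of_le h.N_lt.le h.n_le

theorem point_le_cap (h : Ctx n N r s T T' d H) : 1 + s * (N + (H + d)) ≤ 2 ^ cap n := by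
  have hd : d ≤ 2 ^ (n ^ 2) := le_two_pow_of_le_self h.d_le
  have := poly_le_cap h.n_pos 3 3 1 0 0 0 0 0 0 (by norm_num)
  refine add_le_two_pow (show 1 ≤ 2 ^ 0 by norm_num) (mul_le_two_pow h.s_lt.le
    (add_le_two_pow h.N_lt.le (add_le_two_pow (h.H_le.trans h.N_lt.le) hd le_rfl) le_rfl) le_rfl) ?_
  omega

end Ctx
end BitRAM

/-! ### Constructing the basis and testing candidates -/

namespace BitRAM

open Coppersmith

/-- The coefficients of `(a + H * z) ^ i`. -/
def binom (a : ℤ) (H i j : ℕ) : ℤ := i.choose j * a ^ (i - j) * H ^ j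

theorem binom_succ_zero (a : ℤ) (H i : ℕ) : binom a H (i + 1) 0 = a * binom a H i 0 := by
  simp [binom, pow_succ']

/-- Pascal's rule, by which `binomProg` computes each row from the one before. -/
theorem binom_succ_succ (a : ℤ) (H i j : ℕ) :
    binom a H (i + 1) (j + 1) = a * binom a H i (j + 1) + H * binom a H i j := by
  unfold binom
  rw [Nat.choose_succ_succ, Nat.add_sub_add_right]
  rcases Nat.lt_or_ge j i with h | h
  · rw [show i - j = i - (j + 1) + 1 by omega]; push_cast; ring
  · rw [Nat.choose_eq_zero_of_lt (show i < j + 1 by omega)]; push_cast; ring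

/-- Computes the coefficients of the powers of `a + H * z`. -/
def binomProg : Prog := forLoop 13 (v 5 * v 5) (.ite (v 13 / v 5)
  (.ite (v 13 % v 5)
    (.store 7 (v 13) (v 12 * .get 7 (v 13 - v 5) + v 6 * .get 7 (v 13 - v 5 - 1)))
    (.store 7 (v 13) (v 12 * .get 7 (v 13 - v 5))))
  (.ite (v 13 % v 5) (.store 7 (v 13) 0) (.store 7 (v 13) 1)))

/-- Stores the basis of the lattice. -/
def scaleProg : Prog := forLoop 13 (v 5 * v 5) (.ite (v 13 / v 5 / v 1 - v 7)
  (.store 5 (v 13) (.get 7 (v 13)))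
  (.store 5 (v 13) (.get 12 (v 7 - v 13 / v 5 / v 1) * .get 7 (v 13))))

variable {R B : ℕ} {σ : State} {Q : State → Prop}

theorem binomProg_spec {d H : ℕ} {a : ℤ} (h5 : σ.var 5 = d) (h6 : σ.var 6 = H) (h12 : σ.var 12 = a)
    (hd : 0 < d) (hR : d * d ≤ R) (hB : d * d ≤ 2 ^ B)
    (hE : ∀ i < d, ∀ j < d, |binom a H i j| ≤ 2 ^ B)
    (hQ : ∀ τ, Same binomProg σ τ →
      (∀ n < d * d, τ.arr 7 n = binom a H (n / d) (n % d)) → Q τ) : Ev R B binomProg σ Q := by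
  refine Ev.fill (a := 7) (fun n z => z = binom a H (n / d) (n % d)) (d * d) hR hB rfl ?_ ?_ ?_
  · intro τ hτ
    simp [hτ.var 5 rfl, h5]
  · intro n hn τ _ hτ hnv hprev _
    have v5 : τ.var 5 = d := by rw [hτ.var 5 rfl, h5]
    have v6 : τ.var 6 = H := by rw [hτ.var 6 rfl, h6]
    have v12 : τ.var 12 = a := by rw [hτ.var 12 rfl, h12]
    obtain ⟨i, j, hi, hj, rfl⟩ : ∃ i j, i < d ∧ j < d ∧ n = i * d + j :=
      ⟨n / d, n % d, Nat.div_lt_of_lt_mul hn, Nat.mod_lt _ hd, (Nat.div_add_mod' n d).symm⟩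
    have hdm : ∀ i j, j < d → (i * d + j) / d = i ∧ (i * d + j) % d = j := by
      intro i j hj
      constructor
      · rw [mul_comm, Nat.mul_add_div hd, Nat.div_eq_of_lt hj, add_zero]
      · rw [mul_comm, Nat.mul_add_mod, Nat.mod_eq_of_lt hj]
    obtain ⟨e1, e2⟩ := hdm i j hj
    have c1 : (v 13 / v 5 : Expr).eval τ = (i : ℤ) := by
      conv_rhs => rw [← e1]
      simp [hnv, v5]
    have c2 : (v 13 % v 5 : Expr).eval τ = (j : ℤ) := by
      conv_rhs => rw [← e2]
      simp [hnv, v5]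
    rw [e1, e2]
    have hbd := hE i hi j hj
    refine Ev.ite (fun hpos => ?_) fun hneg => ?_
    · rw [c1] at hpos
      obtain ⟨i, rfl⟩ : ∃ k, i = k + 1 := ⟨i - 1, by omega⟩
      have p1 := hprev (i * d + j) (by rw [add_mul]; omega)
      rw [(hdm i j hj).1, (hdm i j hj).2] at p1
      have i1 : ((((i + 1) * d + j : ℕ) : ℤ) - d) = ((i * d + j : ℕ) : ℤ) := by push_cast; ring
      refine Ev.ite (fun hpos => ?_) fun hneg => ?_
      · rw [c2] at hpos
        obtain ⟨j, rfl⟩ : ∃ k, j = k + 1 := ⟨j - 1, by omega⟩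
        have p2 := hprev (i * d + j) (by rw [add_mul]; omega)
        rw [(hdm i j (by omega)).1, (hdm i j (by omega)).2] at p2
        refine Ev.store _ (binom a H (i + 1) (j + 1)) hnv ?_ (fun _ => hbd)
          ⟨_, setArr_arr_self _ _ _ _, rfl⟩
        simp only [eval_add, eval_mul, eval_get, eval_sub, eval_var, eval_one, v5, v6, v12, hnv, i1]
        rw [p1, show ((i * d + (j + 1) : ℕ) : ℤ) - 1 = ((i * d + j : ℕ) : ℤ) by push_cast; ring, p2,
          binom_succ_succ]
      · rw [c2] at hneg
        obtain rfl : j = 0 := by omega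
        refine Ev.store _ (binom a H (i + 1) 0) hnv ?_ (fun _ => hbd)
          ⟨_, setArr_arr_self _ _ _ _, rfl⟩
        simp only [eval_mul, eval_get, eval_sub, eval_var, v5, v12, hnv, i1]
        rw [p1, binom_succ_zero]
    · rw [c1] at hneg
      obtain rfl : i = 0 := by omega
      refine Ev.ite (fun hpos => ?_) fun hneg => ?_
      · rw [c2] at hpos
        refine Ev.store _ 0 hnv rfl (fun _ => by simp) ⟨_, setArr_arr_self _ _ _ _, ?_⟩
        rw [binom, Nat.choose_eq_zero_of_lt (by omega)]; simp
      · rw [c2] at hneg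
        obtain rfl : j = 0 := by omega
        refine Ev.store _ 1 hnv rfl (fun _ => ?_) ⟨_, setArr_arr_self _ _ _ _, by simp [binom]⟩
        rw [abs_one]; exact one_le_pow₀ (by norm_num)
  · intro τ hτ h _
    exact hQ τ hτ h

theorem scaleProg_spec {N r m d H : ℕ} {a : ℤ} (h1 : σ.var 1 = r) (h5 : σ.var 5 = d)
    (h7 : σ.var 7 = m) (ha : ∀ n < d * d, σ.arr 7 n = binom a H (n / d) (n % d))
    (hN : ∀ t ≤ m, σ.arr 12 t = (N : ℤ) ^ t) (hd : 0 < d) (hR : d * d ≤ R) (hB : d * d ≤ 2 ^ B)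
    (hE : ∀ i < d, ∀ j < d, |entry N r m H a i j| ≤ 2 ^ B)
    (hQ : ∀ τ, Same scaleProg σ τ →
      (∀ n < d * d, τ.arr 5 n = entry N r m H a (n / d) (n % d)) → Q τ) : Ev R B scaleProg σ Q := by
  refine Ev.fill (a := 5) (fun n z => z = entry N r m H a (n / d) (n % d)) (d * d) hR hB rfl ?_ ?_ ?_
  · intro τ hτ
    simp [hτ.var 5 rfl, h5]
  · intro n hn τ _ hτ hnv _ _
    have v1 : τ.var 1 = r := by rw [hτ.var 1 rfl, h1]
    have v5 : τ.var 5 = d := by rw [hτ.var 5 rfl, h5]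
    have v7 : τ.var 7 = m := by rw [hτ.var 7 rfl, h7]
    have a7 := ha n hn
    rw [← hτ.arr 7 rfl] at a7
    have hbd := hE (n / d) (Nat.div_lt_of_lt_mul hn) (n % d) (Nat.mod_lt _ hd)
    have c1 : (v 13 / v 5 / v 1 : Expr).eval τ = ((n / d / r : ℕ) : ℤ) := by
      simp [hnv, v5, v1]
    refine Ev.ite (fun hpos => ?_) fun hneg => ?_
    · rw [eval_sub, c1, eval_var, v7] at hpos
      refine Ev.store _ _ hnv rfl (fun hB => hB.2 _ _) ⟨_, setArr_arr_self _ _ _ _, ?_⟩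
      rw [eval_get, eval_var, hnv, a7, entry, show m - n / d / r = 0 by omega, pow_zero, one_mul, binom]
    · rw [eval_sub, c1, eval_var, v7] at hneg
      have hle : n / d / r ≤ m := by omega
      refine Ev.store _ (entry N r m H a (n / d) (n % d)) hnv ?_ (fun _ => hbd)
        ⟨_, setArr_arr_self _ _ _ _, rfl⟩
      have a12 := hN (m - n / d / r) (Nat.sub_le _ _)
      rw [← hτ.arr 12 rfl, Nat.cast_sub hle] at a12
      rw [eval_mul, eval_get, eval_get, eval_sub, c1, eval_var, eval_var, v7, hnv, a7, a12]
      rfl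
  · intro τ hτ h _
    exact hQ τ hτ h

/-- Outputs the number in variable 16 if it is one of the numbers wanted. -/
def checkProg : Prog := .ite (v 16 - v 3 + 1) (.ite (v 4 - v 16 + 1) (block [.assign 17 1,
  forLoop 18 (v 1) (.assign 17 (v 17 * v 16)), .ite (v 0 % v 17) .skip (.write (v 16))]) .skip) .skip

/-- The numbers that are looked for, except for the congruence condition. -/
def Good (N r T T' : ℕ) (p : ℤ) : Prop := T ≤ p ∧ p ≤ T' ∧ p ^ r ∣ (N : ℤ)

open Classical in
theorem checkProg_spec {N r T T' : ℕ} {p : ℤ} (h0 : σ.var 0 = N) (h1 : σ.var 1 = r) (h3 : σ.var 3 = T)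
    (h4 : σ.var 4 = T') (h16 : σ.var 16 = p) (hT : 0 < T) (hR : r ≤ R) (hB : r ≤ 2 ^ B)
    (hpow : T' ^ r ≤ 2 ^ B)
    (hQ : ∀ τ, Same checkProg σ τ →
      τ.out = (if Good N r T T' p then σ.out ++ [p] else σ.out) → Q τ) : Ev R B checkProg σ Q := by
  suffices h : Ev R B checkProg σ (fun τ =>
      τ.out = (if Good N r T T' p then σ.out ++ [p] else σ.out)) from
    h.conseq fun τ h1 _ h2 => hQ τ h1 h2
  refine Ev.ite (fun hpos => Ev.ite (fun hpos' => ?_) fun hneg => ?_) fun hneg => ?_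
  · have hTp : (T : ℤ) ≤ p := by simp [h16, h3] at hpos; omega
    have hpT : p ≤ T' := by simp [h16, h4] at hpos'; omega
    have hp1 : 1 ≤ p := by omega
    refine Ev.block_cons (Ev.assign 1 rfl (fun _ => ?_) ?_)
    · rw [abs_one]; exact one_le_pow₀ (by norm_num)
    refine Ev.block_cons (Ev.forLoop (I := fun k τ => τ.var 17 = p ^ k) r hR hB rfl ?_ (by simp) ?_ ?_)
    · intro τ hτ
      simp [hτ.var 1 rfl, h1]
    · intro k hk τ _ hτ _ hI
      have v16 : τ.var 16 = p := by rw [hτ.var 16 rfl]; simp [h16]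
      refine Ev.assign (p ^ (k + 1)) (by simp [hI, v16, pow_succ]) (fun _ => ?_) (by simp)
      -- The range test comes first, so the powers of p never exceed T' ^ r ≤ 2 ^ B.
      rw [abs_of_nonneg (by positivity)]
      calc p ^ (k + 1) ≤ p ^ r := pow_le_pow_right₀ hp1 hk
        _ ≤ (T' : ℤ) ^ r := pow_le_pow_left₀ (by omega) hpT r
        _ ≤ _ := by exact_mod_cast hpow
    · intro τ hτ _ hI
      have v16 : τ.var 16 = p := by rw [hτ.var 16 rfl]; simp [h16]
      have v0 : τ.var 0 = N := by rw [hτ.var 0 rfl]; simp [h0]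
      have ho : τ.out = σ.out := by rw [hτ.out rfl]; simp
      have hpr : 0 < p ^ r := by positivity
      refine Ev.block_one (Ev.ite (fun hpos => Ev.skip ?_) fun hneg => Ev.write p v16 ?_)
      · simp only [eval_mod, eval_var, v0, hI] at hpos
        rw [if_neg, ho]
        rintro ⟨-, -, h⟩
        rw [Int.emod_eq_zero_of_dvd h] at hpos
        exact lt_irrefl _ hpos
      · simp only [eval_mod, eval_var, v0, hI] at hneg
        rw [if_pos, push_out, ho]
        exact ⟨hTp, hpT, Int.dvd_of_emod_eq_zero
          (le_antisymm (not_lt.1 hneg) (Int.emod_nonneg _ hpr.ne'))⟩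
  · refine Ev.skip ?_
    rw [if_neg]
    rintro ⟨-, h, -⟩
    simp [h16, h4] at hneg; omega
  · refine Ev.skip ?_
    rw [if_neg]
    rintro ⟨h, -, -⟩
    simp [h16, h3] at hneg; omega

end BitRAM

/-! ### Searching one block -/

namespace BitRAM

open Coppersmith RootFinding

/-- Tests all candidates that belong to the breakpoints in the array 11. -/
def candProg : Prog := forLoop 13 (2 * v 5 * v 5) (block [
  .assign 16 (1 + v 2 * (v 10 + (.get 11 ((2 * v 5 - 1) * (2 * v 5 + 1) + v 13 / v 5) + v 13 % v 5))),
  checkProg])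

/-- Searches a block that starts at the point in variable 10 and moves on to the next block. -/
def bodyProg : Prog := block [.assign 12 ((v 8 + v 10) % v 0), binomProg, scaleProg, lllProg, segsProg,
  candProg, .assign 10 (v 10 + v 6)]

/-- The variables and tables that hold the parameters. -/
structure Setup (n N r s T T' d H : ℕ) (u : ℤ) (σ : State) : Prop where
  var0 : σ.var 0 = N
  var1 : σ.var 1 = r
  var2 : σ.var 2 = s
  var3 : σ.var 3 = T
  var4 : σ.var 4 = T'
  var5 : σ.var 5 = d
  var6 : σ.var 6 = H
  var7 : σ.var 7 = n
  var8 : σ.var 8 = u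
  arr8 : ∀ t < d, σ.arr 8 t = (H : ℤ) ^ t
  arr12 : ∀ t ≤ n, σ.arr 12 t = (N : ℤ) ^ t

variable {n N r s T T' d H : ℕ} {u : ℤ} {R B : ℕ} {σ : State} {Q : State → Prop}

theorem Setup.same {p : Prog} {τ : State} (h : Setup n N r s T T' d H u σ) (hS : Same p σ τ)
    (hv : ∀ x < 9, p.touchesVar x = false) (h8 : p.touchesArr 8 = false)
    (h12 : p.touchesArr 12 = false) : Setup n N r s T T' d H u τ :=
  ⟨by rw [hS.var 0 (hv 0 (by norm_num)), h.var0], by rw [hS.var 1 (hv 1 (by norm_num)), h.var1],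
    by rw [hS.var 2 (hv 2 (by norm_num)), h.var2], by rw [hS.var 3 (hv 3 (by norm_num)), h.var3],
    by rw [hS.var 4 (hv 4 (by norm_num)), h.var4], by rw [hS.var 5 (hv 5 (by norm_num)), h.var5],
    by rw [hS.var 6 (hv 6 (by norm_num)), h.var6], by rw [hS.var 7 (hv 7 (by norm_num)), h.var7],
    by rw [hS.var 8 (hv 8 (by norm_num)), h.var8], fun t ht => by rw [hS.arr 8 h8, h.arr8 t ht],
    fun t ht => by rw [hS.arr 12 h12, h.arr12 t ht]⟩

-- Only membership in the output is tracked, because the same number can be reached from several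
-- breakpoints and be written more than once.
open Classical in
theorem candProg_spec (h : Ctx n N r s T T' d H) (hs : Setup n N r s T T' d H u σ) {X : ℕ}
    (hX : σ.var 10 = X) (hXN : X ≤ N)
    (hC : ∀ i ≤ 2 * d, 0 ≤ segTable (σ.arr 11) d (2 * d - 1) i ∧ segTable (σ.arr 11) d (2 * d - 1) i ≤ H)
    (hQ : ∀ τ, Same candProg σ τ →
      (∀ p, p ∈ τ.out ↔ p ∈ σ.out ∨ Good N r T T' p ∧ ∃ i < 2 * d, ∃ t < d,
        p = 1 + s * (X + (segTable (σ.arr 11) d (2 * d - 1) i + t))) → Q τ) :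
    Ev (cap n) (cap n) candProg σ Q := by
  have hd := h.d_pos
  have hc := h.loop_le.2.2.1
  suffices hmain : Ev (cap n) (cap n) candProg σ (fun τ => ∀ p, p ∈ τ.out ↔ p ∈ σ.out ∨
      Good N r T T' p ∧ ∃ k < 2 * d * d,
        p = 1 + s * (X + (segTable (σ.arr 11) d (2 * d - 1) (k / d) + (k % d : ℕ)))) by
    refine hmain.conseq fun τ h1 _ h2 => hQ τ h1 fun p => (h2 p).trans ?_
    refine or_congr_right (and_congr_right fun _ => ⟨?_, ?_⟩)
    · rintro ⟨k, hk, e⟩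
      exact ⟨k / d, Nat.div_lt_of_lt_mul (by linarith), k % d, Nat.mod_lt _ hd, e⟩
    · rintro ⟨i, hi, t, ht, e⟩
      refine ⟨i * d + t, ?_, ?_⟩
      · have : (i + 1) * d ≤ 2 * d * d := Nat.mul_le_mul_right _ hi
        rw [add_mul] at this; omega
      · rw [mul_comm i d, Nat.mul_add_div hd, Nat.div_eq_of_lt ht, add_zero, Nat.mul_add_mod,
          Nat.mod_eq_of_lt ht, e]
  refine Ev.forLoop (I := fun j τ => ∀ p, p ∈ τ.out ↔ p ∈ σ.out ∨ Good N r T T' p ∧ ∃ k < j,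
    p = 1 + s * (X + (segTable (σ.arr 11) d (2 * d - 1) (k / d) + (k % d : ℕ)))) (2 * d * d) hc
    (le_two_pow_of_le_self hc) rfl ?_ (fun p => by simp) ?_ fun τ _ _ h => h
  · intro τ hτ
    simp [hτ.var 5 rfl, hs.var5]
  · intro k hk τ _ hτ hkv hI
    have hsτ : Setup n N r s T T' d H u τ := hs.same hτ
      (by intro x hx; interval_cases x <;> rfl) rfl rfl
    have v10 : τ.var 10 = X := by rw [hτ.var 10 rfl, hX]
    have a11 : τ.arr 11 = σ.arr 11 := hτ.arr 11 rfl
    have hkd : k / d < 2 * d := Nat.div_lt_of_lt_mul (by linarith)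
    have hCk := hC (k / d) hkd.le
    set c := segTable (σ.arr 11) d (2 * d - 1) (k / d) with hc_def
    have hm : k % d < d := Nat.mod_lt _ hd
    have hsp : (0 : ℤ) < s := by exact_mod_cast h.s_pos
    have hidx : (2 * (d : ℤ) - 1) * (2 * d + 1) + k / d = (((2 * d - 1) * (2 * d + 1) + k / d : ℕ) : ℤ) := by
      push_cast [Nat.cast_sub (show 1 ≤ 2 * d by omega)]; ring
    refine Ev.block_cons (Ev.assign (1 + s * (X + (c + (k % d : ℕ)))) ?_ (fun _ => ?_) ?_)
    · simp only [eval_add, eval_mul, eval_get, eval_sub, eval_div, eval_mod, eval_var, eval_one,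
        eval_ofNat, hsτ.var2, hsτ.var5, v10, hkv, a11, hidx]
      push_cast
      rfl
    · rw [abs_of_nonneg (by have := hCk.1; positivity)]
      have h1 : (1 + s * (N + (H + d)) : ℤ) ≤ 2 ^ cap n := by exact_mod_cast h.point_le_cap
      refine le_trans ?_ h1
      have h2 : (X : ℤ) ≤ N := by exact_mod_cast hXN
      have h3 : ((k % d : ℕ) : ℤ) ≤ d := by exact_mod_cast hm.le
      have h4 : (X : ℤ) + (c + (k % d : ℕ)) ≤ N + (H + d) := by linarith [hCk.2]
      have := mul_le_mul_of_nonneg_left h4 hsp.le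
      linarith
    refine Ev.block_one (checkProg_spec (N := N) (r := r) (T := T) (T' := T')
      (p := 1 + s * (X + (c + (k % d : ℕ)))) (by simp [hsτ.var0]) (by simp [hsτ.var1])
      (by simp [hsτ.var3]) (by simp [hsτ.var4]) (by simp) (by have := h.two_le_T; omega)
      (h.r_le.trans h.n_le) (le_two_pow_of_le_self (h.r_le.trans h.n_le))
      (h.pow_le.trans h.N_le_cap) ?_)
    intro ρ _ ho p
    rw [setVar_out, ho]
    have key : (∃ j < k + 1, p = 1 + s * (X + (segTable (σ.arr 11) d (2 * d - 1) (j / d) + (j % d : ℕ)))) ↔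
        (∃ j < k, p = 1 + s * (X + (segTable (σ.arr 11) d (2 * d - 1) (j / d) + (j % d : ℕ)))) ∨
          p = 1 + s * (X + (c + (k % d : ℕ))) := by
      constructor
      · rintro ⟨j, hj, e⟩
        rcases Nat.lt_succ_iff_lt_or_eq.1 hj with hj | rfl
        exacts [Or.inl ⟨j, hj, e⟩, Or.inr e]
      · rintro (⟨j, hj, e⟩ | e)
        exacts [⟨j, by omega, e⟩, ⟨k, by omega, e⟩]
    rw [key]
    split_ifs with hg
    · rw [setVar_out, List.mem_append, hI p, List.mem_singleton, and_or_left, or_assoc]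
      refine or_congr_right (or_congr_right ⟨fun e => ⟨e ▸ hg, e⟩, fun e => e.2⟩)
    · rw [setVar_out, hI p, and_or_left]
      refine or_congr_right ⟨Or.inl, ?_⟩
      rintro (e | ⟨h1, rfl⟩)
      exacts [e, absurd h1 hg]

/-- u + x = u p - (u s - 1) x, and p divides both terms because it divides N, which divides u s - 1.
The condition modulo s thus becomes a root modulo p of a monic linear polynomial. -/
theorem dvd_shift {p x : ℤ} (hr : 0 < r) (hu : u * s ≡ 1 [ZMOD N]) (hp : p ^ r ∣ N)
    (hx : p = 1 + s * x) : p ∣ (u + x) := by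
  have h1 : p ∣ (N : ℤ) := (dvd_pow_self p hr.ne').trans hp
  have h2 : p ∣ u * s - 1 := h1.trans (Int.ModEq.dvd hu.symm)
  have h3 : u + x = u * p - (u * s - 1) * x := by rw [hx]; ring
  rw [h3]
  exact dvd_sub (dvd_mul_left p u) (h2.mul_right x)

/-- Soundness is immediate from the test and from the shape 1 + s x of the candidates. Completeness
is where the short vector is used: its polynomial vanishes at every wanted y, so the breakpoints
lead to y. -/
theorem bodyProg_spec (h : Ctx n N r s T T' d H) (hs : Setup n N r s T T' d H u σ)
    (hu : u * s ≡ 1 [ZMOD N]) {X : ℕ} (hX : σ.var 10 = X) (hXN : X ≤ N)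
    (hQ : ∀ τ, Same bodyProg σ τ → τ.var 10 = (X + H : ℕ) → (∀ p ∈ σ.out, p ∈ τ.out) →
      (∀ p ∈ τ.out, p ∈ σ.out ∨ Good N r T T' p ∧ p ≡ 1 [ZMOD s]) →
      (∀ y : ℕ, y < H → Good N r T T' (1 + s * (X + y)) → (1 + s * (X + y) : ℤ) ∈ τ.out) → Q τ) :
    Ev (cap n) (cap n) bodyProg σ Q := by
  suffices hmain : Ev (cap n) (cap n) bodyProg σ (fun τ => τ.var 10 = (X + H : ℕ) ∧
      (∀ p ∈ σ.out, p ∈ τ.out) ∧ (∀ p ∈ τ.out, p ∈ σ.out ∨ Good N r T T' p ∧ p ≡ 1 [ZMOD s]) ∧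
      (∀ y : ℕ, y < H → Good N r T T' (1 + s * (X + y)) → (1 + s * (X + y) : ℤ) ∈ τ.out)) from
    hmain.conseq fun τ h1 _ h2 => hQ τ h1 h2.1 h2.2.1 h2.2.2.1 h2.2.2.2
  have hd := h.d_pos
  have hN := h.N_pos
  obtain ⟨c1, c2, c3, c4, c5⟩ := h.loop_le
  have hN' : (0 : ℤ) < N := by exact_mod_cast hN
  set a : ℤ := (u + X) % N with ha
  have ha0 : 0 ≤ a := Int.emod_nonneg _ hN'.ne'
  have haN : a < N := Int.emod_lt_of_pos _ hN'
  have hE : ∀ i < d, ∀ j < d, |entry N r n H a i j| ≤ entryBound n N d := fun i hi j _ => by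
    refine (abs_entry_le hN ha0 haN h.H_le hi).trans (le_of_eq ?_)
    rw [entryBound]; push_cast; rfl
  have hEB : ((entryBound n N d : ℕ) : ℤ) ≤ 2 ^ cap n := by exact_mod_cast h.entryBound_le_cap
  have hbin : ∀ i j, |binom a H i j| ≤ |entry N r n H a i j| := fun i j => by
    have e : entry N r n H a i j = N ^ (n - i / r) * binom a H i j := rfl
    rw [e, abs_mul, abs_of_nonneg (show (0 : ℤ) ≤ N ^ (n - i / r) by positivity)]
    exact le_mul_of_one_le_left (abs_nonneg _) (one_le_pow₀ (by omega))
  have hNc : (N : ℤ) ≤ 2 ^ cap n := by exact_mod_cast h.N_le_cap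
  refine Ev.block_cons (Ev.assign a (by simp [hs.var8, hs.var0, hX, ha])
    (fun _ => by rw [abs_of_nonneg ha0]; exact haN.le.trans hNc) ?_)
  have hs1 : Setup n N r s T T' d H u (σ.setVar 12 a) := by
    obtain ⟨b0, b1, b2, b3, b4, b5, b6, b7, b8, b9, b10⟩ := hs
    constructor <;> simpa
  refine Ev.block_cons (binomProg_spec (a := a) hs1.var5 hs1.var6 (by simp) hd c4
    (le_two_pow_of_le_self c4) (fun i hi j hj => (hbin i j).trans ((hE i hi j hj).trans hEB)) ?_)
  intro τ₁ hτ₁ ha7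
  have hs2 := hs1.same hτ₁ (by intro x hx; interval_cases x <;> rfl) rfl rfl
  refine Ev.block_cons (scaleProg_spec (N := N) (m := n) hs2.var1 hs2.var5 hs2.var7 ha7 hs2.arr12 hd c4
    (le_two_pow_of_le_self c4) (fun i hi j hj => (hE i hi j hj).trans hEB) ?_)
  intro τ₂ hτ₂ ha5
  have hs3 := hs2.same hτ₂ (by intro x hx; interval_cases x <;> rfl) rfl rfl
  have hinv := latInv_of_entry (E := (entryBound n N d : ℝ)) hN h.H_pos hd ha5
    (by exact_mod_cast h.one_le_entryBound) (fun i hi j hj => by exact_mod_cast hE i hi j hj)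
  have hG : ((d : ℝ) * (entryBound n N d : ℝ) ^ 2) ^ d = (gramBound n N d : ℝ) := by
    rw [gramBound]; push_cast; rfl
  rw [hG] at hinv
  refine Ev.block_cons (lllProg_spec hs3.var5 hd hinv c1 (le_two_pow_of_le_self c1)
    (by exact_mod_cast h.gram_nat_le) h.gram_pow_lt ?_)
  intro τ₃ hτ₃ hmem hne hsc hshort
  have hs4 := hs3.same hτ₃ (by intro x hx; interval_cases x <;> rfl) rfl rfl
  set w : ℕ → ℤ := fun j => τ₃.arr 5 j with hw
  have hrow : irow (τ₃.arr 5) d 0 = fun j : Fin d => w j := by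
    funext j; simp [irow, hw]
  rw [hrow] at hmem hne hshort
  have hroot : RootHyp (cap n) (cap n) τ₃ w H d (d * gramBound n N d) := by
    refine ⟨hs4.var5, hd, fun _ _ => rfl, hs4.arr8, fun j hj => ?_, c2, le_two_pow_of_le_self c2,
      h.H_le.trans h.N_le_cap, h.root_nat_le⟩
    have h1 := (sq_le_sc (τ₃.arr 5) d 0 hj).trans (hsc 0 hd)
    have h2 := abs_le_of_sq_le h1
    simp only [Nat.cast_zero, zero_mul, zero_add] at h2
    exact_mod_cast h2
  refine Ev.block_cons (segsProg_spec hroot hs4.var6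
    ((h.H_le.trans_lt h.N_lt).trans_le (Nat.pow_le_pow_right two_pos h.n_le)) ?_)
  intro τ₄ hτ₄ hcell
  have hs5 := hs4.same hτ₄ (by intro x hx; interval_cases x <;> rfl) rfl rfl
  have hHpos : (0 : ℤ) < H := by exact_mod_cast h.H_pos
  have v10 : τ₄.var 10 = X := by
    rw [hτ₄.var 10 rfl, hτ₃.var 10 rfl, hτ₂.var 10 rfl, hτ₁.var 10 rfl]; simpa using hX
  have ho : τ₄.out = σ.out := by
    rw [hτ₄.out rfl, hτ₃.out rfl, hτ₂.out rfl, hτ₁.out rfl]; rfl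
  refine Ev.block_cons (candProg_spec h hs5 v10 hXN (mem_Icc_of_cell hHpos.le hd le_rfl hcell) ?_)
  intro τ₅ hτ₅ hout
  rw [ho] at hout
  have hs6 := hs5.same hτ₅ (by intro x hx; interval_cases x <;> rfl) rfl rfl
  have v10' : τ₅.var 10 = X := by rw [hτ₅.var 10 rfl, v10]
  refine Ev.block_one (Ev.assign ((X + H : ℕ) : ℤ) (by simp [v10', hs6.var6]) (fun _ => ?_)
    ⟨by simp, fun p hp => (hout p).2 (Or.inl hp), fun p hp => ?_, fun y hy hg => ?_⟩)
  · refine abs_natCast_le (add_le_two_pow (hXN.trans h.N_lt.le) (h.H_le.trans h.N_lt.le) ?_)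
    have := Ctx.poly_le_cap h.n_pos 1 2 0 0 0 0 0 0 0 (by norm_num); omega
  · rcases (hout p).1 hp with hp | ⟨hg, i, -, t, -, e⟩
    · exact Or.inl hp
    · refine Or.inr ⟨hg, ?_⟩
      rw [e]
      exact (Int.modEq_iff_dvd.2 ⟨-(X + (segTable (τ₄.arr 11) d (2 * d - 1) i + t)), by ring⟩)
  · refine (hout _).2 (Or.inr ⟨hg, ?_⟩)
    -- For H = 1 no lattice argument is available, but y = 0 is a candidate anyway, since the first
    -- breakpoint is 0.
    rcases h.cond with h1 | h1
    · obtain rfl : y = 0 := by omega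
      refine ⟨0, by omega, 0, hd, ?_⟩
      rw [(hcell _ le_rfl 0 (by omega)).1 rfl]; simp
    -- Reducing u + X modulo N keeps the basis entries small. It preserves divisibility by p because
    -- p divides N.
    · have hdv : (1 + s * (X + y) : ℤ) ∣ a + y := by
        have h2 := dvd_shift h.r_pos hu hg.2.2 (x := X + y) rfl
        have h3 : (1 + s * (X + y) : ℤ) ∣ N := (dvd_pow_self _ h.r_pos.ne').trans hg.2.2
        have h4 : (N : ℤ) ∣ (u + X) - a := ⟨(u + X) / N, by
          have := Int.emod_add_mul_ediv (u + X) N; rw [ha]; linarith⟩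
        have h5 : a + y = (u + (X + y)) - ((u + X) - a) := by ring
        rw [h5]; exact dvd_sub h2 (h3.trans h4)
      have hz := eval_eq_zero hN h.r_pos hd h.n_pos h.H_pos h.le_pow h1 hmem
        (by exact_mod_cast hshort) hg.2.2 hg.1 hdv (by positivity) (by exact_mod_cast hy.le)
      have hev : (hpoly w H d).eval (y : ℤ) = 0 := by
        rw [eval_hpoly, ← hz, Fin.sum_univ_eq_sum_range
          (fun j => w j * ((H : ℤ) ^ (d - 1 - j) * (y : ℤ) ^ j))]
        exact Finset.sum_congr rfl fun j _ => mul_assoc _ _ _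
      have hwne : ∃ j < d, w j ≠ 0 := by
        obtain ⟨j, hj⟩ := Function.ne_iff.1 hne
        exact ⟨j, j.2, hj⟩
      obtain ⟨i, hi, t, ht, e⟩ := exists_candidate hHpos hd hwne hcell (y := y) (by positivity)
        (by exact_mod_cast hy) hev
      exact ⟨i, hi, t, ht, by rw [← e]⟩

end BitRAM

/-! ### Reading the input; power tables and the modular inverse -/

namespace BitRAM

variable {R B : ℕ} {σ : State} {Q : State → Prop}

theorem one_abs_le (B : ℕ) : |(1 : ℤ)| ≤ 2 ^ B := by rw [abs_one]; exact one_le_pow₀ (by norm_num)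

/-- Computes the number of nonzero cells at the beginning of array 0. -/
def lengthProg : Prog := .while (.get 0 (v 7)) (.assign 7 (v 7 + 1))

theorem binary_natCast (n i : ℕ) :
    binary n i = if i < n.size then (if n.testBit i then 2 else 1) else 0 := by
  simp [binary]

theorem lengthProg_spec {N : ℕ} (h0 : σ.arr 0 = binary N) (h7 : σ.var 7 = 0) (hR : N.size ≤ R)
    (hB : N.size ≤ 2 ^ B) (hQ : ∀ τ, Same lengthProg σ τ → τ.var 7 = N.size → Q τ) :
    Ev R B lengthProg σ Q := by
  refine Ev.while (I := fun k τ => τ.var 7 = k ∧ k ≤ N.size) ⟨by simp [h7], Nat.zero_le _⟩ ?_ ?_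
  · rintro k τ - hτ ⟨hk, -⟩ hpos
    rw [eval_get, eval_var, hk, hτ.arr 0 rfl, h0, binary_natCast] at hpos
    have hlt : k < N.size := by
      by_contra hge
      rw [if_neg hge] at hpos; exact lt_irrefl _ hpos
    refine ⟨hlt.trans_le hR, Ev.assign ((k + 1 : ℕ) : ℤ) (by simp [hk]) (fun _ => abs_natCast_le ?_)
      ⟨by simp, hlt⟩⟩
    omega
  · rintro k τ - hτ ⟨hk, hle⟩ hneg
    refine hQ τ (hτ.mono (fun _ h => h) (fun _ h => h) fun h => h) ?_
    rw [eval_get, eval_var, hk, hτ.arr 0 rfl, h0, binary_natCast] at hneg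
    have : ¬ k < N.size := by
      intro hlt
      rw [if_pos hlt] at hneg
      split_ifs at hneg <;> norm_num at hneg
    rw [hk, show k = N.size by omega]

/-- Stores in variable `x` the number whose binary expansion is in array `a`, cut off after as many
bits as variable 7 says. -/
def parseProg (a x : ℕ) : Prog := block [.assign x 0, .assign 21 1, forLoop 20 (v 7)
  (block [.assign x (v x + .get a (v 20) / 2 * v 21), .assign 21 (2 * v 21)])]

/-- Halving the cell codes 0, 1, 2 yields the bit itself, with 0 for a blank. -/
theorem binary_div_two (n i : ℕ) : binary n i / 2 = ((n.testBit i).toNat : ℤ) := by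
  rw [binary_natCast]
  split_ifs with h1 h2
  · simp [h2]
  · simp [h2]
  · have : n.testBit i = false :=
      Nat.testBit_eq_false_of_lt ((Nat.size_le.1 le_rfl).trans_le
        (Nat.pow_le_pow_right two_pos (not_lt.1 h1)))
    simp [this]

/-- Reading stops after n bits whatever the length of the input number, so the cost depends on the
length of N alone. -/
theorem parseProg_spec {a x m n : ℕ} (ha : σ.arr a = binary m) (h7 : σ.var 7 = n) (hx : x < 7)
    (hR : n ≤ R) (hB : n ≤ B)
    (hQ : ∀ τ, Same (parseProg a x) σ τ → τ.var x = (m % 2 ^ n : ℕ) → Q τ) :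
    Ev R B (parseProg a x) σ Q := by
  suffices hmain : Ev R B (parseProg a x) σ (fun τ => τ.var x = (m % 2 ^ n : ℕ)) from
    hmain.conseq fun τ h1 _ h2 => hQ τ h1 h2
  have e1 : ¬ 7 = x := by omega
  have e2 : ¬ x = 20 := by omega
  have e3 : ¬ x = 21 := by omega
  refine Ev.block_cons (Ev.assign 0 rfl (fun _ => by simp) ?_)
  refine Ev.block_cons (Ev.assign 1 rfl (fun _ => one_abs_le B) ?_)
  refine Ev.block_one (Ev.forLoop (I := fun k τ => τ.var x = (m % 2 ^ k : ℕ) ∧ τ.var 21 = (2 ^ k : ℕ)) n hR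
    (le_two_pow_of_le_self hB) ?_ ?_ ?_ ?_ ?_)
  · simp [block, Prog.touchesVar, e2]
  · intro τ hτ
    have := hτ.var 7 (by simp [forLoop, block, Prog.touchesVar]; omega)
    simp [this, h7, e1]
  · simp [e2, e3, Nat.mod_one]
  · rintro k hk τ - hτ hkv ⟨hI1, hI2⟩
    have haτ : τ.arr a = binary m := by
      rw [hτ.arr a (by simp [forLoop, block, Prog.touchesArr])]; simpa using ha
    have hb : (m % 2 ^ (k + 1) : ℕ) ≤ 2 ^ B :=
      (Nat.mod_lt _ (by positivity)).le.trans (Nat.pow_le_pow_right two_pos (by omega))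
    refine Ev.block_cons (Ev.assign ((m % 2 ^ (k + 1) : ℕ) : ℤ) ?_ (fun _ => abs_natCast_le hb) ?_)
    · simp only [eval_add, eval_mul, eval_div, eval_get, eval_var, eval_ofNat, hkv, haτ,
        binary_div_two, hI1, hI2]
      rw [Nat.mod_pow_succ, Nat.toNat_testBit]
      push_cast
      ring
    · refine Ev.block_one (Ev.assign ((2 ^ (k + 1) : ℕ) : ℤ) ?_ (fun _ => abs_natCast_le
        (Nat.pow_le_pow_right two_pos (by omega))) ?_)
      · have e4 : ¬ 21 = x := by omega
        simp only [eval_mul, eval_ofNat, eval_var, setVar_var, if_neg e4, hI2]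
        push_cast; ring
      · simp [e2, e3]
  · rintro τ - - ⟨h, -⟩
    exact h

/-- Stores the powers of variable `x` with exponents up to variable `y` in array `a`. -/
def powTable (a y x : ℕ) : Prog := block [.store a 0 1,
  forLoop 20 (v y) (.store a (v 20 + 1) (.get a (v 20) * v x))]

theorem powTable_spec {a x y n b : ℕ} (hx : σ.var x = b) (hy : σ.var y = n) (hx20 : x ≠ 20)
    (hy20 : y ≠ 20) (hR : n ≤ R) (hB : n ≤ B) (hb : 0 < b) (hpow : b ^ n ≤ 2 ^ B)
    (hQ : ∀ τ, Same (powTable a y x) σ τ → (∀ t ≤ n, τ.arr a t = (b : ℤ) ^ t) → Q τ) :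
    Ev R B (powTable a y x) σ Q := by
  suffices hmain : Ev R B (powTable a y x) σ (fun τ => ∀ t ≤ n, τ.arr a t = (b : ℤ) ^ t) from
    hmain.conseq fun τ h1 _ h2 => hQ τ h1 h2
  refine Ev.block_cons (Ev.store 0 1 rfl rfl (fun _ => one_abs_le B) ?_)
  refine Ev.block_one (Ev.forLoop (I := fun k τ => ∀ t ≤ k, τ.arr a t = (b : ℤ) ^ t) n hR
    (le_two_pow_of_le_self hB) rfl ?_ ?_ ?_ ?_)
  · intro τ hτ
    have := hτ.var y (by simp [forLoop, Prog.touchesVar, hy20.symm])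
    simp [this, hy]
  · intro t ht
    obtain rfl : t = 0 := by omega
    simp
  · intro k hk τ _ hτ hkv hI
    have vx : τ.var x = b := by
      rw [hτ.var x (by simp [forLoop, Prog.touchesVar, hx20.symm])]; simpa using hx
    refine Ev.store ((k + 1 : ℕ) : ℤ) ((b : ℤ) ^ (k + 1)) (by simp [hkv]) ?_ (fun _ => ?_) ?_
    · rw [eval_mul, eval_get, eval_var, eval_var, hkv, hI k le_rfl, vx, pow_succ]
    · rw [abs_of_nonneg (by positivity)]
      exact_mod_cast (Nat.pow_le_pow_right hb hk).trans hpow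
    · intro t ht
      rw [setVar_arr, setArr_arr_self]
      rcases Nat.lt_or_eq_of_le ht with ht | rfl
      · rw [Function.update_of_ne (by exact_mod_cast ht.ne)]; exact hI t (by omega)
      · rw [Function.update_self]
  · exact fun τ _ _ h => h

/-- The Euclidean algorithm: stores an inverse of variable 2 modulo variable 0 in variable 8. -/
def invProg : Prog := block [.assign 22 (v 0), .assign 23 (v 2 % v 0), .assign 8 0, .assign 24 1,
  .while (v 23) (block [.assign 25 (v 22 / v 23), .assign 26 (v 22 % v 23), .assign 22 (v 23),
    .assign 23 (v 26), .assign 26 ((v 8 - v 25 * v 24) % v 0), .assign 8 (v 24), .assign 24 (v 26)])]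

theorem invProg_spec {N s n : ℕ} (h0 : σ.var 0 = N) (h2 : σ.var 2 = s) (hN : 0 < N) (hNn : N < 2 ^ n)
    (hg : Nat.gcd N s = 1) (hR : 2 * n ≤ R) (hB : n ≤ B)
    (hQ : ∀ τ, Same invProg σ τ → τ.var 8 * s ≡ 1 [ZMOD N] → Q τ) :
    Ev R B invProg σ Q := by
  suffices hmain : Ev R B invProg σ (fun τ => τ.var 8 * s ≡ 1 [ZMOD N]) from
    hmain.conseq fun τ h1 _ h2 => hQ τ h1 h2
  have hNB : N ≤ 2 ^ B := hNn.le.trans (Nat.pow_le_pow_right two_pos hB)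
  have hbd : ∀ {k : ℕ}, k ≤ N → |(k : ℤ)| ≤ 2 ^ B := fun h => abs_natCast_le (h.trans hNB)
  refine Ev.block_cons (Ev.assign (N : ℤ) (by simp [h0]) (fun _ => hbd le_rfl) ?_)
  refine Ev.block_cons (Ev.assign ((s % N : ℕ) : ℤ) (by simp [h0, h2])
    (fun _ => hbd (Nat.mod_lt _ hN).le) ?_)
  refine Ev.block_cons (Ev.assign 0 rfl (fun _ => by simp) ?_)
  refine Ev.block_cons (Ev.assign 1 rfl (fun _ => one_abs_le B) ?_)
  -- The product of consecutive remainders at least halves in each round, since 2 (a mod b) ≤ a.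
  -- Starting from at most N ^ 2 this allows at most 2 n rounds. The cofactors are reduced modulo N
  -- to keep them small.
  refine Ev.block_one (Ev.while (I := fun k τ => ∃ a b : ℕ, τ.var 22 = a ∧ τ.var 23 = b ∧ b < a ∧
    a ≤ N ∧ Nat.gcd a b = 1 ∧ a * b * 2 ^ k ≤ N ^ 2 ∧ |τ.var 24| ≤ N ∧ τ.var 8 * s ≡ a [ZMOD N] ∧
    τ.var 24 * s ≡ b [ZMOD N]) ?_ ?_ ?_)
  · refine ⟨N, s % N, by simp, by simp, Nat.mod_lt _ hN, le_rfl, ?_, ?_, ?_, ?_, ?_⟩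
    · rw [Nat.gcd_comm, ← Nat.gcd_rec, hg]
    · have := (Nat.mod_lt s hN).le
      rw [pow_zero, mul_one, sq]; exact Nat.mul_le_mul_left _ this
    · have : (1 : ℤ) ≤ N := by exact_mod_cast hN
      simpa using this
    · simp [Int.ModEq]
    · simp [Int.ModEq]
  · rintro k τ - hτ ⟨a, b, ha, hb, hba, haN, hgab, hk, h24, hc0, hc1⟩ hpos
    have hb0 : 0 < b := by
      rw [eval_var, hb] at hpos; exact_mod_cast hpos
    have v0 : τ.var 0 = N := by rw [hτ.var 0 rfl]; simp [h0]
    refine ⟨?_, ?_⟩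
    · have h1 : 2 ^ k ≤ a * b * 2 ^ k := Nat.le_mul_of_pos_left _ (Nat.mul_pos (hb0.trans hba) hb0)
      have h2 : N ^ 2 < (2 ^ n) ^ 2 := Nat.pow_lt_pow_left hNn two_ne_zero
      rw [← pow_mul] at h2
      have := (Nat.pow_lt_pow_iff_right (a := 2) (by norm_num)).1 ((h1.trans hk).trans_lt h2)
      omega
    have hm := Nat.mod_lt a hb0
    have hdm := Nat.div_add_mod a b
    have hq1 : 1 ≤ a / b := (Nat.one_le_div_iff hb0).2 hba.le
    have hN' : (0 : ℤ) < N := by exact_mod_cast hN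
    set c := (τ.var 8 - (a / b : ℕ) * τ.var 24) % (N : ℤ) with hc
    have hcn := Int.emod_nonneg (τ.var 8 - (a / b : ℕ) * τ.var 24) hN'.ne'
    have hcl := Int.emod_lt_of_pos (τ.var 8 - (a / b : ℕ) * τ.var 24) hN'
    rw [← hc] at hcn hcl
    have hNB' : (N : ℤ) ≤ 2 ^ B := by exact_mod_cast hNB
    refine Ev.block_cons (Ev.assign ((a / b : ℕ) : ℤ) (by simp [ha, hb])
      (fun _ => hbd ((Nat.div_le_self _ _).trans haN)) ?_)
    refine Ev.block_cons (Ev.assign ((a % b : ℕ) : ℤ) (by simp [ha, hb]) (fun _ => hbd (by omega)) ?_)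
    refine Ev.block_cons (Ev.assign (b : ℤ) (by simp [hb]) (fun _ => hbd (by omega)) ?_)
    refine Ev.block_cons (Ev.assign ((a % b : ℕ) : ℤ) (by simp) (fun _ => hbd (by omega)) ?_)
    refine Ev.block_cons (Ev.assign c (by simp [v0, hc])
      (fun _ => by rw [abs_of_nonneg hcn]; omega) ?_)
    refine Ev.block_cons (Ev.assign (τ.var 24) (by simp) (fun _ => h24.trans hNB') ?_)
    refine Ev.block_one (Ev.assign c (by simp) (fun _ => by rw [abs_of_nonneg hcn]; omega) ?_)
    refine ⟨b, a % b, by simp, by simp, hm, by omega, ?_, ?_, ?_, by simpa using hc1, ?_⟩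
    · rw [← hgab, Nat.gcd_comm a b, Nat.gcd_comm b (a % b), ← Nat.gcd_rec]
    · refine le_trans ?_ hk
      have h1 : b ≤ b * (a / b) := Nat.le_mul_of_pos_right _ hq1
      have h2 : 2 * (a % b) ≤ a := by omega
      calc b * (a % b) * 2 ^ (k + 1) = b * (2 * (a % b)) * 2 ^ k := by ring
        _ ≤ b * a * 2 ^ k := by gcongr
        _ = _ := by ring
    · simp only [setVar_var, if_true]
      rw [abs_of_nonneg hcn]; exact hcl.le
    · simp only [setVar_var, if_true]
      have h1 : c * s ≡ (τ.var 8 - (a / b : ℕ) * τ.var 24) * s [ZMOD N] :=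
        (Int.mod_modEq _ _).mul_right _
      refine h1.trans ?_
      have h2 := hc0.sub (hc1.mul_left ((a / b : ℕ) : ℤ))
      have h3 : (a : ℤ) - (a / b : ℕ) * b = (a % b : ℕ) := by
        have : ((b * (a / b) + a % b : ℕ) : ℤ) = a := by rw [hdm]
        push_cast at this ⊢
        linarith
      rw [h3] at h2
      convert h2 using 1; ring
  · rintro k τ - hτ ⟨a, b, ha, hb, -, -, hgab, -, -, hc0, -⟩ hneg
    have hb0 : b = 0 := by
      rw [eval_var, hb] at hneg; simpa using hneg
    rw [hb0, Nat.gcd_zero_right] at hgab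
    simpa [hgab] using hc0

end BitRAM

/-! ### Choosing the dimension and the block length -/

namespace BitRAM

variable {R B : ℕ} {σ : State} {Q : State → Prop}

/-- Computes the dimension of the lattice in variable 5. -/
def dimProg : Prog := block [.assign 5 0, .assign 27 1,
  .while (.get 12 (v 7) - v 27) (block [.assign 27 (v 27 * v 3), .assign 5 (v 5 + 1)])]

/-- The loop finds the least d with N ^ n ≤ T ^ d. Minimality is kept as T ^ (d - 1) < N ^ n, which
the running time needs, and with T ≥ 2 it gives d ≤ n ^ 2. -/
theorem dimProg_spec {N T n : ℕ} (h3 : σ.var 3 = T) (h7 : σ.var 7 = n) (h12 : σ.arr 12 n = (N : ℤ) ^ n)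
    (hn : 0 < n) (hN : N < 2 ^ n) (hT : 2 ≤ T) (hTN : T ≤ N) (hR : n ^ 2 ≤ R) (hB : n ^ 2 + n ≤ B)
    (hQ : ∀ τ, Same dimProg σ τ → (∃ d : ℕ, τ.var 5 = d ∧ 0 < d ∧ d ≤ n ^ 2 ∧ N ^ n ≤ T ^ d ∧
      T ^ (d - 1) < N ^ n) → Q τ) :
    Ev R B dimProg σ Q := by
  suffices hmain : Ev R B dimProg σ (fun τ => ∃ d : ℕ, τ.var 5 = d ∧ 0 < d ∧ d ≤ n ^ 2 ∧
      N ^ n ≤ T ^ d ∧ T ^ (d - 1) < N ^ n) from hmain.conseq fun τ h1 _ h2 => hQ τ h1 h2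
  have hNn : N ^ n < 2 ^ n ^ 2 := by rw [sq, pow_mul]; exact Nat.pow_lt_pow_left hN hn.ne'
  have hlt : ∀ {k}, T ^ k < N ^ n → k < n ^ 2 := fun h =>
    (Nat.pow_lt_pow_iff_right (a := 2) (by norm_num)).1 (((Nat.pow_le_pow_left hT _).trans_lt h).trans hNn)
  refine Ev.block_cons (Ev.assign 0 rfl (fun _ => by simp) ?_)
  refine Ev.block_cons (Ev.assign 1 rfl (fun _ => one_abs_le B) ?_)
  refine Ev.block_one (Ev.while (I := fun k τ => τ.var 5 = k ∧ τ.var 27 = (T ^ k : ℕ) ∧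
    (0 < k → T ^ (k - 1) < N ^ n)) (by simp) ?_ ?_)
  · rintro k τ - hτ ⟨hk, hp, -⟩ hpos
    have v3 : τ.var 3 = T := by rw [hτ.var 3 rfl]; simp [h3]
    have v7 : τ.var 7 = n := by rw [hτ.var 7 rfl]; simp [h7]
    have a12 : τ.arr 12 n = (N : ℤ) ^ n := by rw [hτ.arr 12 rfl]; simpa using h12
    have hc : T ^ k < N ^ n := by
      rw [eval_sub, eval_get, eval_var, eval_var, v7, a12, hp, sub_pos] at hpos
      exact_mod_cast hpos
    have hk2 := hlt hc
    refine ⟨hk2.trans_le hR, ?_⟩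
    have hb : T ^ (k + 1) ≤ 2 ^ B := by
      rw [pow_succ]
      refine (Nat.mul_le_mul (hc.trans hNn).le (hTN.trans hN.le)).trans ?_
      rw [← pow_add]; exact Nat.pow_le_pow_right two_pos hB
    refine Ev.block_cons (Ev.assign ((T ^ (k + 1) : ℕ) : ℤ) (by simp [hp, v3, pow_succ])
      (fun _ => abs_natCast_le hb) ?_)
    refine Ev.block_one (Ev.assign ((k + 1 : ℕ) : ℤ) (by simp [hk])
      (fun _ => abs_natCast_le (le_two_pow_of_le_self (by omega))) ?_)
    exact ⟨by simp, by simp, fun _ => by simpa using hc⟩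
  · rintro k τ - hτ ⟨hk, hp, hprev⟩ hneg
    have v7 : τ.var 7 = n := by rw [hτ.var 7 rfl]; simp [h7]
    have a12 : τ.arr 12 n = (N : ℤ) ^ n := by rw [hτ.arr 12 rfl]; simpa using h12
    have hc : N ^ n ≤ T ^ k := by
      rw [eval_sub, eval_get, eval_var, eval_var, v7, a12, hp, sub_pos, not_lt] at hneg
      exact_mod_cast hneg
    have hk0 : 0 < k := by
      rcases Nat.eq_zero_or_pos k with rfl | h
      · rw [pow_zero] at hc
        have := Nat.one_lt_pow hn.ne' (show 1 < N by omega); omega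
      · exact h
    refine ⟨k, hk, hk0, ?_, hc, hprev hk0⟩
    have := hlt (hprev hk0); omega

/-- Computes the number in variable 9 that the length of the blocks is compared with. -/
def limitProg : Prog := block [.assign 9 1, forLoop 20 (v 1 * (v 7 - 1)) (.assign 9 (v 9 * v 3))]

theorem limitProg_spec {T r n : ℕ} (h1 : σ.var 1 = r) (h3 : σ.var 3 = T) (h7 : σ.var 7 = n)
    (hn : 0 < n) (hT : 0 < T) (hR : r * (n - 1) ≤ R) (hRB : R ≤ 2 ^ B)
    (hB : T ^ (r * (n - 1)) ≤ 2 ^ B)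
    (hQ : ∀ τ, Same limitProg σ τ → τ.var 9 = (T ^ (r * (n - 1)) : ℕ) → Q τ) :
    Ev R B limitProg σ Q := by
  suffices hmain : Ev R B limitProg σ (fun τ => τ.var 9 = (T ^ (r * (n - 1)) : ℕ)) from
    hmain.conseq fun τ h1 _ h2 => hQ τ h1 h2
  refine Ev.block_cons (Ev.assign 1 rfl (fun _ => one_abs_le B) ?_)
  refine Ev.block_one (Ev.forLoop (I := fun k τ => τ.var 9 = (T ^ k : ℕ)) (r * (n - 1)) hR
    (hR.trans hRB) rfl ?_ (by simp) ?_ fun τ _ _ h => h)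
  · intro τ hτ
    simp [hτ.var 1 rfl, hτ.var 7 rfl, h1, h7, Nat.cast_sub (show 1 ≤ n from hn)]
  · intro k hk τ _ hτ _ hI
    have v3 : τ.var 3 = T := by rw [hτ.var 3 rfl]; simp [h3]
    exact Ev.assign ((T ^ (k + 1) : ℕ) : ℤ) (by simp [hI, v3, pow_succ])
      (fun _ => abs_natCast_le ((Nat.pow_le_pow_right hT hk).trans hB)) (by simp)

/-- Computes the length of the blocks in variable 6. -/
def lenProg : Prog := block [.assign 6 1, .assign 27 (v 5), .assign 28 1,
  forLoop 20 (v 5) (block [.assign 27 (v 27 * 4), .assign 28 (v 28 * 2)]),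
  .while (v 9 - v 27 + 1) (block [.assign 6 (v 6 * 2), .assign 27 (v 27 * v 28)])]

/-- H is doubled while d * (4 H) ^ d ≤ M. The last successful test gives the condition of the
lattice argument for the final H, and the failing test shows that H is maximal up to a factor 2. -/
theorem lenProg_spec {M d x : ℕ} (h5 : σ.var 5 = d) (h9 : σ.var 9 = M) (hd : 0 < d) (hM : M < 2 ^ x)
    (hR : d + x ≤ R) (hB : 3 * d + x ≤ B)
    (hQ : ∀ τ, Same lenProg σ τ → (∃ H : ℕ, τ.var 6 = H ∧ 0 < H ∧ (H = 1 ∨ d * (2 * H) ^ d ≤ M) ∧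
      M < d * (4 * H) ^ d) → Q τ) :
    Ev R B lenProg σ Q := by
  suffices hmain : Ev R B lenProg σ (fun τ => ∃ H : ℕ, τ.var 6 = H ∧ 0 < H ∧
      (H = 1 ∨ d * (2 * H) ^ d ≤ M) ∧ M < d * (4 * H) ^ d) from
    hmain.conseq fun τ h1 _ h2 => hQ τ h1 h2
  have hdB : d ≤ 2 ^ B := le_two_pow_of_le_self (by omega)
  have h4 : ∀ k ≤ d, d * 4 ^ k ≤ 2 ^ B := fun k hk => by
    rw [show 4 = 2 ^ 2 by norm_num, ← pow_mul]
    exact mul_le_two_pow (le_two_pow_of_le_self le_rfl) le_rfl (show d + 2 * k ≤ B by omega)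
  refine Ev.block_cons (Ev.assign 1 rfl (fun _ => one_abs_le B) ?_)
  refine Ev.block_cons (Ev.assign (d : ℤ) (by simp [h5]) (fun _ => abs_natCast_le hdB) ?_)
  refine Ev.block_cons (Ev.assign 1 rfl (fun _ => one_abs_le B) ?_)
  refine Ev.block_cons (Ev.forLoop (I := fun k τ => τ.var 27 = (d * 4 ^ k : ℕ) ∧
    τ.var 28 = (2 ^ k : ℕ)) d (by omega) hdB rfl ?_ (by simp) ?_ ?_)
  · intro τ hτ
    simp [hτ.var 5 rfl, h5]
  · rintro k hk τ - hτ - ⟨hI1, hI2⟩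
    refine Ev.block_cons (Ev.assign ((d * 4 ^ (k + 1) : ℕ) : ℤ) ?_
      (fun _ => abs_natCast_le (h4 _ hk)) ?_)
    · simp [hI1]; ring
    · exact Ev.block_one (Ev.assign ((2 ^ (k + 1) : ℕ) : ℤ) (by simp [hI2, pow_succ])
        (fun _ => abs_natCast_le (Nat.pow_le_pow_right two_pos (by omega))) (by simp))
  · rintro τ hτ - ⟨h27, h28⟩
    have v6 : τ.var 6 = 1 := by rw [hτ.var 6 rfl]; simp
    have v9 : τ.var 9 = M := by rw [hτ.var 9 rfl]; simp [h9]
    refine Ev.block_one (Ev.while (I := fun k τ => ∃ H : ℕ, H = 2 ^ k ∧ τ.var 6 = H ∧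
      τ.var 27 = (d * (4 * H) ^ d : ℕ) ∧ τ.var 28 = (2 ^ d : ℕ) ∧ (H = 1 ∨ d * (2 * H) ^ d ≤ M))
      ⟨1, by simp, by simp [v6], by simp [h27], by simp [h28], Or.inl rfl⟩ ?_ ?_)
    · rintro k ρ - hρ ⟨H, hH, u6, u27, u28, -⟩ hpos
      have u9 : ρ.var 9 = M := by rw [hρ.var 9 rfl, v9]
      have hc : d * (4 * H) ^ d ≤ M := by
        rw [eval_add, eval_sub, eval_var, eval_var, eval_one, u9, u27] at hpos
        have : ((d * (4 * H) ^ d : ℕ) : ℤ) ≤ (M : ℕ) := by omega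
        exact_mod_cast this
      have hHle : 4 * H ≤ M := (Nat.le_self_pow hd.ne' _).trans
        ((Nat.le_mul_of_pos_left _ hd).trans hc)
      have hkx : k < x := by
        have : 2 ^ k < 2 ^ x := by omega
        exact (Nat.pow_lt_pow_iff_right (by norm_num)).1 this
      have hxB : 2 ^ x ≤ 2 ^ B := Nat.pow_le_pow_right two_pos (by omega)
      have e : d * (4 * (2 * H)) ^ d = d * (4 * H) ^ d * 2 ^ d := by
        rw [mul_assoc, ← mul_pow]; congr 2; ring
      refine ⟨by omega, Ev.block_cons (Ev.assign ((2 * H : ℕ) : ℤ) (by simp [u6, mul_comm])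
        (fun _ => abs_natCast_le (by omega)) ?_)⟩
      refine Ev.block_one (Ev.assign ((d * (4 * (2 * H)) ^ d : ℕ) : ℤ) ?_
        (fun _ => abs_natCast_le ?_) ?_)
      · rw [e]; simp [u27, u28]
      · rw [e]; exact mul_le_two_pow (hc.trans hM.le) le_rfl (by omega)
      · refine ⟨2 * H, by rw [hH, pow_succ]; ring, by simp, by simp, by simp [u28], Or.inr ?_⟩
        rw [show 2 * (2 * H) = 4 * H by ring]; exact hc
    · rintro k ρ - hρ ⟨H, hH, u6, u27, -, hor⟩ hneg
      have u9 : ρ.var 9 = M := by rw [hρ.var 9 rfl, v9]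
      refine ⟨H, u6, by rw [hH]; positivity, hor, ?_⟩
      rw [eval_add, eval_sub, eval_var, eval_var, eval_one, u9, u27] at hneg
      have : ((M : ℕ) : ℤ) < (d * (4 * H) ^ d : ℕ) := by omega
      exact_mod_cast this

end BitRAM

/-! ### The preparation phase -/

namespace BitRAM

variable {N r s T T' n : ℕ} {σ : State} {Q : State → Prop}

/-- Computes all parameters from the input. -/
def paramProg : Prog := block [invProg, powTable 12 7 0, dimProg, limitProg, lenProg, powTable 8 5 6,
  .assign 10 ((v 3 + v 2 - 2) / v 2), .assign 11 ((v 4 - 1) / v 2)]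

theorem paramProg_spec (h0 : σ.var 0 = N) (h1 : σ.var 1 = r) (h2 : σ.var 2 = s) (h3 : σ.var 3 = T)
    (h4 : σ.var 4 = T') (h7 : σ.var 7 = n) (hg : Nat.gcd N s = 1) (hN : N < 2 ^ n) (hr : 0 < r)
    (hs : 0 < s) (hsn : s < 2 ^ n) (hT : 2 ≤ T) (hTT : T ≤ T') (hpow : T' ^ r ≤ N)
    (hQ : ∀ τ, Same paramProg σ τ → (∃ d H : ℕ, ∃ u : ℤ, Ctx n N r s T T' d H ∧
      Setup n N r s T T' d H u τ ∧ u * s ≡ 1 [ZMOD N] ∧ τ.var 10 = ((T + s - 2) / s : ℕ) ∧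
      τ.var 11 = ((T' - 1) / s : ℕ) ∧ T ^ (r * (n - 1)) < d * (4 * H) ^ d ∧ T ^ (d - 1) < N ^ n) → Q τ) :
    Ev (cap n) (cap n) paramProg σ Q := by
  have hTN : T ≤ N := hTT.trans ((Nat.le_self_pow hr.ne' T').trans hpow)
  have hT'N : T' ≤ N := (Nat.le_self_pow hr.ne' T').trans hpow
  have hn : 0 < n := by
    rcases Nat.eq_zero_or_pos n with rfl | h
    · rw [pow_zero] at hN; omega
    · exact h
  have hrn : r ≤ n := by
    have h1 : 2 ^ r < 2 ^ n := ((Nat.pow_le_pow_left (hT.trans hTT) r).trans hpow).trans_lt hN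
    exact ((Nat.pow_lt_pow_iff_right (by norm_num)).1 h1).le
  have hcap := Ctx.poly_le_cap hn 4 4 4 4 0 0 0 0 0 (by norm_num)
  have hx : r * (n - 1) ≤ n ^ 2 := by
    rw [sq]; exact Nat.mul_le_mul hrn (Nat.sub_le _ _)
  have hM : T ^ (r * (n - 1)) < 2 ^ (n ^ 3 + 1) := by
    refine lt_of_le_of_lt (pow_le_two_pow (hTN.trans hN.le) hx (x := n ^ 3) (by ring_nf; rfl)) ?_
    exact Nat.pow_lt_pow_right (by norm_num) (Nat.lt_succ_self _)
  suffices hmain : Ev (cap n) (cap n) paramProg σ (fun τ => ∃ d H : ℕ, Ctx n N r s T T' d H ∧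
      τ.var 5 = d ∧ τ.var 6 = H ∧ τ.var 8 * s ≡ 1 [ZMOD N] ∧ (∀ t ≤ d, τ.arr 8 t = (H : ℤ) ^ t) ∧
      (∀ t ≤ n, τ.arr 12 t = (N : ℤ) ^ t) ∧ τ.var 10 = ((T + s - 2) / s : ℕ) ∧
      τ.var 11 = ((T' - 1) / s : ℕ) ∧ T ^ (r * (n - 1)) < d * (4 * H) ^ d ∧ T ^ (d - 1) < N ^ n) by
    refine hmain.conseq fun τ hS _ ⟨d, H, hc, e5, e6, e8, a8, a12, e10, e11, i1, i2⟩ => hQ τ hS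
      ⟨d, H, τ.var 8, hc, ⟨by rw [hS.var 0 rfl, h0], by rw [hS.var 1 rfl, h1], by rw [hS.var 2 rfl, h2],
        by rw [hS.var 3 rfl, h3], by rw [hS.var 4 rfl, h4], e5, e6, by rw [hS.var 7 rfl, h7], rfl,
        fun t ht => a8 t ht.le, a12⟩, e8, e10, e11, i1, i2⟩
  refine Ev.block_cons (invProg_spec h0 h2 (by omega) hN hg (by omega) (by omega) fun τ₁ s₁ e8 => ?_)
  refine Ev.block_cons (powTable_spec (b := N) (n := n) (by rw [s₁.var 0 rfl, h0])
    (by rw [s₁.var 7 rfl, h7]) (by norm_num) (by norm_num) (by omega) (by omega) (by omega)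
    (pow_le_two_pow hN.le le_rfl (by nlinarith)) fun τ₂ s₂ a12 => ?_)
  have b3 : τ₂.var 3 = T := by rw [s₂.var 3 rfl, s₁.var 3 rfl, h3]
  have b7 : τ₂.var 7 = n := by rw [s₂.var 7 rfl, s₁.var 7 rfl, h7]
  refine Ev.block_cons (dimProg_spec b3 b7 (a12 n le_rfl) hn hN hT hTN (by omega) (by omega) ?_)
  rintro τ₃ s₃ ⟨d, e5, hd, hdn, hNT, hTN'⟩
  have c1 : τ₃.var 1 = r := by rw [s₃.var 1 rfl, s₂.var 1 rfl, s₁.var 1 rfl, h1]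
  have c3 : τ₃.var 3 = T := by rw [s₃.var 3 rfl, b3]
  have c7 : τ₃.var 7 = n := by rw [s₃.var 7 rfl, b7]
  refine Ev.block_cons (limitProg_spec c1 c3 c7 hn (by omega) (by omega) Nat.lt_two_pow_self.le
    (hM.le.trans (Nat.pow_le_pow_right two_pos (by omega))) fun τ₄ s₄ e9 => ?_)
  have d5 : τ₄.var 5 = d := by rw [s₄.var 5 rfl, e5]
  refine Ev.block_cons (lenProg_spec d5 e9 hd hM (by omega) (by omega) ?_)
  rintro τ₅ s₅ ⟨H, e6, hH, hor, hlt⟩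
  -- In the second case (2 H) ^ d ≤ T ^ (r n) ≤ N ^ n ≤ T ^ d, hence 2 H ≤ T.
  have hHN : H ≤ N := by
    rcases hor with h | h
    · omega
    · have h5 : (2 * H) ^ d ≤ T ^ d := by
        calc (2 * H) ^ d ≤ d * (2 * H) ^ d := Nat.le_mul_of_pos_left _ hd
          _ ≤ T ^ (r * (n - 1)) := h
          _ ≤ T ^ (r * n) := Nat.pow_le_pow_right (by omega) (Nat.mul_le_mul_left _ (Nat.sub_le _ _))
          _ = (T ^ r) ^ n := by rw [pow_mul]
          _ ≤ N ^ n := Nat.pow_le_pow_left ((Nat.pow_le_pow_left hTT r).trans hpow) n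
          _ ≤ _ := hNT
      have := (Nat.pow_le_pow_iff_left hd.ne').1 h5
      omega
  refine Ev.block_cons (powTable_spec (b := H) (n := d) e6 (by rw [s₅.var 5 rfl, d5]) (by norm_num)
    (by norm_num) (by omega) (by omega) hH
    (pow_le_two_pow (hHN.trans hN.le) hdn (x := cap n) (by
      have : n * n ^ 2 = n ^ 3 := by ring
      omega)) fun τ₆ s₆ a8 => ?_)
  have f2 : τ₆.var 2 = s := by
    rw [s₆.var 2 rfl, s₅.var 2 rfl, s₄.var 2 rfl, s₃.var 2 rfl, s₂.var 2 rfl, s₁.var 2 rfl, h2]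
  have f3 : τ₆.var 3 = T := by rw [s₆.var 3 rfl, s₅.var 3 rfl, s₄.var 3 rfl, c3]
  have f4 : τ₆.var 4 = T' := by
    rw [s₆.var 4 rfl, s₅.var 4 rfl, s₄.var 4 rfl, s₃.var 4 rfl, s₂.var 4 rfl, s₁.var 4 rfl, h4]
  have hNc : N ≤ 2 ^ cap n := hN.le.trans (Nat.pow_le_pow_right two_pos (by omega))
  have hX : (T + s - 2) / s ≤ T := by
    refine Nat.div_le_of_le_mul ?_
    obtain ⟨k, rfl⟩ : ∃ k, T = k + 1 := ⟨T - 1, by omega⟩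
    have := Nat.le_mul_of_pos_left k hs
    rw [mul_add]; omega
  -- Variables 10 and 11 receive the least and the greatest x with T ≤ 1 + s x ≤ T': the ceiling of
  -- (T - 1) / s and the floor of (T' - 1) / s.
  refine Ev.block_cons (Ev.assign (((T + s - 2) / s : ℕ) : ℤ) ?_
    (fun _ => abs_natCast_le ((hX.trans hTN).trans hNc)) ?_)
  · simp [f2, f3, Nat.cast_sub (show 2 ≤ T + s by omega)]
  refine Ev.block_one (Ev.assign (((T' - 1) / s : ℕ) : ℤ) ?_ (fun _ => abs_natCast_le
    (((Nat.div_le_self _ _).trans (Nat.sub_le _ _)).trans (hT'N.trans hNc))) ?_)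
  · simp [f2, f4, Nat.cast_sub (show 1 ≤ T' by omega)]
  refine ⟨d, H, ⟨hn, hN, hr, hT, hTT, hpow, hs, hsn, hd, hdn, hH, hHN, hNT, hor⟩, ?_, ?_, ?_, ?_, ?_,
    by simp, by simp, hlt, hTN'⟩
  · simp [s₆.var 5 rfl, s₅.var 5 rfl, d5]
  · simp [s₆.var 6 rfl, e6]
  · simpa [s₆.var 8 rfl, s₅.var 8 rfl, s₄.var 8 rfl, s₃.var 8 rfl, s₂.var 8 rfl] using e8
  · simpa using a8
  · simpa [s₆.arr 12 rfl, s₅.arr 12 rfl, s₄.arr 12 rfl, s₃.arr 12 rfl] using a12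

/-- Reads the input and prepares the search. -/
def setupProg : Prog := block [lengthProg, .assign 11 (0 - 1), parseProg 0 0, .ite (v 0 - 1)
  (block [parseProg 1 1, parseProg 3 3, parseProg 4 4, .ite (.get 2 (v 7)) .skip
    (block [parseProg 2 2, paramProg])])
  (.write 1)]

/-- The result of the preparation. -/
inductive Prepared (N r s T T' n : ℕ) (τ : State) : Prop
  | one (h : N = 1) (hout : τ.out = [1]) (h10 : τ.var 10 = 0) (h11 : τ.var 11 = -1)
  | none (h : 2 ≤ N) (hs : 2 ^ n ≤ s) (hout : τ.out = []) (h10 : τ.var 10 = 0) (h11 : τ.var 11 = -1)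
  | some (d H : ℕ) (u : ℤ) (hc : Ctx n N r s T T' d H) (hs : Setup n N r s T T' d H u τ)
      (hu : u * s ≡ 1 [ZMOD N]) (hout : τ.out = []) (h10 : τ.var 10 = ((T + s - 2) / s : ℕ))
      (h11 : τ.var 11 = ((T' - 1) / s : ℕ)) (hH : T ^ (r * (n - 1)) < d * (4 * H) ^ d)
      (hd : T ^ (d - 1) < N ^ n)

/-- Unlike r, T and T', the number s may be far longer than N. Cell n of its expansion is nonblank
exactly when 2 ^ n ≤ s. In that case s exceeds N, nothing is to be output, and s is not read.
Variables 10 and 11 then hold 0 and -1, which makes the main loop stop at once; the same happens for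
N = 1. -/
theorem setupProg_spec (hN : 0 < N) (hg : Nat.gcd N s = 1) (hr : 0 < r) (hs : 0 < s)
    (hT : 2 ≤ N → 2 ≤ T) (hTT : T ≤ T') (hpow : T' ^ r ≤ N) (hn : n = N.size)
    (hQ : ∀ τ, Prepared N r s T T' n τ → Q τ) :
    Ev (cap n) (cap n) setupProg (input [N, r, s, T, T']) Q := by
  have hNn : N < 2 ^ n := by rw [hn]; exact Nat.lt_size_self N
  have hn0 : 0 < n := by rw [hn]; exact Nat.size_pos.2 hN
  have hcap := Ctx.poly_le_cap hn0 4 4 4 4 0 0 0 0 0 (by norm_num)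
  have hmod : ∀ {k}, k ≤ N → k % 2 ^ n = k := fun h => Nat.mod_eq_of_lt (h.trans_lt hNn)
  set σ := input [N, r, s, T, T'] with hσ
  refine Ev.block_cons (lengthProg_spec (N := N) rfl rfl (by omega) (le_two_pow_of_le_self (by omega))
    fun τ₁ s₁ e7 => ?_)
  rw [← hn] at e7
  refine Ev.block_cons (Ev.assign (-1) (by simp) (fun _ => by rw [abs_neg]; exact one_abs_le _) ?_)
  refine Ev.block_cons (parseProg_spec (a := 0) (x := 0) (m := N) (n := n) (by simp [s₁.arr 0 rfl, hσ, input])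
    (by simp [e7]) (by norm_num) (by omega) (by omega) fun τ₂ s₂ e0 => ?_)
  rw [hmod le_rfl] at e0
  have o₂ : τ₂.out = [] := by rw [s₂.out rfl, setVar_out, s₁.out rfl]; rfl
  have f10 : τ₂.var 10 = 0 := by simp [s₂.var 10 rfl, s₁.var 10 rfl, hσ, input]
  have f11 : τ₂.var 11 = -1 := by simp [s₂.var 11 rfl]
  have f7 : τ₂.var 7 = n := by simp [s₂.var 7 rfl, e7]
  have harr : ∀ i < 5, τ₂.arr i = σ.arr i := by
    intro i hi
    have h1 : (parseProg 0 0).touchesArr i = false := by interval_cases i <;> rfl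
    have h2 : lengthProg.touchesArr i = false := by interval_cases i <;> rfl
    rw [s₂.arr i h1, setVar_arr, s₁.arr i h2]
  refine Ev.block_one (Ev.ite (fun hpos => ?_) fun hneg => ?_)
  · have hN2 : 2 ≤ N := by
      simp [e0] at hpos; omega
    have hT2 := hT hN2
    have hT'N : T' ≤ N := (Nat.le_self_pow hr.ne' T').trans hpow
    have hrn : r < 2 ^ n := by
      have h1 : 2 ^ r ≤ N := (Nat.pow_le_pow_left (hT2.trans hTT) r).trans hpow
      exact (Nat.lt_two_pow_self.trans_le h1).trans hNn
    refine Ev.block_cons (parseProg_spec (a := 1) (x := 1) (m := r) (n := n)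
      (by rw [harr 1 (by norm_num)]; rfl) f7 (by norm_num) (by omega) (by omega) fun τ₃ s₃ e1 => ?_)
    refine Ev.block_cons (parseProg_spec (a := 3) (x := 3) (m := T) (n := n)
      (by rw [s₃.arr 3 rfl, harr 3 (by norm_num)]; rfl) (by rw [s₃.var 7 rfl, f7]) (by norm_num)
      (by omega) (by omega) fun τ₄ s₄ e3 => ?_)
    refine Ev.block_cons (parseProg_spec (a := 4) (x := 4) (m := T') (n := n)
      (by rw [s₄.arr 4 rfl, s₃.arr 4 rfl, harr 4 (by norm_num)]; rfl)
      (by rw [s₄.var 7 rfl, s₃.var 7 rfl, f7]) (by norm_num)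
      (by omega) (by omega) fun τ₅ s₅ e4 => ?_)
    rw [Nat.mod_eq_of_lt hrn] at e1
    rw [hmod (hTT.trans hT'N)] at e3
    rw [hmod hT'N] at e4
    have g7 : τ₅.var 7 = n := by rw [s₅.var 7 rfl, s₄.var 7 rfl, s₃.var 7 rfl, f7]
    have ga : τ₅.arr 2 = binary s := by
      rw [s₅.arr 2 rfl, s₄.arr 2 rfl, s₃.arr 2 rfl, harr 2 (by norm_num)]; rfl
    have go : τ₅.out = [] := by rw [s₅.out rfl, s₄.out rfl, s₃.out rfl, o₂]
    refine Ev.block_one (Ev.ite (fun hpos => Ev.skip (hQ _ (.none hN2 ?_ go ?_ ?_))) fun hneg => ?_)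
    · rw [eval_get, eval_var, g7, ga, binary_natCast] at hpos
      have : n < s.size := by
        by_contra h
        rw [if_neg h] at hpos; exact lt_irrefl _ hpos
      exact Nat.lt_size.1 this
    · rw [s₅.var 10 rfl, s₄.var 10 rfl, s₃.var 10 rfl, f10]
    · rw [s₅.var 11 rfl, s₄.var 11 rfl, s₃.var 11 rfl, f11]
    · have hsn : s < 2 ^ n := by
        rw [eval_get, eval_var, g7, ga, binary_natCast] at hneg
        refine Nat.size_le.1 (not_lt.1 fun h => ?_)
        rw [if_pos h] at hneg
        split_ifs at hneg <;> norm_num at hneg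
      refine Ev.block_cons (parseProg_spec (a := 2) (x := 2) (m := s) (n := n) ga g7 (by norm_num)
        (by omega) (by omega) fun τ₆ s₆ e2 => ?_)
      rw [Nat.mod_eq_of_lt hsn] at e2
      refine Ev.block_one (paramProg_spec (N := N) (r := r) (s := s) (T := T) (T' := T') (n := n)
        (by rw [s₆.var 0 rfl, s₅.var 0 rfl, s₄.var 0 rfl, s₃.var 0 rfl, e0])
        (by rw [s₆.var 1 rfl, s₅.var 1 rfl, s₄.var 1 rfl, e1]) e2
        (by rw [s₆.var 3 rfl, s₅.var 3 rfl, e3]) (by rw [s₆.var 4 rfl, e4]) (by rw [s₆.var 7 rfl, g7])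
        hg hNn hr hs hsn hT2 hTT hpow ?_)
      rintro τ₇ s₇ ⟨d, H, u, hc, hset, hu, h10, h11, hH, hd⟩
      exact hQ _ (.some d H u hc hset hu (by rw [s₇.out rfl, s₆.out rfl, go]) h10 h11 hH hd)
  · have hN1 : N = 1 := by
      simp [e0] at hneg; omega
    exact Ev.write 1 rfl (hQ _ (.one hN1 (by simp [o₂]) (by simpa using f10) (by simpa using f11)))

end BitRAM

/-! ### The whole algorithm -/

namespace BitRAM

variable {N r s T T' n d H : ℕ} {u : ℤ} {σ : State}

/-- The whole algorithm. -/
def mainProg : Prog := .seq setupProg (.while (v 11 - v 10 + 1) bodyProg)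

theorem bdd_input (l : List ℕ) {B : ℕ} (hB : 1 ≤ B) : Bdd B (input l) := by
  have h2 : (2 : ℤ) ≤ 2 ^ B := le_self_pow₀ (by norm_num) (by omega)
  refine ⟨fun x => by simp [input], fun a i => le_trans ?_ h2⟩
  simp only [input, binary]
  split_ifs <;> simp

/-- The numbers that the algorithm has to output. -/
def Wanted (N r s T T' : ℕ) (p : ℤ) : Prop :=
  (T : ℤ) ≤ p ∧ p ≤ T' ∧ p ^ r ∣ (N : ℤ) ∧ p ≡ 1 [ZMOD s]

/-- After k rounds exactly the x from X₀ to X₀ + k H - 1 have been covered. The last block may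
extend beyond X₁, which is harmless because candidates are compared with T'. -/
theorem loop_spec (h : Ctx n N r s T T' d H) (hs : Setup n N r s T T' d H u σ)
    (hu : u * s ≡ 1 [ZMOD N]) (ho : σ.out = []) (h10 : σ.var 10 = ((T + s - 2) / s : ℕ))
    (h11 : σ.var 11 = ((T' - 1) / s : ℕ)) :
    Run (cap n) (.while (v 11 - v 10 + 1) bodyProg) σ
      (((T' - T) / (H * s) + 1 + 1) * ((v 11 - v 10 + 1).fuel (cap n) + bodyProg.fuel (cap n) (cap n)))
      (fun τ => ∀ p, p ∈ τ.out ↔ Wanted N r s T T' p) := by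
  have hsp := h.s_pos
  have hT := h.two_le_T
  have hTT := h.T_le
  have hceil : T ≤ s * ((T + s - 2) / s) + 1 := by
    have h1 := Nat.div_add_mod (T + s - 2) s
    have h2 := Nat.mod_lt (T + s - 2) hsp
    omega
  have hfloor : s * ((T' - 1) / s) + 1 ≤ T' := by
    have := Nat.mul_div_le (T' - 1) s; omega
  set X₀ := (T + s - 2) / s with hX₀
  set X₁ := (T' - 1) / s with hX₁
  have htest : ∀ {τ : State} {X : ℕ}, Same bodyProg σ τ → τ.var 10 = X →
      (0 < (v 11 - v 10 + 1 : Expr).eval τ ↔ X ≤ X₁) := fun {τ X} hτ hX => by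
    rw [eval_add, eval_sub, eval_var, eval_var, eval_one, hτ.var 11 rfl, h11, hX]; omega
  refine Run.while (I := fun k τ => τ.var 10 = (X₀ + k * H : ℕ) ∧
    (∀ p ∈ τ.out, Wanted N r s T T' p) ∧
    (∀ x : ℕ, X₀ ≤ x → x < X₀ + k * H → Good N r T T' (1 + s * x) → (1 + s * x : ℤ) ∈ τ.out)) ?_ ?_ ?_
  · refine ⟨by simp [h10], by simp [ho], fun x h1 h2 => ?_⟩
    omega
  · rintro k τ - hτ ⟨hX, hsound, hcomp⟩ hpos
    have hXle := (htest hτ hX).1 hpos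
    have hsτ := hs.same hτ (by intro x hx; interval_cases x <;> rfl) rfl rfl
    refine ⟨?_, bodyProg_spec h hsτ hu hX ?_ ?_⟩
    -- Round k begins only if X₀ + k H ≤ X₁. As s X₀ ≥ T - 1 and s X₁ ≤ T' - 1, this gives k H s ≤
    -- T' - T.
    · refine Nat.lt_succ_of_le ((Nat.le_div_iff_mul_le (Nat.mul_pos h.H_pos hsp)).2 ?_)
      have h1 : s * (X₀ + k * H) ≤ s * X₁ := Nat.mul_le_mul_left _ hXle
      have h2 : s * (X₀ + k * H) = s * X₀ + k * (H * s) := by ring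
      omega
    · have : X₁ ≤ T' := (Nat.div_le_self _ _).trans (Nat.sub_le _ _)
      exact (hXle.trans this).trans h.le_N
    · intro ρ _ hXρ hmono hsd hcp
      refine ⟨by rw [hXρ]; push_cast; ring, fun p hp => ?_, fun x hx0 hx hg => ?_⟩
      · rcases hsd p hp with hp | ⟨hg, hm⟩
        · exact hsound p hp
        · exact ⟨hg.1, hg.2.1, hg.2.2, hm⟩
      · rcases Nat.lt_or_ge x (X₀ + k * H) with h1 | h1
        · exact hmono _ (hcomp x hx0 h1 hg)
        · obtain ⟨y, rfl⟩ := Nat.exists_eq_add_of_le h1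
          rw [Nat.cast_add] at hg ⊢
          exact hcp y (by rw [add_mul] at hx; omega) hg
  · rintro k τ - hτ ⟨hX, hsound, hcomp⟩ hneg p
    rw [htest hτ hX, not_le] at hneg
    refine ⟨hsound p, fun ⟨h1, h2, h3, h4⟩ => ?_⟩
    obtain ⟨z, hz⟩ := Int.modEq_iff_dvd.1 h4.symm
    have hsz : (0 : ℤ) < s := by exact_mod_cast hsp
    have hz0 : 0 ≤ z := by
      by_contra hlt
      have : s * z < 0 := mul_neg_of_pos_of_neg hsz (not_le.1 hlt)
      omega
    lift z to ℕ using hz0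
    obtain rfl : p = 1 + s * z := by omega
    have k1 : T ≤ 1 + s * z := by exact_mod_cast h1
    have k2 : 1 + s * z ≤ T' := by exact_mod_cast h2
    refine hcomp z ?_ (lt_of_le_of_lt ?_ hneg) ⟨h1, h2, h3⟩
    · rw [hX₀]
      refine Nat.lt_succ_iff.1 (Nat.div_lt_of_lt_mul ?_)
      rw [Nat.mul_succ]; omega
    · rw [hX₁, Nat.le_div_iff_mul_le hsp, mul_comm]; omega

theorem mainProg_spec (hN : 0 < N) (hg : Nat.gcd N s = 1) (hr : 0 < r) (hs : 0 < s) (hT0 : 0 < T)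
    (hT : 2 ≤ N → 2 ≤ T) (hTT : T ≤ T') (hpow : T' ^ r ≤ N) (hn : n = N.size) :
    ∃ τ t, Exec mainProg (input [N, r, s, T, T']) τ t ∧ (∀ p, p ∈ τ.out ↔ Wanted N r s T T' p) ∧
      (t ≤ 2 * mainProg.fuel (cap n) (cap n) ∨ ∃ d H, Ctx n N r s T T' d H ∧
        T ^ (r * (n - 1)) < d * (4 * H) ^ d ∧ T ^ (d - 1) < N ^ n ∧
        t ≤ ((T' - T) / (H * s) + 2) * mainProg.fuel (cap n) (cap n)) := by
  have hn0 : 0 < n := by rw [hn]; exact Nat.size_pos.2 hN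
  have hNn : N < 2 ^ n := by rw [hn]; exact Nat.lt_size_self N
  have hT'N : T' ≤ N := (Nat.le_self_pow hr.ne' T').trans hpow
  have hcap := Ctx.poly_le_cap hn0 1 0 0 0 0 0 0 0 0 (by norm_num)
  obtain ⟨τ, t, he, ht, hB, hP⟩ := setupProg_spec hN hg hr hs hT hTT hpow hn (fun _ h => h)
    (bdd_input _ (by omega))
  set F₁ := setupProg.fuel (cap n) (cap n) with hF₁
  set F₂ := (v 11 - v 10 + 1 : Expr).fuel (cap n) + bodyProg.fuel (cap n) (cap n) with hF₂
  -- The fuel of `mainProg` does not count the true number of blocks; it serves only as a polynomial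
  -- majorant for the setup together with one block.
  have hF : F₁ + F₂ ≤ mainProg.fuel (cap n) (cap n) := by
    change F₁ + F₂ ≤ F₁ + (cap n + 1) * F₂
    nlinarith [Nat.zero_le (cap n * F₂)]
  have hcost : (v 11 - v 10 + 1 : Expr).cost τ + len ((v 11 - v 10 + 1 : Expr).eval τ) ≤ F₂ :=
    (Expr.cost_add_len_le hB _).trans (Nat.le_add_right _ _)
  have hhalt : τ.var 10 = 0 → τ.var 11 = -1 → ∃ t, Exec mainProg (input [N, r, s, T, T']) τ t ∧
      t ≤ 2 * mainProg.fuel (cap n) (cap n) := fun h10 h11 =>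
    ⟨_, he.seq (.while_neg (by simp [h10, h11])), by omega⟩
  rcases hP with ⟨h1, ho, h10, h11⟩ | ⟨h2, hsn, ho, h10, h11⟩ |
    ⟨d, H, u, hc, hset, hu, ho, h10, h11, hH, hd⟩
  · obtain ⟨t, e1, e2⟩ := hhalt h10 h11
    refine ⟨τ, t, e1, fun p => ?_, Or.inl e2⟩
    have hT1 : T = 1 := by omega
    have hT1' : T' = 1 := by omega
    rw [ho, List.mem_singleton]
    constructor
    · rintro rfl
      exact ⟨by simp [hT1], by simp [hT1'], by simp, rfl⟩
    · rintro ⟨h3, h4, -⟩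
      rw [hT1] at h3; rw [hT1'] at h4
      omega
  · obtain ⟨t, e1, e2⟩ := hhalt h10 h11
    refine ⟨τ, t, e1, fun p => ?_, Or.inl e2⟩
    rw [ho]
    -- A wanted p would have s ∣ p - 1 with 0 < p - 1 < N < 2 ^ n ≤ s.
    refine ⟨fun h => absurd h (List.not_mem_nil), fun ⟨h3, h4, _, h5⟩ => ?_⟩
    have hT2 := hT h2
    have := Int.le_of_dvd (by omega) (Int.modEq_iff_dvd.1 h5.symm)
    omega
  · obtain ⟨ρ, t', e1, e2, -, e4⟩ := loop_spec hc hset hu ho h10 h11 hB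
    refine ⟨ρ, _, he.seq e1, e4, Or.inr ⟨d, H, hc, hH, hd, ?_⟩⟩
    rw [← hF₂] at e2
    refine le_trans ?_ (Nat.mul_le_mul_left _ hF)
    generalize F₁ = f₁, F₂ = f₂, (T' - T) / (H * s) = q at ht e2
    nlinarith [Nat.zero_le (q * f₁)]

end BitRAM

/-! ### The running time estimate -/

/-- The dimension and the length of the blocks are large enough. -/
theorem log_bound {t L h : ℝ} {m d r : ℝ} (ht : 0 < t) (hL : 0 < L) (hr : 1 ≤ r) (hrt : r * t ≤ L)
    (hLm : L ≤ m) (hd1 : (d - 1) * t ≤ m * L) (hd2 : m * L ≤ d * t) (hd : 0 < d)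
    (h1 : r * (m - 1) * t ≤ d + d * h) : r * t ^ 2 / L ≤ h + 3 := by
  have htL : t ≤ L := by nlinarith
  have hmd : m ≤ d := by
    by_contra hlt
    have h2 : d * t < m * t := mul_lt_mul_of_pos_right (not_le.1 hlt) ht
    have h3 : m * t ≤ m * L := mul_le_mul_of_nonneg_left htL (by linarith)
    linarith
  set A := r * t ^ 2 / L with hA
  have hAL : A * L = r * t * t := by rw [hA, div_mul_cancel₀ _ hL.ne']; ring
  have hA0 : 0 ≤ A := by positivity
  have hAt : A ≤ t := by
    refine le_of_mul_le_mul_right ?_ hL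
    rw [hAL, mul_comm t L]; exact mul_le_mul_of_nonneg_right hrt ht.le
  have h2 : A * d ≤ r * m * t + A := by
    refine le_of_mul_le_mul_right ?_ ht
    have h3 : A * ((d - 1) * t) ≤ A * (m * L) := mul_le_mul_of_nonneg_left hd1 hA0
    have h4 : A * (m * L) = r * m * t * t := by rw [mul_left_comm, hAL]; ring
    nlinarith
  -- The 3 collects three losses of at most d each: the summand d in `h1`, coming from log d ≤ d; r
  -- t ≤ L ≤ m ≤ d, from m - 1 in place of m; and A ≤ t ≤ d, from d - 1 in place of d.
  refine le_of_mul_le_mul_right ?_ hd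
  nlinarith

/-- With t = log T and L = log N one has r t ^ 2 / L = θ ^ 2 L / r, so `log_bound` says N ^ (θ ^ 2 /
r) ≤ 4 e ^ 3 H. Multiplying by N ^ α ≤ s and using T = N ^ (θ / r) gives the claim. -/
theorem exp_log_bound {N r s T m d H : ℕ} {α : ℝ} (hN : 2 ≤ N) (hr : 0 < r) (hT : 2 ≤ T)
    (hTr : T ^ r ≤ N) (hNm : N < 2 ^ m) (hd : 0 < d) (hH : 0 < H) (hs : (N : ℝ) ^ α ≤ s)
    (hdT : N ^ m ≤ T ^ d) (hTd : T ^ (d - 1) < N ^ m) (hc : T ^ (r * (m - 1)) < d * (4 * H) ^ d) :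
    (T : ℝ) ≤ 4 * Real.exp 3 * (H * s) * (N : ℝ) ^ (theta N r T * (1 - theta N r T) / r - α) := by
  have hN0 : (0 : ℝ) < N := by positivity
  have hT0 : (0 : ℝ) < T := by positivity
  have hH0 : (0 : ℝ) < H := by exact_mod_cast hH
  have hd0 : (0 : ℝ) < d := by exact_mod_cast hd
  have hr0 : (0 : ℝ) < r := by exact_mod_cast hr
  have hm : 0 < m := by
    rcases Nat.eq_zero_or_pos m with rfl | h
    · rw [pow_zero] at hNm; omega
    · exact h
  set L := Real.log N with hL
  set t := Real.log T with ht
  have hLpos : 0 < L := Real.log_pos (by exact_mod_cast hN)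
  have htpos : 0 < t := Real.log_pos (by exact_mod_cast hT)
  have hlog : ∀ {a b j k : ℕ}, 0 < a → a ^ j ≤ b ^ k → (j : ℝ) * Real.log a ≤ k * Real.log b := by
    intro a b j k ha h
    rw [← Real.log_pow, ← Real.log_pow]
    exact Real.log_le_log (by positivity) (by exact_mod_cast h)
  have h1 : (r : ℝ) * t ≤ L := by
    have := hlog (b := N) (k := 1) (show 0 < T by omega) (by simpa using hTr)
    simpa using this
  have h2 : L ≤ m := by
    have h3 := hlog (j := 1) (show 0 < N by omega) (by simpa using hNm.le)
    have h4 := Real.log_two_lt_d9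
    have h5 : (m : ℝ) * Real.log 2 ≤ m * 1 := by gcongr; linarith
    simp only [Nat.cast_one, one_mul, Nat.cast_ofNat] at h3
    linarith
  have h3 : ((d : ℝ) - 1) * t ≤ m * L := by
    have := hlog (show 0 < T by omega) hTd.le
    rwa [Nat.cast_sub (show 1 ≤ d from hd), Nat.cast_one] at this
  have h4 : (m : ℝ) * L ≤ d * t := hlog (by omega) hdT
  have h5 : (r : ℝ) * (m - 1) * t ≤ d + d * Real.log (4 * H) := by
    have h6 : ((T : ℝ) ^ (r * (m - 1))) ≤ d * (4 * H) ^ d := by exact_mod_cast hc.le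
    have h7 := Real.log_le_log (by positivity) h6
    rw [Real.log_pow, Real.log_mul (by positivity) (by positivity), Real.log_pow, Nat.cast_mul,
      Nat.cast_sub (show 1 ≤ m from hm), Nat.cast_one] at h7
    have h8 := Real.log_le_sub_one_of_pos hd0
    linarith
  have hA := log_bound htpos hLpos (by exact_mod_cast hr) h1 h2 h3 h4 hd0 h5
  set A := (r : ℝ) * t ^ 2 / L with hAdef
  have hexpA : Real.exp A ≤ 4 * H * Real.exp 3 := by
    calc Real.exp A ≤ Real.exp (Real.log (4 * H) + 3) := Real.exp_le_exp.2 hA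
      _ = _ := by rw [Real.exp_add, Real.exp_log (by positivity)]
  have hexpα : Real.exp (L * α) ≤ s := by rwa [← Real.rpow_def_of_pos hN0]
  have he : L * (theta N r T * (1 - theta N r T) / r - α) = t - A - L * α := by
    rw [theta, ← hL, ← ht, hAdef]
    field_simp
  rw [Real.rpow_def_of_pos hN0, ← hL, he]
  have h6 : (T : ℝ) = Real.exp A * Real.exp (L * α) * Real.exp (t - A - L * α) := by
    rw [← Real.exp_add, ← Real.exp_add, show A + L * α + (t - A - L * α) = t by ring, ht,
      Real.exp_log hT0]
  calc (T : ℝ) = Real.exp A * Real.exp (L * α) * Real.exp (t - A - L * α) := h6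
    _ ≤ (4 * H * Real.exp 3) * s * Real.exp (t - A - L * α) := by gcongr
    _ = _ := by ring

/-- 2 ^ (size - 1) ≤ N, and 1 / log 2 is less than 2. -/
theorem size_le_log {N : ℕ} (hN : 0 < N) : (N.size : ℝ) ≤ 2 * (1 + Real.log N) := by
  have h0 : 0 < N.size := Nat.size_pos.2 hN
  have h1 : 2 ^ (N.size - 1) ≤ N := Nat.lt_size.1 (by omega)
  have h2 : ((2 : ℝ) ^ (N.size - 1)) ≤ N := by exact_mod_cast h1
  have h3 := Real.log_le_log (by positivity) h2
  rw [Real.log_pow, Nat.cast_sub (show 1 ≤ N.size from h0), Nat.cast_one] at h3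
  have h4 := Real.log_two_gt_d9
  have h5 : (0 : ℝ) ≤ (N.size : ℝ) - 1 := by
    have : (1 : ℝ) ≤ N.size := by exact_mod_cast h0
    linarith
  nlinarith

namespace BitRAM

theorem fuel_le_log (p : Prog) : ∃ (C : ℝ) (k : ℕ), 0 ≤ C ∧ ∀ N : ℕ, 0 < N →
    (p.fuel (cap N.size) (cap N.size) : ℝ) ≤ C * (1 + Real.log N) ^ k := by
  obtain ⟨C, k, h⟩ := p.fuel_le
  refine ⟨C * (41 * 2 ^ 9) ^ (2 * k), 9 * (2 * k), by positivity, fun N hN => ?_⟩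
  -- 41 is the 40 of `cap` plus one for the summand 1, and 2 ^ 9 comes from `size_le_log`.
  have h1 : (cap N.size : ℝ) + 1 ≤ 41 * 2 ^ 9 * (1 + Real.log N) ^ 9 := by
    have h2 : (N.size : ℝ) ^ 9 ≤ (2 * (1 + Real.log N)) ^ 9 :=
      pow_le_pow_left₀ (by positivity) (size_le_log hN) 9
    have h3 : (1 : ℝ) ≤ (N.size : ℝ) ^ 9 := one_le_pow₀ (by exact_mod_cast Nat.size_pos.2 hN)
    rw [mul_pow] at h2
    rw [cap]; push_cast
    linarith
  calc (p.fuel (cap N.size) (cap N.size) : ℝ)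
      ≤ C * (((cap N.size : ℝ) + 1) * ((cap N.size : ℝ) + 1)) ^ k := by
        exact_mod_cast h (cap N.size) (cap N.size)
    _ = C * ((cap N.size : ℝ) + 1) ^ (2 * k) := by rw [← sq, ← pow_mul]
    _ ≤ C * (41 * 2 ^ 9 * (1 + Real.log N) ^ 9) ^ (2 * k) := by gcongr
    _ = _ := by rw [mul_pow, ← pow_mul]; ring

end BitRAM

theorem mainTheorem6 :
    ∃ (A : BitRAM.Prog) (C : ℝ) (k : ℕ),
      ∀ (N r s T T' : ℕ) (α : ℝ),
        0 < N → 0 < r → 0 < s → 0 < T → 0 < T' →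
        0 < α → α < 1 / 2 → (N : ℝ) ^ α ≤ (s : ℝ) → Nat.gcd N s = 1 →
        (4 : ℝ) ^ √(Real.log N / r) ≤ (T : ℝ) → T ≤ T' → (T' : ℝ) ≤ (N : ℝ) ^ (1 / (r : ℝ)) →
        ∃ (τ : BitRAM.State) (t : ℕ),
          BitRAM.Exec A (BitRAM.input [N, r, s, T, T']) τ t ∧
          (∀ p : ℤ, p ∈ τ.out ↔
            (T : ℤ) ≤ p ∧ p ≤ (T' : ℤ) ∧ p ^ r ∣ (N : ℤ) ∧ p ≡ 1 [ZMOD (s : ℤ)]) ∧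
          (t : ℝ) ≤
            (1 + ((T' : ℝ) - T) / T * (N : ℝ) ^ (theta N r T * (1 - theta N r T) / r - α)) *
              (C * (1 + Real.log N) ^ k) := by
  obtain ⟨C, k, hC, hF⟩ := BitRAM.fuel_le_log BitRAM.mainProg
  -- The factor 4 e ^ 3 is the loss in the block length from `exp_log_bound`. Being at least 2, it
  -- also absorbs the additive 2 in the number of blocks.
  refine ⟨BitRAM.mainProg, 4 * Real.exp 3 * C, k, ?_⟩
  intro N r s T T' α hN hr hs hT hT' hα hα' hsα hg hT4 hTT hT'r
  have hpow : T' ^ r ≤ N := by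
    have h1 : ((T' : ℝ)) ^ r ≤ ((N : ℝ) ^ (1 / (r : ℝ))) ^ r := pow_le_pow_left₀ (by positivity) hT'r r
    rw [one_div, Real.rpow_inv_natCast_pow (by positivity) hr.ne'] at h1
    exact_mod_cast h1
  -- For N ≥ 2 the exponent of 4 is positive, so T > 1; powers of T can then reach N ^ n.
  have hT2 : 2 ≤ N → 2 ≤ T := fun h => by
    have h1 : 0 < Real.log N := Real.log_pos (by exact_mod_cast h)
    have hr0 : (0 : ℝ) < r := by exact_mod_cast hr
    have h2 : (1 : ℝ) < 4 ^ √(Real.log N / r) :=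
      Real.one_lt_rpow (by norm_num) (Real.sqrt_pos.2 (by positivity))
    have : (1 : ℝ) < T := h2.trans_le hT4
    exact_mod_cast this
  obtain ⟨τ, t, he, hout, ht⟩ := BitRAM.mainProg_spec hN hg hr hs hT hT2 hTT hpow rfl
  refine ⟨τ, t, he, hout, ?_⟩
  have hlog : 0 ≤ Real.log N := Real.log_natCast_nonneg N
  have hFN := hF N hN
  set F : ℕ := BitRAM.mainProg.fuel (BitRAM.cap N.size) (BitRAM.cap N.size)
  set Y : ℝ := (N : ℝ) ^ (theta N r T * (1 - theta N r T) / r - α) with hY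
  have hY0 : 0 ≤ Y := by positivity
  have hT0 : (0 : ℝ) < T := by exact_mod_cast hT
  have hD : 0 ≤ (T' : ℝ) - T := sub_nonneg.2 (by exact_mod_cast hTT)
  have hZ : 0 ≤ ((T' : ℝ) - T) / T * Y := by positivity
  have hE : (2 : ℝ) ≤ 4 * Real.exp 3 := by
    have := Real.one_le_exp (show (0 : ℝ) ≤ 3 by norm_num)
    linarith
  have hG : (0 : ℝ) ≤ C * (1 + Real.log N) ^ k := by positivity
  suffices h : (t : ℝ) ≤ (4 * Real.exp 3 * (1 + ((T' : ℝ) - T) / T * Y)) * F by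
    refine h.trans ((mul_le_mul_of_nonneg_left hFN (by positivity)).trans (le_of_eq ?_))
    ring
  rcases ht with ht | ⟨d, H, hc, hH, hd, ht⟩
  · have h1 : (t : ℝ) ≤ 2 * F := by exact_mod_cast ht
    refine h1.trans (mul_le_mul_of_nonneg_right ?_ (by positivity))
    nlinarith
  · have hN2 : 2 ≤ N := hc.two_le_T.trans (hTT.trans hc.le_N)
    have hHs : (0 : ℝ) < H * s := by
      have := hc.H_pos
      positivity
    have key := exp_log_bound hN2 hr hc.two_le_T ((Nat.pow_le_pow_left hTT r).trans hpow) hc.N_lt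
      hc.d_pos hc.H_pos hsα hc.le_pow hd hH
    rw [← hY] at key
    have h1 : (t : ℝ) ≤ ((((T' - T) / (H * s) : ℕ) : ℝ) + 2) * F := by exact_mod_cast ht
    refine h1.trans (mul_le_mul_of_nonneg_right ?_ (by positivity))
    have h2 : (((T' - T) / (H * s) : ℕ) : ℝ) ≤ ((T' : ℝ) - T) / (H * s) := by
      refine Nat.cast_div_le.trans (le_of_eq ?_)
      rw [Nat.cast_sub hTT]; push_cast; rfl
    have h3 : ((T' : ℝ) - T) / (H * s) ≤ 4 * Real.exp 3 * (((T' : ℝ) - T) / T * Y) := by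
      rw [div_le_iff₀ hHs]
      calc (T' : ℝ) - T = ((T' : ℝ) - T) / T * T := (div_mul_cancel₀ _ hT0.ne').symm
        _ ≤ ((T' : ℝ) - T) / T * (4 * Real.exp 3 * (H * s) * Y) :=
          mul_le_mul_of_nonneg_left key (by positivity)
        _ = _ := by ring
    linarith
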